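/- **Setting.** Let $d>4$ be an integer. Fix constants $\epsilon,c_1,c_2,\eta>0$, $C\in\mathbb R$, $\alpha\in(0,1)$ and functions $K\mapsto C_e(K),\,C_g(K),\,L_1(K)$ of $K>1$. For $L>0$ put $\beta=L^{-d}$. Consider a function $D$ on $\mathbb Z^d$ and real-valued functions $f_n(k;z)$ $(n\ge 0)$, $g_n(k;z)$, $e_n(k;z)$ $(n\ge1)$ of $k\in[-\pi,\pi]^d$ and $z>0$ (all may depend on $L$) with $f_0=1$ and $$f_{n+1}(k;z)=\sum_{m=1}^{n+1}g_m(k;z)f_{n+1-m}(k;z)+e_{n+1}(k;z)\qquad(n\ge0).$$ Write $\hat D(k)=\sum_{x}D(x)e^{ik\cdot x}$, $a(k)=1-\hat D(k)$, $\sigma^2=-\nabla^2\hat D(0)$ and $\|h\|_1=(2\pi)^{-d}\int_{[-\pi,\pi]^d}|h(k)|\,dk$; $\nabla^2$ is the Laplacian in $k$. Assume the following. *Assumption S.* For every $n$ and $z>0$, $f_n(\cdot;z)$, $g_n(\cdot;z)$ and $e_n(\cdot;z)$ are invariant under sign changes of single components and under permutations of the components of $k$; $f_n(\cdot;z)$ and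 $g_n(\cdot;z)$ are $C^2$ near $k=0$; and for each $n$, $|f_n(k;z)|$ is bounded uniformly in $k\in[-\pi,\pi]^d$ and $z$ in some neighbourhood of $1$. *Assumption D.* $D\ge0$, $\sum_xD(x)=1$, $\sum_x|x|^{2+2\epsilon}D(x)<\infty$, $f_1(k;z)=z\hat D(k)$, $e_1(k;z)=0$, $\|D\|_\infty\le CL^{-d}$, $\sigma^2\le CL^2$, and, for $k\in[-\pi,\pi]^d$: $c_1L^2|k|^2\le a(k)\le c_2L^2|k|^2$ if $\|k\|_\infty\le L^{-1}$; $a(k)>\eta$ if $\|k\|_\infty\ge L^{-1}$; and $a(k)<2-\eta$ always. *Bounds.* For $K>0$, say that (F$_K$) holds at $(m,z)$ if $$\|\hat D^2f_m(\cdot;z)\|_1\le K\beta m^{-d/2},\qquad |f_m(0;z)|\le K,\qquad |\nabla^2f_m(0;z)|\le K\sigma^2m;$$ that (E$_K$) holds at $(m,z)$ if, for all $k\in[-\pi,\pi]^d$, $$|e_m(k;z)|\le C_e(K)\beta m^{-d/2},\qquad |e_m(k;z)-e_m(0;z)|\le C_e(K)a(k)\beta m^{-(d-2)/2};$$ and that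 (G$_K$) holds at $(m,z)$ if $g_m(0;\cdot)$ is differentiable at $z$ and, for all $k\in[-\pi,\pi]^d$ and $\epsilon'\in[0,\epsilon]$, $$|g_m(k;z)|\le C_g(K)\beta m^{-d/2},\quad |\nabla^2g_m(0;z)|\le C_g(K)\sigma^2\beta m^{-(d-2)/2},\quad |\partial_zg_m(0;z)|\le C_g(K)\beta m^{-(d-2)/2},$$ $$|g_m(k;z)-g_m(0;z)-a(k)\sigma^{-2}\nabla^2g_m(0;z)|\le C_g(K)\beta\,a(k)^{1+\epsilon'}m^{-(d-2-2\epsilon')/2}.$$ *Assumptions E and G.* For every $K>1$ with $L\ge L_1(K)$, every $n$ and every non-degenerate interval $I\subset[1-\alpha,1+\alpha]$: if (F$_K$) holds for all $z\in I$ and $1\le m\le n$, then (E$_K$) and (G$_K$) hold for all $z\in I$ and $2\le m\le n+1$. *Critical value.* Let $z_0=1$ and $z_{n+1}=1-\sum_{m=2}^{n+1}g_m(0;z_n)$ for $n\ge0$ (so $z_1=1$). The critical value of the recursion is $z_c=\lim_{n\to\infty}z_n$. **Theorem.** There is $L_0$, depending only on $d,\epsilon,C,c_1,c_2,\eta,\alpha$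 and the functions $C_e,C_g,L_1$, such that for every $L\ge L_0$ and all $D,f,g,e$ satisfying the recursion and Assumptions S, D, E, G for this $L$, the limit $z_c$ exists, and the following holds. Suppose that there is $p_c>0$ such that the susceptibility $\chi(z)=\sum_{n=0}^\infty f_n(0;z)$ converges and is positive for $z\in(0,p_c)$, with $\lim_{z\uparrow p_c}\chi(z)=\infty$. Suppose also that, for every $K>1$ with $L\ge L_1(K)$, if (F$_K$) holds at $z=z_c$ for all $m\ge1$, then (E$_K$) and (G$_K$) hold for all $m\ge2$ and all $z\in(0,z_c]$. Then $z_c=p_c$. -/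

import Mathlib

open Filter Topology MeasureTheory
open scoped ENNReal

noncomputable section

namespace LaceRec

/-- The dual space `ℝ^d`, with the Euclidean norm. -/
abbrev Dual (d : ℕ) : Type := EuclideanSpace ℝ (Fin d)

/-- The cube `[-π, π]^d`. -/
def cube (d : ℕ) : Set (Dual d) := {k | ∀ i, |k i| ≤ Real.pi}

/-- The Fourier transform `∑_x D(x) exp(i k·x)` of a function `D` on `ℤ^d`. -/
def fourier {d : ℕ} (D : (Fin d → ℤ) → ℝ) (k : Dual d) : ℂ :=
  ∑' x : Fin d → ℤ, (D x : ℂ) * Complex.exp (Complex.I * ((∑ i, k i * (x i : ℝ) : ℝ) : ℂ))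

/-- The (real) Fourier transform of the step distribution. Under `AssumptionD` the full Fourier
transform is real, being equal to `f 1 k 1`, so that nothing is lost in taking the real part. -/
def Dhat {d : ℕ} (D : (Fin d → ℤ) → ℝ) (k : Dual d) : ℝ := (fourier D k).re

/-- `a(k) = 1 - D̂(k)`. -/
def a {d : ℕ} (D : (Fin d → ℤ) → ℝ) (k : Dual d) : ℝ := 1 - Dhat D k

/-- The Laplacian `∇² h(0)` at the origin. -/
def lapZero {d : ℕ} (h : Dual d → ℝ) : ℝ := Laplacian.laplacian h (0 : Dual d)

/-- `σ² = -∇² D̂(0)`. -/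
def sigmaSq {d : ℕ} (D : (Fin d → ℤ) → ℝ) : ℝ := -lapZero (Dhat D)

/-- `β = L^{-d}`. -/
def beta (d : ℕ) (L : ℝ) : ℝ := (L ^ d)⁻¹

/-- `‖h‖₁ = (2π)^{-d} ∫_{[-π,π]^d} |h(k)| dk`, as an extended non-negative number. -/
def normOne {d : ℕ} (h : Dual d → ℝ) : ℝ≥0∞ :=
  ENNReal.ofReal (((2 * Real.pi) ^ d)⁻¹) * ∫⁻ k in cube d, ‖h k‖ₑ

/-- Invariance on the cube under sign changes of a component and permutations of components. -/
def LatticeSymmetric {d : ℕ} (h : Dual d → ℝ) : Prop :=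
  ∀ k ∈ cube d,
    (∀ i : Fin d, h (WithLp.toLp 2 (Function.update k.ofLp i (-(k i)))) = h k) ∧
    (∀ π : Equiv.Perm (Fin d), h (WithLp.toLp 2 (fun i => k (π i))) = h k)

/-- The recursion relation
`f_{n+1}(k;z) = ∑_{m=1}^{n+1} g_m(k;z) f_{n+1-m}(k;z) + e_{n+1}(k;z)`, with `f_0 = 1`. -/
def Recursion {d : ℕ} (f g e : ℕ → Dual d → ℝ → ℝ) : Prop :=
  ∀ z : ℝ, 0 < z → ∀ k ∈ cube d,
    f 0 k z = 1 ∧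
    ∀ n : ℕ, f (n + 1) k z =
      (∑ m ∈ Finset.Icc 1 (n + 1), g m k z * f (n + 1 - m) k z) + e (n + 1) k z

/-- Lattice symmetry, a weak boundedness of `f_n`, and the regularity at `k = 0` that gives
a meaning to `∇² f_n(0;z)` and `∇² g_n(0;z)`. -/
structure AssumptionS {d : ℕ} (f g e : ℕ → Dual d → ℝ → ℝ) : Prop where
  symm_f : ∀ n : ℕ, ∀ z : ℝ, 0 < z → LatticeSymmetric (fun k => f n k z)
  symm_g : ∀ n : ℕ, 1 ≤ n → ∀ z : ℝ, 0 < z → LatticeSymmetric (fun k => g n k z)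
  symm_e : ∀ n : ℕ, 1 ≤ n → ∀ z : ℝ, 0 < z → LatticeSymmetric (fun k => e n k z)
  bounded : ∀ n : ℕ, ∃ U ∈ 𝓝 (1 : ℝ), ∃ B : ℝ, ∀ z ∈ U, ∀ k ∈ cube d, |f n k z| ≤ B
  smooth_f : ∀ n : ℕ, ∀ z : ℝ, 0 < z → ContDiffAt ℝ 2 (fun k => f n k z) 0
  smooth_g : ∀ n : ℕ, 1 ≤ n → ∀ z : ℝ, 0 < z → ContDiffAt ℝ 2 (fun k => g n k z) 0

/-- The assumption on the step distribution `D = D_L`, with moment exponent `ε` and constants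
`C, c₁, c₂, η`. -/
structure AssumptionD {d : ℕ} (ε C c₁ c₂ η L : ℝ) (D : (Fin d → ℤ) → ℝ)
    (f e : ℕ → Dual d → ℝ → ℝ) : Prop where
  nonneg : ∀ x, 0 ≤ D x
  f_one : ∀ z : ℝ, 0 < z → ∀ k ∈ cube d, (f 1 k z : ℂ) = z * fourier D k
  e_one : ∀ z : ℝ, 0 < z → ∀ k ∈ cube d, e 1 k z = 0
  normalised : HasSum D 1
  moment : Summable fun x : Fin d → ℤ => (√(∑ i, (x i : ℝ) ^ 2)) ^ (2 + 2 * ε) * D x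
  sup_le : ∀ x, D x ≤ C * beta d L
  sigma_le : sigmaSq D ≤ C * L ^ 2
  small_k : ∀ k ∈ cube d, (∀ i, |k i| ≤ L⁻¹) →
    c₁ * L ^ 2 * ‖k‖ ^ 2 ≤ a D k ∧ a D k ≤ c₂ * L ^ 2 * ‖k‖ ^ 2
  large_k : ∀ k ∈ cube d, (∃ i, L⁻¹ ≤ |k i|) → η < a D k
  away_two : ∀ k ∈ cube d, a D k < 2 - η

/-- The bounds on `f_m(·;z)`, with constant `K`:
`‖D̂² f_m‖₁ ≤ K β m^{-d/2}`, `|f_m(0)| ≤ K`, `|∇² f_m(0)| ≤ K σ² m`. -/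
structure FBounds {d : ℕ} (L : ℝ) (D : (Fin d → ℤ) → ℝ) (f : ℕ → Dual d → ℝ → ℝ)
    (K : ℝ) (m : ℕ) (z : ℝ) : Prop where
  l1 : normOne (fun k => Dhat D k ^ 2 * f m k z) ≤
    ENNReal.ofReal (K * beta d L * (m : ℝ) ^ (-(d : ℝ) / 2))
  zero : |f m 0 z| ≤ K
  lap : |lapZero (fun k => f m k z)| ≤ K * sigmaSq D * m

/-- The bounds on `e_m(·;z)`, with constant `Ce`. -/
structure EBounds {d : ℕ} (L : ℝ) (D : (Fin d → ℤ) → ℝ) (e : ℕ → Dual d → ℝ → ℝ)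
    (Ce : ℝ) (m : ℕ) (z : ℝ) : Prop where
  sup : ∀ k ∈ cube d, |e m k z| ≤ Ce * beta d L * (m : ℝ) ^ (-(d : ℝ) / 2)
  diff : ∀ k ∈ cube d, |e m k z - e m 0 z| ≤
    Ce * a D k * beta d L * (m : ℝ) ^ (-((d : ℝ) - 2) / 2)

/-- The bounds on `g_m(·;z)`, with constant `Cg`. -/
structure GBounds {d : ℕ} (ε L : ℝ) (D : (Fin d → ℤ) → ℝ) (g : ℕ → Dual d → ℝ → ℝ)
    (Cg : ℝ) (m : ℕ) (z : ℝ) : Prop where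
  sup : ∀ k ∈ cube d, |g m k z| ≤ Cg * beta d L * (m : ℝ) ^ (-(d : ℝ) / 2)
  lap : |lapZero (fun k => g m k z)| ≤
    Cg * sigmaSq D * beta d L * (m : ℝ) ^ (-((d : ℝ) - 2) / 2)
  differentiable : DifferentiableAt ℝ (fun w => g m 0 w) z
  deriv_le : |deriv (fun w => g m 0 w) z| ≤
    Cg * beta d L * (m : ℝ) ^ (-((d : ℝ) - 2) / 2)
  taylor : ∀ ε' ∈ Set.Icc 0 ε, ∀ k ∈ cube d,
    |g m k z - g m 0 z - a D k * (sigmaSq D)⁻¹ * lapZero (fun k => g m k z)| ≤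
      Cg * beta d L * a D k ^ (1 + ε') * (m : ℝ) ^ (-((d : ℝ) - 2 - 2 * ε') / 2)

/-- For every `K > 1` with `L ≥ L₁(K)`: if, for some `n` and some interval `I ⊆ [1-α, 1+α]`,
the `f`-bounds with constant `K` hold for `z ∈ I` and `1 ≤ m ≤ n`, then the `e`-bounds with
constant `Ce(K)` hold for `z ∈ I` and `2 ≤ m ≤ n + 1`. -/
def AssumptionE {d : ℕ} (α : ℝ) (Ce L₁ : ℝ → ℝ) (L : ℝ) (D : (Fin d → ℤ) → ℝ)
    (f e : ℕ → Dual d → ℝ → ℝ) : Prop :=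
  ∀ K : ℝ, 1 < K → L₁ K ≤ L → ∀ n : ℕ, ∀ I : Set ℝ, I.OrdConnected → I.Nontrivial →
    I ⊆ Set.Icc (1 - α) (1 + α) →
    (∀ z ∈ I, ∀ m ∈ Finset.Icc 1 n, FBounds L D f K m z) →
    ∀ z ∈ I, ∀ m ∈ Finset.Icc 2 (n + 1), EBounds L D e (Ce K) m z

/-- The same for `g`, with constant `Cg(K)`. -/
def AssumptionG {d : ℕ} (α ε : ℝ) (Cg L₁ : ℝ → ℝ) (L : ℝ) (D : (Fin d → ℤ) → ℝ)
    (f g : ℕ → Dual d → ℝ → ℝ) : Prop :=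
  ∀ K : ℝ, 1 < K → L₁ K ≤ L → ∀ n : ℕ, ∀ I : Set ℝ, I.OrdConnected → I.Nontrivial →
    I ⊆ Set.Icc (1 - α) (1 + α) →
    (∀ z ∈ I, ∀ m ∈ Finset.Icc 1 n, FBounds L D f K m z) →
    ∀ z ∈ I, ∀ m ∈ Finset.Icc 2 (n + 1), GBounds ε L D g (Cg K) m z

/-- The sequence `z_0 = z_1 = 1`, `z_{n+1} = 1 - ∑_{m=2}^{n+1} g_m(0; z_n)`. -/
def zSeq {d : ℕ} (g : ℕ → Dual d → ℝ → ℝ) : ℕ → ℝ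
  | 0 => 1
  | n + 1 => 1 - ∑ m ∈ Finset.Icc 2 (n + 1), g m 0 (zSeq g n)

/-- `zc` is the critical value of the recursion relation: the limit of the `z_n`. -/
def IsCriticalValue {d : ℕ} (g : ℕ → Dual d → ℝ → ℝ) (zc : ℝ) : Prop :=
  Tendsto (zSeq g) atTop (𝓝 zc)

/-- The susceptibility series `∑_{n ≥ 0} f_n(0;z)` converges (as a limit of partial sums) with
value `s`. -/
def HasSusceptibility {d : ℕ} (f : ℕ → Dual d → ℝ → ℝ) (z s : ℝ) : Prop :=
  Tendsto (fun N : ℕ => ∑ n ∈ Finset.range N, f n 0 z) atTop (𝓝 s)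

/-- For every `K > 1` with `L ≥ L₁(K)`: if the `f`-bounds with constant `K` hold for `z = zc` and
all `m ≥ 1`, then the `e`- and `g`-bounds with constants `Ce(K)`, `Cg(K)` hold for all `m ≥ 2`,
uniformly in the (positive) parameters `z ≤ zc`. -/
def UniformEG {d : ℕ} (ε : ℝ) (Ce Cg L₁ : ℝ → ℝ) (L : ℝ) (D : (Fin d → ℤ) → ℝ)
    (f g e : ℕ → Dual d → ℝ → ℝ) (zc : ℝ) : Prop :=
  ∀ K : ℝ, 1 < K → L₁ K ≤ L → (∀ m : ℕ, 1 ≤ m → FBounds L D f K m zc) →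
    ∀ z ∈ Set.Ioc 0 zc, ∀ m : ℕ, 2 ≤ m →
      EBounds L D e (Ce K) m z ∧ GBounds ε L D g (Cg K) m z

end LaceRec

end

/-!
The bounds on `f` bootstrap. If the coefficients `g_m` and `e_m` obey bounds of order `β m^{-d/2}`
for `m ≤ n` and `∑_{m ≤ n} g_m(0;z)` is within `O(β n^{-(d-2)/2})` of `1`, then the recursion is a
renewal equation whose solution satisfies (F_K) up to `n`, with `K` independent of `L`; Assumptions
E and G then bound the coefficients of index `n + 1`. Since `z ↦ g_m(0;z)` is Lipschitz with
constant `O(β m^{-(d-2)/2})`, this runs on nested intervals around the `z_n` which shrink to `z_c`,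
and `∑_m g_m(0;z_c) = 1`.

Summing the recursion gives `χ(z) (1 - ∑_m g_m(0;z)) = 1 + ∑_m e_m(0;z)`, which lies between `1/2`
and `3/2`. Hence `χ` is finite only where the mass `∑_m g_m(0;z)` differs from `1`, and it stays
bounded where the mass stays away from `1`, so it blows up exactly at `z_c`.
-/

noncomputable section

namespace LaceRec

section Weights

open Finset

/-- The weight `(1 + x n)^{-s}`: polynomial decay of exponent `s`, setting in on the scale
`n ≈ 1 / x`. -/
def weight (s x : ℝ) (n : ℕ) : ℝ := (1 + x * n) ^ (-s)

lemma one_add_mul_cast_pos {x : ℝ} (hx : 0 ≤ x) (n : ℕ) : 0 < 1 + x * (n : ℝ) := by positivity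

lemma one_le_one_add_mul_cast {x : ℝ} (hx : 0 ≤ x) (n : ℕ) : 1 ≤ 1 + x * (n : ℝ) :=
  le_add_of_nonneg_right (by positivity)

lemma weight_pos (s : ℝ) {x : ℝ} (hx : 0 ≤ x) (n : ℕ) : 0 < weight s x n :=
  Real.rpow_pos_of_pos (one_add_mul_cast_pos hx n) _

@[simp] lemma weight_zero_right (s x : ℝ) : weight s x 0 = 1 := by simp [weight]

lemma weight_le_one {s x : ℝ} (hs : 0 ≤ s) (hx : 0 ≤ x) (n : ℕ) : weight s x n ≤ 1 :=
  Real.rpow_le_one_of_one_le_of_nonpos (one_le_one_add_mul_cast hx n) (by linarith)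

lemma weight_anti_scale {s x y : ℝ} (hs : 0 ≤ s) (hx : 0 ≤ x) (hxy : x ≤ y) (n : ℕ) :
    weight s y n ≤ weight s x n :=
  Real.rpow_le_rpow_of_nonpos (one_add_mul_cast_pos hx n) (by gcongr) (by linarith)

lemma weight_anti {s x : ℝ} (hs : 0 ≤ s) (hx : 0 ≤ x) {m n : ℕ} (hmn : m ≤ n) :
    weight s x n ≤ weight s x m :=
  Real.rpow_le_rpow_of_nonpos (one_add_mul_cast_pos hx m) (by gcongr) (by linarith)

lemma weight_anti_exponent {s t x : ℝ} (hst : s ≤ t) (hx : 0 ≤ x) (n : ℕ) :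
    weight t x n ≤ weight s x n :=
  Real.rpow_le_rpow_of_exponent_le (one_le_one_add_mul_cast hx n) (by linarith)

lemma weight_le_two_rpow_mul {s x y : ℝ} {i n : ℕ} (hs : 0 ≤ s) (hx : 0 ≤ x)
    (h : 1 + x * n ≤ 2 * (1 + y * i)) : weight s y i ≤ 2 ^ s * weight s x n := by
  have hn := one_add_mul_cast_pos hx n
  calc weight s y i ≤ ((1 + x * (n : ℝ)) / 2) ^ (-s) :=
        Real.rpow_le_rpow_of_nonpos (by positivity) (by linarith) (by linarith)
    _ = 2 ^ s * weight s x n := by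
        rw [Real.div_rpow hn.le zero_le_two, Real.rpow_neg zero_le_two, weight, div_inv_eq_mul,
          mul_comm]

lemma weight_mul_weight_le {s x y : ℝ} (hs : 0 ≤ s) (hx : 0 ≤ x) (hxy : x ≤ y) {i n : ℕ}
    (h : i ≤ n) : weight s y n * weight s x i ≤ weight s x n * weight s y i := by
  have hy := hx.trans hxy
  have hxn := one_add_mul_cast_pos hx n
  have hxi := one_add_mul_cast_pos hx i
  have hyn := one_add_mul_cast_pos hy n
  have hyi := one_add_mul_cast_pos hy i
  have hin : (i : ℝ) ≤ n := by exact_mod_cast h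
  unfold weight
  rw [← Real.mul_rpow hyn.le hxi.le, ← Real.mul_rpow hxn.le hyi.le]
  refine Real.rpow_le_rpow_of_nonpos (by positivity) ?_ (by linarith)
  nlinarith [mul_nonneg (sub_nonneg.2 hxy) (sub_nonneg.2 hin)]

lemma weight_le_mul_weight_succ {s x δ : ℝ} (hs : 0 ≤ s) (hx : 0 ≤ x) (hδ : s * x ≤ δ)
    (hδ1 : δ ≤ 1 / 2) (n : ℕ) : weight s x n ≤ (1 + 2 * δ) * weight s x (n + 1) := by
  have hn := one_add_mul_cast_pos hx n
  have hn1 := one_add_mul_cast_pos hx (n + 1)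
  have hδ0 : 0 ≤ δ := (mul_nonneg hs hx).trans hδ
  have hfactor : 1 + x * ((n + 1 : ℕ) : ℝ) ≤ (1 + x) * (1 + x * n) := by
    push_cast
    nlinarith [mul_nonneg (mul_nonneg hx hx) n.cast_nonneg (α := ℝ)]
  have hgrowth : (1 + x) ^ s ≤ 1 + 2 * δ :=
    calc (1 + x) ^ s ≤ Real.exp x ^ s :=
          Real.rpow_le_rpow (by linarith) (by linarith [Real.add_one_le_exp x]) hs
      _ = Real.exp (s * x) := by rw [← Real.exp_mul, mul_comm]
      _ ≤ Real.exp δ := Real.exp_le_exp.2 hδ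
      _ ≤ 1 / (1 - δ) := Real.exp_bound_div_one_sub_of_interval hδ0 (by linarith)
      _ ≤ 1 + 2 * δ := by rw [div_le_iff₀ (by linarith)]; nlinarith
  have hrpow : (1 + x * ((n + 1 : ℕ) : ℝ)) ^ s ≤ (1 + 2 * δ) * (1 + x * n) ^ s :=
    calc _ ≤ ((1 + x) * (1 + x * n)) ^ s := Real.rpow_le_rpow hn1.le hfactor hs
      _ = (1 + x) ^ s * (1 + x * n) ^ s := Real.mul_rpow (by linarith) hn.le
      _ ≤ _ := by gcongr
  rw [weight, weight, Real.rpow_neg hn.le, Real.rpow_neg hn1.le, ← div_eq_mul_inv,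
    le_div_iff₀ (by positivity), inv_mul_le_iff₀ (by positivity)]
  exact hrpow.trans_eq (mul_comm _ _)

/-- The discrete form of `∂ₙ (1 + x n)^{1-s} = -(s - 1) x (1 + x n)^{-s}`. -/
lemma mul_weight_succ_le_sub {s x : ℝ} (hs : 1 ≤ s) (hx : 0 ≤ x) (n : ℕ) :
    x * (s - 1) * weight s x (n + 1) ≤ weight (s - 1) x n - weight (s - 1) x (n + 1) := by
  have hu := one_add_mul_cast_pos hx n
  have hv := one_add_mul_cast_pos hx (n + 1)
  have huv : 1 + x * ((n + 1 : ℕ) : ℝ) = 1 + x * n + x := by push_cast; ring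
  rw [weight, weight, weight]
  set u := 1 + x * (n : ℝ)
  set v := 1 + x * ((n + 1 : ℕ) : ℝ)
  have hratio : 1 + (s - 1) * (x / v) ≤ (v / u) ^ (s - 1) := by
    have hlog : x / v ≤ Real.log (v / u) := by
      have h := Real.one_sub_inv_le_log_of_pos (div_pos hv hu)
      rwa [inv_div, one_sub_div hv.ne', huv, add_sub_cancel_left, ← huv] at h
    rw [Real.rpow_def_of_pos (div_pos hv hu)]
    nlinarith [Real.add_one_le_exp (Real.log (v / u) * (s - 1))]
  have hsplit : v ^ (-s) = v ^ (-(s - 1)) / v := by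
    rw [show -s = -(s - 1) - 1 by ring, Real.rpow_sub_one hv.ne']
  have hu' : u ^ (-(s - 1)) = (v / u) ^ (s - 1) * v ^ (-(s - 1)) := by
    rw [Real.div_rpow hv.le hu.le, Real.rpow_neg hu.le, Real.rpow_neg hv.le]
    field_simp
  have : 0 < v ^ (-(s - 1)) := Real.rpow_pos_of_pos hv _
  calc x * (s - 1) * v ^ (-s) = (s - 1) * (x / v) * v ^ (-(s - 1)) := by rw [hsplit]; ring
    _ ≤ ((v / u) ^ (s - 1) - 1) * v ^ (-(s - 1)) := by gcongr; linarith
    _ = _ := by rw [hu']; ring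

lemma mul_sum_Ico_weight_succ_le {s x : ℝ} (hs : 1 ≤ s) (hx : 0 ≤ x) (m n : ℕ) :
    x * (s - 1) * ∑ j ∈ Ico m n, weight s x (j + 1) ≤ weight (s - 1) x m := by
  rcases le_total n m with h | h
  · simpa [h] using (weight_pos (s - 1) hx m).le
  · calc x * (s - 1) * ∑ j ∈ Ico m n, weight s x (j + 1)
        ≤ ∑ j ∈ Ico m n, (weight (s - 1) x j - weight (s - 1) x (j + 1)) := by
          rw [mul_sum]; exact sum_le_sum fun j _ => mul_weight_succ_le_sub hs hx j
      _ = weight (s - 1) x m - weight (s - 1) x n := by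
          rw [← neg_inj, ← sum_neg_distrib]
          simpa using sum_Ico_sub (weight (s - 1) x) h
      _ ≤ weight (s - 1) x m := sub_le_self _ (weight_pos _ hx n).le

lemma sum_Ico_weight_succ_le {s : ℝ} (hs : 2 ≤ s) (m n : ℕ) :
    ∑ j ∈ Ico m n, weight s 1 (j + 1) ≤ weight (s - 1) 1 m := by
  have hsum : 0 ≤ ∑ j ∈ Ico m n, weight s 1 (j + 1) :=
    sum_nonneg fun j _ => (weight_pos s zero_le_one _).le
  nlinarith [mul_sum_Ico_weight_succ_le (by linarith : 1 ≤ s) zero_le_one m n]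

lemma sum_range_weight_le {s x : ℝ} (hs : 1 < s) (hx : 0 < x) (n : ℕ) :
    ∑ j ∈ range n, weight s x j ≤ 1 + 1 / (x * (s - 1)) := by
  have hpos : 0 < x * (s - 1) := mul_pos hx (sub_pos.2 hs)
  cases n with
  | zero => simpa using by positivity
  | succ n =>
    have h := mul_sum_Ico_weight_succ_le hs.le hx.le 0 n
    rw [weight_zero_right, ← range_eq_Ico, ← le_div_iff₀' hpos] at h
    rw [sum_range_succ', weight_zero_right]
    linarith

lemma sum_range_weight_le_three_div {s x : ℝ} (hs : 3 / 2 ≤ s) (hx : 0 < x) (hx1 : x ≤ 1)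
    (n : ℕ) : ∑ j ∈ range n, weight s x j ≤ 3 / x := by
  refine (sum_range_weight_le (by linarith) hx n).trans ?_
  have hle : 1 / (x * (s - 1)) ≤ 2 / x := by
    rw [div_le_div_iff₀ (by nlinarith) hx]
    nlinarith
  have hone : 1 ≤ 1 / x := by rwa [le_div_iff₀ hx, one_mul]
  calc 1 + 1 / (x * (s - 1)) ≤ 1 / x + 2 / x := add_le_add hone hle
    _ = 3 / x := by ring

/-- The constant in the convolution bound for weights of exponent `s`. -/
def convConst (s : ℝ) : ℝ := 6 * 2 ^ s

lemma one_le_convConst {s : ℝ} (hs : 0 ≤ s) : 1 ≤ convConst s := by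
  unfold convConst
  linarith [Real.one_le_rpow (one_le_two (α := ℝ)) hs]

lemma sum_weight_mul_weight_le {s x y : ℝ} (hs : 3 / 2 ≤ s) (hx : 0 ≤ x) (hxy : x ≤ y)
    (hy : 0 < y) (hy1 : y ≤ 1) (n : ℕ) :
    ∑ p ∈ antidiagonal n, weight s y p.1 * weight s x p.2 ≤
      convConst s / y * weight s x n := by
  have hs0 : 0 ≤ s := by linarith
  have hwx := fun n => (weight_pos s hx n).le
  have hwy := fun n => (weight_pos s hy.le n).le
  have hterm : ∀ p ∈ antidiagonal n, weight s y p.1 * weight s x p.2 ≤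
      2 ^ s * weight s x n * (weight s y p.1 + weight s y p.2) := by
    rintro ⟨j, i⟩ hp
    obtain rfl : j + i = n := by simpa using hp
    have h2 : (0 : ℝ) ≤ 2 ^ s := by positivity
    rcases le_total j i with h | h
    · have hji : (j : ℝ) ≤ i := by exact_mod_cast h
      have hi := weight_le_two_rpow_mul (y := x) (i := i) (n := j + i) hs0 hx
        (by push_cast; nlinarith)
      calc _ ≤ weight s y j * (2 ^ s * weight s x (j + i)) := by gcongr; exact hwy j
        _ ≤ _ := by nlinarith [mul_nonneg h2 (mul_nonneg (hwx (j + i)) (hwy i))]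
    · have hij : (i : ℝ) ≤ j := by exact_mod_cast h
      have hj := weight_le_two_rpow_mul (y := y) (i := j) (n := j + i) hs0 hy.le
        (by push_cast; nlinarith)
      have hexchange := weight_mul_weight_le hs0 hx hxy (i.le_add_left j)
      calc _ ≤ (2 ^ s * weight s y (j + i)) * weight s x i := by gcongr; exact hwx i
        _ ≤ _ := by nlinarith [mul_nonneg h2 (mul_nonneg (hwx (j + i)) (hwy j))]
  have hfst : ∑ p ∈ antidiagonal n, weight s y p.1 ≤ 3 / y := by
    rw [Nat.sum_antidiagonal_eq_sum_range_succ_mk]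
    exact sum_range_weight_le_three_div hs hy hy1 _
  have hsnd : ∑ p ∈ antidiagonal n, weight s y p.2 ≤ 3 / y := by
    rwa [← Nat.sum_antidiagonal_swap]
  calc _ ≤ 2 ^ s * weight s x n * ∑ p ∈ antidiagonal n, (weight s y p.1 + weight s y p.2) := by
        rw [mul_sum]; exact sum_le_sum hterm
    _ ≤ 2 ^ s * weight s x n * (3 / y + 3 / y) := by
        rw [sum_add_distrib]
        gcongr
        exact mul_nonneg (by positivity) (hwx n)
    _ = _ := by rw [convConst]; ring

end Weights

section PowerSeriesBounds

open Finset PowerSeries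

lemma abs_coeff_mul_le {A B : PowerSeries ℝ} {α β : ℕ → ℝ} {N : ℕ}
    (hA : ∀ n ≤ N, |coeff n A| ≤ α n) (hB : ∀ n ≤ N, |coeff n B| ≤ β n) {n : ℕ} (hn : n ≤ N) :
    |coeff n (A * B)| ≤ ∑ p ∈ antidiagonal n, α p.1 * β p.2 := by
  rw [coeff_mul]
  refine (abs_sum_le_sum_abs _ _).trans (sum_le_sum ?_)
  rintro ⟨j, i⟩ hp
  obtain rfl : j + i = n := by simpa using hp
  rw [abs_mul]
  exact mul_le_mul (hA j (by omega)) (hB i (by omega)) (abs_nonneg _)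
    ((abs_nonneg _).trans (hA j (by omega)))

lemma abs_coeff_mul_le_weight {A B : PowerSeries ℝ} {s x y α β : ℝ} (hs : 3 / 2 ≤ s)
    (hx : 0 ≤ x) (hxy : x ≤ y) (hy : 0 < y) (hy1 : y ≤ 1) {N : ℕ}
    (hA : ∀ n ≤ N, |coeff n A| ≤ α * weight s y n)
    (hB : ∀ n ≤ N, |coeff n B| ≤ β * weight s x n) {n : ℕ} (hn : n ≤ N) :
    |coeff n (A * B)| ≤ α * β * (convConst s / y) * weight s x n := by
  have hα : 0 ≤ α := by simpa using (abs_nonneg _).trans (hA 0 (Nat.zero_le _))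
  have hβ : 0 ≤ β := by simpa using (abs_nonneg _).trans (hB 0 (Nat.zero_le _))
  refine (abs_coeff_mul_le hA hB hn).trans ?_
  calc _ = α * β * ∑ p ∈ antidiagonal n, weight s y p.1 * weight s x p.2 := by
        rw [mul_sum]; exact sum_congr rfl fun _ _ => by ring
    _ ≤ α * β * (convConst s / y * weight s x n) := by
        gcongr; exact sum_weight_mul_weight_le hs hx hxy hy hy1 n
    _ = _ := by ring

lemma coeff_succ_mul_eq (A B : PowerSeries ℝ) (n : ℕ) :
    coeff (n + 1) (A * B) = coeff 0 A * coeff (n + 1) B +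
      ∑ p ∈ antidiagonal n, coeff (p.1 + 1) A * coeff p.2 B := by
  rw [coeff_mul, Nat.sum_antidiagonal_succ]

lemma abs_sum_antidiagonal_succ_mul_le {t r : ℕ → ℝ} {s x τ τ' b M : ℝ} {n : ℕ}
    (hs : 3 / 2 ≤ s) (hx : 0 ≤ x) (hx1 : x ≤ 1) (hb : 0 ≤ b)
    (hτ : τ * weight s x n ≤ τ' * weight s x (n + 1))
    (ht : ∀ j ≤ n, |t (j + 1)| ≤ (if j = 0 then τ else 0) + b * weight s 1 (j + 1))
    (hr : ∀ i ≤ n, |r i| ≤ M * weight s x i) :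
    |∑ p ∈ antidiagonal n, t (p.1 + 1) * r p.2| ≤
      M * (τ' + b * convConst s) * weight s x (n + 1) := by
  have hM : 0 ≤ M := by simpa using (abs_nonneg _).trans (hr 0 (Nat.zero_le _))
  have hconv : ∑ p ∈ antidiagonal n, weight s 1 (p.1 + 1) * weight s x p.2 ≤
      convConst s * weight s x (n + 1) := by
    have h := sum_weight_mul_weight_le hs hx hx1 one_pos le_rfl (n + 1)
    rw [Nat.sum_antidiagonal_succ, div_one] at h
    exact (le_add_of_nonneg_left
      (mul_nonneg (weight_pos s zero_le_one _).le (weight_pos s hx _).le)).trans h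
  have hshift : ∑ p ∈ antidiagonal n, (if p.1 = 0 then τ else 0) * weight s x p.2 =
      τ * weight s x n := by
    rw [Nat.sum_antidiagonal_eq_sum_range_succ_mk, sum_range_succ']
    simp
  calc _ ≤ ∑ p ∈ antidiagonal n,
          ((if p.1 = 0 then τ else 0) + b * weight s 1 (p.1 + 1)) * (M * weight s x p.2) := by
        refine (abs_sum_le_sum_abs _ _).trans (sum_le_sum ?_)
        rintro ⟨j, i⟩ hp
        obtain rfl : j + i = n := by simpa using hp
        rw [abs_mul]
        exact mul_le_mul (ht j (by omega)) (hr i (by omega)) (abs_nonneg _)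
          ((abs_nonneg _).trans (ht j (by omega)))
    _ = M * (∑ p ∈ antidiagonal n, (if p.1 = 0 then τ else 0) * weight s x p.2 +
          b * ∑ p ∈ antidiagonal n, weight s 1 (p.1 + 1) * weight s x p.2) := by
        rw [mul_sum, ← sum_add_distrib, mul_sum]
        exact sum_congr rfl fun _ _ => by ring
    _ ≤ M * (τ' * weight s x (n + 1) + b * (convConst s * weight s x (n + 1))) := by
        rw [hshift]; gcongr
    _ = _ := by ring

/-- Comparison principle: a weight which is a supersolution of the renewal equation `H * R = S`
dominates its solution. -/
lemma abs_coeff_le_of_mul_eq {H R S : PowerSeries ℝ} {s x τ τ' b M σ : ℝ} {N : ℕ}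
    (hs : 3 / 2 ≤ s) (hx : 0 ≤ x) (hx1 : x ≤ 1) (hb : 0 ≤ b) (hHR : H * R = S)
    (h0 : 0 < coeff 0 H)
    (hH : ∀ j < N, |coeff (j + 1) H| ≤ (if j = 0 then τ else 0) + b * weight s 1 (j + 1))
    (hS0 : |coeff 0 S| ≤ M * coeff 0 H)
    (hS : ∀ n < N, |coeff (n + 1) S| ≤ σ * weight s x (n + 1))
    (hτ : ∀ n, τ * weight s x n ≤ τ' * weight s x (n + 1))
    (hM : σ + M * (τ' + b * convConst s) ≤ M * coeff 0 H) :
    ∀ n ≤ N, |coeff n R| ≤ M * weight s x n := by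
  subst hHR
  intro n
  induction n using Nat.strong_induction_on with
  | _ n ih =>
    intro hn
    refine le_of_mul_le_mul_left ?_ h0
    cases n with
    | zero =>
      rw [coeff_mul, Nat.antidiagonal_zero, sum_singleton, abs_mul, abs_of_pos h0] at hS0
      rwa [weight_zero_right, mul_one, mul_comm _ M]
    | succ n =>
      have hconv := abs_sum_antidiagonal_succ_mul_le (t := fun j => coeff j H) hs hx hx1 hb (hτ n)
        (fun j hj => hH j (by omega)) (fun i hi => ih i (by omega) (by omega))
      have hsource := hS n hn
      rw [coeff_succ_mul_eq] at hsource
      calc coeff 0 H * |coeff (n + 1) R| = |coeff 0 H * coeff (n + 1) R| := by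
            rw [abs_mul, abs_of_pos h0]
        _ ≤ σ * weight s x (n + 1) + M * (τ' + b * convConst s) * weight s x (n + 1) := by
            refine (le_of_eq ?_).trans ((abs_sub _ _).trans (add_le_add hsource hconv))
            rw [add_sub_cancel_right]
        _ ≤ M * coeff 0 H * weight s x (n + 1) := by
            rw [← add_mul]
            exact mul_le_mul_of_nonneg_right hM (weight_pos s hx _).le
        _ = _ := by ring

lemma abs_coeff_inverse_le {H P : PowerSeries ℝ} {s b : ℝ} (hs : 3 / 2 ≤ s) {N : ℕ}
    (hHP : H * P = 1) (h0 : 1 / 2 ≤ coeff 0 H) (hb0 : 0 ≤ b) (hb : 4 * b * convConst s ≤ 1)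
    (hH : ∀ j < N, |coeff (j + 1) H| ≤ b * weight s 1 (j + 1)) :
    ∀ n ≤ N, |coeff n P| ≤ 2 * weight s 1 n :=
  abs_coeff_le_of_mul_eq (τ := 0) (τ' := 0) (σ := 0) hs zero_le_one le_rfl hb0 hHP (by linarith)
    (by simpa using hH) (by rw [coeff_one, if_pos rfl, abs_one]; linarith)
    (by simp [coeff_one]) (by simp) (by linarith)

lemma abs_coeff_succ_inverse_le {H P : PowerSeries ℝ} {s b : ℝ} (hs : 3 / 2 ≤ s) {N : ℕ}
    (hHP : H * P = 1) (h0 : 1 / 2 ≤ coeff 0 H) (hb0 : 0 ≤ b) (hb : 4 * b * convConst s ≤ 1)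
    (hH : ∀ j < N, |coeff (j + 1) H| ≤ b * weight s 1 (j + 1)) {n : ℕ} (hn : n < N) :
    |coeff (n + 1) P| ≤ 4 * b * convConst s * weight s 1 (n + 1) := by
  have hP := abs_coeff_inverse_le hs hHP h0 hb0 hb hH
  have hconv := abs_sum_antidiagonal_succ_mul_le (t := fun j => coeff j H) (τ := 0) (τ' := 0)
    (n := n) hs zero_le_one le_rfl hb0 (by simp)
    (fun j hj => by simpa using hH j (by omega)) (fun i hi => hP i (by omega))
  have hcoeff : coeff 0 H * coeff (n + 1) P =
      -∑ p ∈ antidiagonal n, coeff (p.1 + 1) H * coeff p.2 P := by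
    have h := coeff_succ_mul_eq H P n
    rw [hHP, coeff_one, if_neg n.succ_ne_zero] at h
    linarith
  have habs : coeff 0 H * |coeff (n + 1) P| ≤
      2 * (0 + b * convConst s) * weight s 1 (n + 1) := by
    rwa [← abs_neg, ← hcoeff, abs_mul, abs_of_nonneg (by linarith)] at hconv
  nlinarith [abs_nonneg (coeff (n + 1) P)]

lemma abs_coeff_resolvent_le {P R : PowerSeries ℝ} {s κ b : ℝ} (hs : 3 / 2 ≤ s) {N : ℕ}
    (hκ : 0 ≤ κ) (hκ1 : κ ≤ 1 / 2) (hR : (1 - X + C κ * P) * R = 1) (hP0 : 1 ≤ coeff 0 P)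
    (hb0 : 0 ≤ b) (hb : b * convConst s ≤ 1 / 2)
    (hP : ∀ j < N, |coeff (j + 1) P| ≤ b * weight s 1 (j + 1)) :
    ∀ n ≤ N, |coeff n R| ≤ weight s (κ / (4 * s)) n := by
  have hs0 : 0 < s := by linarith
  have hx1 : κ / (4 * s) ≤ 1 := by rw [div_le_one (by positivity)]; linarith
  have hdefect : κ ≤ κ * coeff 0 P := le_mul_of_one_le_right hκ hP0
  have hzero : coeff 0 (1 - X + C κ * P : PowerSeries ℝ) = 1 + κ * coeff 0 P := by
    simp only [map_add, map_sub, coeff_C_mul, coeff_zero_X, coeff_one, if_true, sub_zero]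
  have hsucc : ∀ j < N, |coeff (j + 1) (1 - X + C κ * P : PowerSeries ℝ)| ≤
      (if j = 0 then 1 else 0) + κ * b * weight s 1 (j + 1) := by
    intro j hj
    have hstep : |coeff (j + 1) (1 - X : PowerSeries ℝ)| = if j = 0 then 1 else 0 := by
      simp only [map_sub, coeff_one, coeff_X, j.succ_ne_zero, if_false, add_eq_right]
      split_ifs <;> simp
    rw [map_add, coeff_C_mul, mul_assoc]
    refine (abs_add_le _ _).trans (add_le_add hstep.le ?_)
    rw [abs_mul, abs_of_nonneg hκ]
    exact mul_le_mul_of_nonneg_left (hP j hj) hκ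
  have h := abs_coeff_le_of_mul_eq (τ := 1) (τ' := 1 + 2 * (κ / 4)) (σ := 0) (M := 1)
    (x := κ / (4 * s)) hs (by positivity) hx1 (mul_nonneg hκ hb0) hR
    (by rw [hzero]; linarith) hsucc
    (by rw [hzero, coeff_one, if_pos rfl, abs_one]; linarith) (by simp [coeff_one])
    (fun n => by
      rw [one_mul]
      exact weight_le_mul_weight_succ hs0.le (by positivity) (by field_simp; rfl) (by linarith) n)
    (by rw [hzero]; nlinarith)
  simpa only [one_mul] using h

end PowerSeriesBounds

section GreenFunction

open Finset PowerSeries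

/-- On the range `n ≤ N`, the kernel `g` has total mass `1 - κ` and tail of exponent `θ`, both up
to errors of order `b`. The step `g 1` is only required to be bounded. -/
structure RenewalKernel (θ b κ : ℝ) (N : ℕ) (g : ℕ → ℝ) : Prop where
  defect_nonneg : 0 ≤ κ
  defect_le : κ ≤ 1 / 2
  zero : g 0 = 0
  one : |g 1| ≤ 2
  bound : ∀ m ≤ N, 2 ≤ m → |g m| ≤ b * weight θ 1 m
  tail : ∀ j ≤ N, 1 ≤ j → |1 - κ - ∑ m ∈ range (j + 1), g m| ≤ b * weight (θ - 1) 1 j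

/-- The factor turning the mass defect `κ` of a renewal kernel into the inverse scale of the
weight that dominates its Green function. -/
def rate (θ : ℝ) : ℝ := 1 / (4 * (θ - 1))

/-- The size of the error of a renewal kernel up to which its Green function is controlled. -/
def smallness (θ : ℝ) : ℝ := 1 / (8 * convConst (θ - 1) ^ 2)

lemma smallness_pos {θ : ℝ} (hθ : 5 / 2 ≤ θ) : 0 < smallness θ := by
  have := one_le_convConst (s := θ - 1) (by linarith)
  unfold smallness; positivity

lemma smallness_le_one {θ : ℝ} (hθ : 5 / 2 ≤ θ) : smallness θ ≤ 1 := by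
  have := one_le_convConst (s := θ - 1) (by linarith)
  unfold smallness
  rw [div_le_one (by positivity)]
  nlinarith

lemma rate_pos {θ : ℝ} (hθ : 5 / 2 ≤ θ) : 0 < rate θ :=
  one_div_pos.2 (by linarith)

lemma rate_le_one {θ : ℝ} (hθ : 5 / 2 ≤ θ) : rate θ ≤ 1 := by
  unfold rate
  rw [div_le_one (by linarith)]
  linarith

lemma one_sub_mk_eq {g : ℕ → ℝ} (hg : g 0 = 0) (κ : ℝ) :
    1 - PowerSeries.mk g = C κ +
      (1 - X) * PowerSeries.mk fun j => 1 - κ - ∑ m ∈ range (j + 1), g m := by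
  ext n
  cases n with
  | zero => simp [hg]
  | succ n =>
    rw [sub_mul, one_mul]
    simp only [map_sub, map_add, coeff_succ_X_mul, coeff_C, coeff_one, coeff_mk,
      sum_range_succ _ (n + 1)]
    simp

lemma eq_mul_of_one_sub_mul_eq_one {R : Type*} [CommRing R] {G H P S q x κ : R}
    (hG : 1 - G = κ + (1 - x) * H) (hHP : H * P = 1) (hS : (1 - x + κ * P) * S = 1)
    (hq : (1 - G) * q = 1) : q = P * S := by
  have hGP : (1 - G) * (P * S) = 1 :=
    calc (1 - G) * (P * S) = (κ * P + (1 - x) * (H * P)) * S := by rw [hG]; ring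
      _ = (1 - x + κ * P) * S := by rw [hHP]; ring
      _ = 1 := hS
  exact left_inv_eq_right_inv (by rwa [mul_comm]) hGP

/-- With `1 - G = κ + (1 - X) H` and `P = H⁻¹`, the Green function is `P (1 - X + κ P)⁻¹`. -/
lemma RenewalKernel.abs_coeff_green_le {θ b κ : ℝ} {N : ℕ} {g : ℕ → ℝ} (hθ : 5 / 2 ≤ θ)
    (hg : RenewalKernel θ b κ N g) (hb0 : 0 ≤ b) (hb : b ≤ smallness θ) {q : PowerSeries ℝ}
    (hq : (1 - PowerSeries.mk g) * q = 1) :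
    ∀ n ≤ N, |coeff n q| ≤ 2 * convConst (θ - 1) * weight (θ - 1) (rate θ * κ) n := by
  have hκ := hg.defect_nonneg
  have hκ1 := hg.defect_le
  have hs : 3 / 2 ≤ θ - 1 := by linarith
  have hx : rate θ * κ = κ / (4 * (θ - 1)) := one_div_mul_eq_div _ _
  set s := θ - 1
  set c := convConst s with hc
  have hc1 : 1 ≤ c := one_le_convConst (by linarith)
  have hbc : 8 * b * c * c ≤ 1 := by
    rw [smallness, le_div_iff₀ (by positivity), ← hc] at hb
    linarith
  have hbc' : 4 * b * c ≤ 1 := by nlinarith [mul_nonneg hb0 (zero_le_one.trans hc1)]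
  set H : PowerSeries ℝ := PowerSeries.mk fun j => 1 - κ - ∑ m ∈ range (j + 1), g m
  have hH0 : coeff 0 H = 1 - κ := by simp [H, hg.zero]
  have hHP : H * H⁻¹ = 1 := PowerSeries.mul_inv_cancel _ (by
    rw [← coeff_zero_eq_constantCoeff_apply, hH0]; linarith)
  set P := H⁻¹
  have hHle : ∀ j < N, |coeff (j + 1) H| ≤ b * weight s 1 (j + 1) := fun j hj => by
    simpa [H] using hg.tail (j + 1) hj (by omega)
  have hPle := abs_coeff_inverse_le hs hHP (by rw [hH0]; linarith) hb0 hbc' hHle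
  have hP0 : 1 ≤ coeff 0 P := by
    have h := congrArg (coeff 0) hHP
    rw [coeff_mul, Nat.antidiagonal_zero, sum_singleton, hH0, coeff_one, if_pos rfl] at h
    nlinarith
  set T : PowerSeries ℝ := 1 - X + C κ * P
  have hTT : T * T⁻¹ = 1 := PowerSeries.mul_inv_cancel _ (by
    have h : constantCoeff T = 1 + κ * coeff 0 P := by simp [T]
    rw [h]; nlinarith)
  have hTle : ∀ n ≤ N, |coeff n T⁻¹| ≤ 1 * weight s (rate θ * κ) n := by
    rw [hx]
    simpa only [one_mul] using abs_coeff_resolvent_le hs hκ hκ1 hTT hP0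
      (b := 4 * b * c) (by positivity) (by linarith)
      (fun j hj => abs_coeff_succ_inverse_le hs hHP (by rw [hH0]; linarith) hb0 hbc' hHle hj)
  have hqP : q = P * T⁻¹ := eq_mul_of_one_sub_mul_eq_one (one_sub_mk_eq hg.zero κ) hHP hTT hq
  intro n hn
  rw [hqP]
  have hx0 : 0 ≤ rate θ * κ := mul_nonneg (rate_pos hθ).le hκ
  have hx1 : rate θ * κ ≤ 1 := by nlinarith [rate_le_one hθ]
  refine (abs_coeff_mul_le_weight hs hx0 hx1 one_pos le_rfl hPle hTle hn).trans_eq ?_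
  ring

/-- The Euler operator `X d/dX`, which multiplies the `n`-th coefficient by `n`. -/
def euler (A : PowerSeries ℝ) : PowerSeries ℝ := X * d⁄dX ℝ A

lemma coeff_euler (A : PowerSeries ℝ) (n : ℕ) : coeff n (euler A) = n * coeff n A := by
  unfold euler
  cases n with
  | zero => simp
  | succ n => rw [coeff_succ_X_mul, coeff_derivative]; push_cast; ring

lemma euler_mul (A B : PowerSeries ℝ) : euler (A * B) = euler A * B + A * euler B := by
  unfold euler
  rw [Derivation.leibniz]
  simp only [smul_eq_mul]; ring

lemma euler_one_sub (A : PowerSeries ℝ) : euler (1 - A) = -euler A := by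
  simp [euler]

lemma euler_green {G q : PowerSeries ℝ} (hq : (1 - G) * q = 1) : euler q = q * q * euler G := by
  have h : -euler G * q + (1 - G) * euler q = 0 := by
    rw [← euler_one_sub, ← euler_mul, hq]; simp [euler]
  linear_combination q * h - euler q * hq

lemma euler_euler_green {G q : PowerSeries ℝ} (hq : (1 - G) * q = 1) :
    euler (euler q) = euler (euler G) * (q * q) +
      2 * (euler G * (euler G * (q * (q * q)))) := by
  rw [euler_green hq, euler_mul, euler_mul, euler_green hq]
  ring

end GreenFunction

section GreenFunctionDecay

open Finset PowerSeries

lemma weight_one_le_rpow {s : ℝ} (hs : 0 ≤ s) {n : ℕ} (hn : 1 ≤ n) :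
    weight s 1 n ≤ (n : ℝ) ^ (-s) :=
  Real.rpow_le_rpow_of_nonpos (by exact_mod_cast hn) (by linarith) (by linarith)

lemma rpow_le_weight_one {s : ℝ} (hs : 0 ≤ s) {n : ℕ} (hn : 1 ≤ n) :
    (n : ℝ) ^ (-s) ≤ 2 ^ s * weight s 1 n := by
  have hn' : (1 : ℝ) ≤ n := by exact_mod_cast hn
  calc (n : ℝ) ^ (-s) ≤ ((1 + 1 * (n : ℝ)) / 2) ^ (-s) :=
        Real.rpow_le_rpow_of_nonpos (by positivity) (by linarith) (by linarith)
    _ = 2 ^ s * weight s 1 n := by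
        rw [Real.div_rpow (by positivity) zero_le_two, Real.rpow_neg zero_le_two, weight,
          div_inv_eq_mul, mul_comm]

lemma weight_eq_rpow_mul_weight {s x : ℝ} (hx : 0 ≤ x) (r : ℝ) (n : ℕ) :
    weight s x n = (1 + x * n) ^ r * weight (s + r) x n := by
  unfold weight
  rw [← Real.rpow_add (one_add_mul_cast_pos hx n)]
  congr 1; ring

lemma cast_mul_weight_succ_le {s : ℝ} (n : ℕ) :
    n * weight (s + 1) 1 n ≤ weight s 1 n := by
  rw [weight_eq_rpow_mul_weight (s := s) zero_le_one 1 n, Real.rpow_one]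
  exact mul_le_mul_of_nonneg_right (by linarith) (weight_pos _ zero_le_one n).le

lemma cast_mul_weight_le {s : ℝ} (hs : 3 / 2 ≤ s) {j n : ℕ} (hj : j ≤ n) :
    j * weight s 1 j ≤ (n : ℝ) ^ (3 / 4 : ℝ) * weight (5 / 4) 1 j := by
  rcases Nat.eq_zero_or_pos j with rfl | hj0
  · simpa using by positivity
  have hpos : (0 : ℝ) < j := by exact_mod_cast hj0
  have hjn : (j : ℝ) ≤ n := by exact_mod_cast hj
  have hw := (weight_pos s zero_le_one j).le
  calc (j : ℝ) * weight s 1 j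
      = (j : ℝ) ^ (3 / 4 : ℝ) * ((j : ℝ) ^ (1 / 4 : ℝ) * weight s 1 j) := by
        rw [← mul_assoc, ← Real.rpow_add hpos]; norm_num
    _ ≤ (n : ℝ) ^ (3 / 4 : ℝ) * ((1 + 1 * (j : ℝ)) ^ (1 / 4 : ℝ) * weight (3 / 2) 1 j) := by
        gcongr
        · linarith
        · exact weight_anti_exponent hs zero_le_one j
    _ = (n : ℝ) ^ (3 / 4 : ℝ) * weight (5 / 4) 1 j := by
        rw [weight_eq_rpow_mul_weight (s := 5 / 4) zero_le_one (1 / 4)]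
        norm_num

lemma cast_mul_weight_mul_weight_le {s x : ℝ} (hs : 3 / 2 ≤ s) (hx : 0 ≤ x) (j i : ℕ) :
    (j * weight s 1 j) * weight s x i ≤
      2 ^ s * ((j + i : ℕ) * weight s 1 (j + i)) * weight s x i +
        2 ^ s * (((j + i : ℕ) : ℝ) ^ (3 / 4 : ℝ) * weight s x (j + i)) * weight (5 / 4) 1 j := by
  have hs0 : 0 ≤ s := by linarith
  have hwx := fun n => (weight_pos s hx n).le
  have hw := fun n => (weight_pos s zero_le_one n).le
  have hw' := fun n => (weight_pos (5 / 4) zero_le_one n).le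
  have hleft : 0 ≤ 2 ^ s * ((j + i : ℕ) * weight s 1 (j + i)) * weight s x i :=
    mul_nonneg (mul_nonneg (by positivity) (mul_nonneg (by positivity) (hw _))) (hwx i)
  have hright : 0 ≤ 2 ^ s * (((j + i : ℕ) : ℝ) ^ (3 / 4 : ℝ) * weight s x (j + i)) *
      weight (5 / 4) 1 j :=
    mul_nonneg (mul_nonneg (by positivity) (mul_nonneg (by positivity) (hwx _))) (hw' j)
  rcases le_total j i with h | h
  · have hji : (j : ℝ) ≤ i := by exact_mod_cast h
    have hi := weight_le_two_rpow_mul (y := x) (i := i) (n := j + i) hs0 hx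
      (by push_cast; nlinarith)
    have hj := cast_mul_weight_le hs (j.le_add_right i)
    have hprod := mul_le_mul hj hi (hwx i) (mul_nonneg (by positivity) (hw' j))
    linarith
  · have hij : (i : ℝ) ≤ j := by exact_mod_cast h
    have hj := weight_le_two_rpow_mul (y := 1) (i := j) (n := j + i) hs0 zero_le_one
      (by push_cast; linarith)
    have hprod : (j * weight s 1 j) * weight s x i ≤
        ((j + i : ℕ) * (2 ^ s * weight s 1 (j + i))) * weight s x i := by
      refine mul_le_mul_of_nonneg_right (mul_le_mul ?_ hj (hw j) (by positivity)) (hwx i)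
      exact_mod_cast j.le_add_right i
    linarith

lemma sum_cast_mul_weight_mul_weight_le {s x : ℝ} (hs : 3 / 2 ≤ s) (hx : 0 < x) (hx1 : x ≤ 1)
    (n : ℕ) :
    ∑ p ∈ antidiagonal n, (p.1 * weight s 1 p.1) * weight s x p.2 ≤
      2 ^ s * (n * weight s 1 n * (3 / x) + (n : ℝ) ^ (3 / 4 : ℝ) * 5 * weight s x n) := by
  have hterm : ∀ p ∈ antidiagonal n, (p.1 * weight s 1 p.1) * weight s x p.2 ≤
      2 ^ s * (n * weight s 1 n) * weight s x p.2 +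
        2 ^ s * ((n : ℝ) ^ (3 / 4 : ℝ) * weight s x n) * weight (5 / 4) 1 p.1 := by
    rintro ⟨j, i⟩ hp
    obtain rfl : j + i = n := by simpa using hp
    exact cast_mul_weight_mul_weight_le hs hx.le j i
  have hsnd : ∑ p ∈ antidiagonal n, weight s x p.2 ≤ 3 / x := by
    rw [← Nat.sum_antidiagonal_swap, Nat.sum_antidiagonal_eq_sum_range_succ_mk]
    exact sum_range_weight_le_three_div hs hx hx1 _
  have hfst : ∑ p ∈ antidiagonal n, weight (5 / 4) 1 p.1 ≤ 5 := by
    rw [Nat.sum_antidiagonal_eq_sum_range_succ_mk]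
    exact (sum_range_weight_le (by norm_num) one_pos _).trans (by norm_num)
  have := (weight_pos s zero_le_one n).le
  have := (weight_pos s hx.le n).le
  calc _ ≤ ∑ p ∈ antidiagonal n, (2 ^ s * (n * weight s 1 n) * weight s x p.2 +
          2 ^ s * ((n : ℝ) ^ (3 / 4 : ℝ) * weight s x n) * weight (5 / 4) 1 p.1) :=
        sum_le_sum hterm
    _ ≤ 2 ^ s * (n * weight s 1 n) * (3 / x) +
          2 ^ s * ((n : ℝ) ^ (3 / 4 : ℝ) * weight s x n) * 5 := by
        rw [sum_add_distrib, ← mul_sum, ← mul_sum]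
        gcongr
    _ = _ := by ring

lemma RenewalKernel.abs_coeff_euler_le {θ b κ : ℝ} {N : ℕ} {g : ℕ → ℝ} (hθ : 5 / 2 ≤ θ)
    (hg : RenewalKernel θ b κ N g) (hb : b ≤ 1) {n : ℕ} (hn : n ≤ N) :
    |coeff n (euler (PowerSeries.mk g))| ≤ convConst (θ - 1) * weight (θ - 1) 1 n := by
  have hc := one_le_convConst (s := θ - 1) (by linarith)
  have hw := weight_pos (θ - 1) zero_le_one n
  rw [coeff_euler, coeff_mk, abs_mul, Nat.abs_cast]
  obtain rfl | rfl | h : n = 0 ∨ n = 1 ∨ 2 ≤ n := by omega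
  · simpa using by linarith
  · have hone : weight (θ - 1) 1 1 = (2 ^ (θ - 1))⁻¹ := by
      rw [weight, ← Real.rpow_neg zero_le_two]; norm_num
    rw [hone, convConst, mul_assoc, mul_inv_cancel₀ (by positivity)]
    norm_num
    linarith [hg.one]
  · calc (n : ℝ) * |g n| ≤ n * (1 * weight θ 1 n) := by
          gcongr
          exact (hg.bound n hn h).trans
            (mul_le_mul_of_nonneg_right hb (weight_pos θ zero_le_one n).le)
      _ ≤ 1 * weight (θ - 1) 1 n := by
          simpa using cast_mul_weight_succ_le (s := θ - 1) n
      _ ≤ _ := by gcongr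

/-- The decay in `n` of the Green function of a renewal kernel whose mass defect is of order `x`.
The two terms come from the tail of the kernel and from diffusion. -/
def greenTail (θ x : ℝ) (n : ℕ) : ℝ := (n : ℝ) ^ (-θ) * x ^ (1 / 4 - θ) + weight (θ + 1) x n

lemma greenTail_nonneg (θ : ℝ) {x : ℝ} (hx : 0 ≤ x) (n : ℕ) : 0 ≤ greenTail θ x n := by
  have := weight_pos (θ + 1) hx n
  unfold greenTail; positivity

lemma weight_le_greenTail (θ : ℝ) {x : ℝ} (hx : 0 ≤ x) (n : ℕ) :
    weight (θ + 1) x n ≤ greenTail θ x n :=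
  le_add_of_nonneg_left (by positivity)

lemma rpow_le_greenTail (θ : ℝ) {x : ℝ} (hx : 0 ≤ x) (n : ℕ) :
    (n : ℝ) ^ (-θ) * x ^ (1 / 4 - θ) ≤ greenTail θ x n :=
  le_add_of_nonneg_right (weight_pos _ hx n).le

lemma cast_mul_weight_one_div_sq_le {θ x : ℝ} (hθ : 5 / 2 ≤ θ) (hx : 0 < x) (hx1 : x ≤ 1) {n : ℕ}
    (hn : 1 ≤ n) :
    n * weight (θ - 1) 1 n * (1 / x ^ 2) ≤ (n : ℝ) ^ 2 * ((n : ℝ) ^ (-θ) * x ^ (1 / 4 - θ)) := by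
  have hn0 : (0 : ℝ) < n := by exact_mod_cast hn
  have hxpow : 1 / x ^ 2 ≤ x ^ (1 / 4 - θ) := by
    rw [one_div, ← Real.rpow_natCast, ← Real.rpow_neg hx.le]
    exact Real.rpow_le_rpow_of_exponent_ge hx hx1 (by push_cast; linarith)
  have hnpow : (n : ℝ) * (n : ℝ) ^ (-(θ - 1)) = (n : ℝ) ^ 2 * (n : ℝ) ^ (-θ) := by
    rw [show -(θ - 1) = 1 + -θ by ring, Real.rpow_add hn0, Real.rpow_one]
    ring
  calc _ ≤ n * (n : ℝ) ^ (-(θ - 1)) * x ^ (1 / 4 - θ) := by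
        gcongr
        exact weight_one_le_rpow (by linarith) hn
    _ = _ := by rw [hnpow, mul_assoc]

lemma rpow_div_mul_weight_le {θ x : ℝ} (hθ : 1 ≤ θ) (hx : 0 < x) {n : ℕ} (hxn : 1 ≤ x * n) :
    (n : ℝ) ^ (3 / 4 : ℝ) * (1 / x) * weight (θ - 1) x n ≤
      (n : ℝ) ^ 2 * ((n : ℝ) ^ (-θ) * x ^ (1 / 4 - θ)) := by
  have hxn0 : 0 < x * n := by linarith
  have hn0 : (0 : ℝ) < n := pos_of_mul_pos_right hxn0 hx.le
  have hweight : weight (θ - 1) x n ≤ (x * n) ^ (-(θ - 1)) :=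
    Real.rpow_le_rpow_of_nonpos hxn0 (by linarith) (by linarith)
  have hspare : 1 ≤ (x * n) ^ (1 / 4 : ℝ) := Real.one_le_rpow hxn (by norm_num)
  calc _ ≤ (n : ℝ) ^ (3 / 4 : ℝ) * (1 / x) * ((x * n) ^ (-(θ - 1)) * (x * n) ^ (1 / 4 : ℝ)) := by
        gcongr
        exact hweight.trans (le_mul_of_one_le_right (by positivity) hspare)
    _ = ((n : ℝ) ^ (3 / 4 : ℝ) * (n : ℝ) ^ (5 / 4 - θ)) *
        (x ^ (-1 : ℝ) * x ^ (5 / 4 - θ)) := by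
      rw [← Real.rpow_add hxn0, Real.mul_rpow hx.le hn0.le, Real.rpow_neg_one,
        show -(θ - 1) + 1 / 4 = 5 / 4 - θ by ring]
      ring
    _ = _ := by
      rw [← Real.rpow_add hn0, ← Real.rpow_add hx, ← mul_assoc, ← Real.rpow_natCast,
        ← Real.rpow_add hn0]
      congr 2 <;> push_cast <;> ring

lemma one_div_sq_mul_weight_le (θ : ℝ) {x : ℝ} (hx : 0 < x) {n : ℕ} (hxn : 1 ≤ x * n) :
    1 / x ^ 2 * weight (θ - 1) x n ≤ 4 * ((n : ℝ) ^ 2 * weight (θ + 1) x n) := by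
  have hw := weight_pos (θ + 1) hx.le n
  have hsplit : weight (θ - 1) x n = (1 + x * n) ^ 2 * weight (θ + 1) x n := by
    rw [weight_eq_rpow_mul_weight hx.le 2, show θ - 1 + 2 = θ + 1 by ring, Real.rpow_two]
  rw [hsplit]
  calc _ ≤ 1 / x ^ 2 * ((2 * (x * n)) ^ 2 * weight (θ + 1) x n) := by gcongr; linarith
    _ = _ := by field_simp; ring

/-- The constant in the decay of the Green function. -/
def greenConst (θ : ℝ) : ℝ := 96 * convConst (θ - 1) ^ 9

lemma one_le_greenConst {θ : ℝ} (hθ : 5 / 2 ≤ θ) : 1 ≤ greenConst θ := by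
  have := one_le_pow₀ (n := 9) (one_le_convConst (s := θ - 1) (by linarith))
  unfold greenConst
  linarith

lemma RenewalKernel.abs_green_le_of_mul_le_one {θ b κ : ℝ} {N : ℕ} {g : ℕ → ℝ}
    (hθ : 5 / 2 ≤ θ) (hg : RenewalKernel θ b κ N g) (hb0 : 0 ≤ b) (hb : b ≤ smallness θ)
    {q : PowerSeries ℝ} (hq : (1 - PowerSeries.mk g) * q = 1) {n : ℕ} (hn : n ≤ N)
    (hxn : rate θ * κ * n ≤ 1) :
    |coeff n q| ≤ greenConst θ * greenTail θ (rate θ * κ) n := by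
  have hx0 : 0 ≤ rate θ * κ := mul_nonneg (rate_pos hθ).le hg.defect_nonneg
  have hqn := hg.abs_coeff_green_le hθ hb0 hb hq n hn
  set x := rate θ * κ
  set c := convConst (θ - 1) with hc
  have hc1 : 1 ≤ c := one_le_convConst (by linarith)
  have htail := greenTail_nonneg θ hx0 n
  have hdecay : 1 ≤ 2 ^ (θ + 1) * weight (θ + 1) x n := by
    refine (weight_zero_right (θ + 1) 0).symm.le.trans
      (weight_le_two_rpow_mul (y := 0) (i := 0) (by linarith) hx0 ?_)
    norm_num
    linarith
  have htwo : (2 : ℝ) ^ (θ + 1) ≤ c := by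
    have h : (2 : ℝ) ^ (θ + 1) = 4 * 2 ^ (θ - 1) := by
      rw [show θ + 1 = 2 + (θ - 1) by ring, Real.rpow_add two_pos]; norm_num
    rw [h, hc, convConst]
    gcongr
    norm_num
  calc |coeff n q| ≤ 2 * c * weight (θ - 1) x n := hqn
    _ ≤ 2 * c * 1 := by gcongr; exact weight_le_one (by linarith) hx0 n
    _ ≤ 2 * c * (2 ^ (θ + 1) * weight (θ + 1) x n) := by gcongr
    _ ≤ 2 * c * (c * greenTail θ x n) := by
        have hw := (weight_pos (θ + 1) hx0 n).le
        gcongr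
        exact weight_le_greenTail θ hx0 n
    _ = 2 * c ^ 2 * greenTail θ x n := by ring
    _ ≤ 96 * c ^ 9 * greenTail θ x n := by
        have hpow : c ^ 2 ≤ c ^ 9 := pow_le_pow_right₀ hc1 (by norm_num)
        gcongr
        norm_num

lemma abs_coeff_euler_mul_le {s x α β : ℝ} {N : ℕ} {A B : PowerSeries ℝ} (hs : 3 / 2 ≤ s)
    (hx : 0 < x) (hx1 : x ≤ 1) (hα : 0 ≤ α) (hβ : 0 ≤ β)
    (hA : ∀ n ≤ N, |coeff n A| ≤ α * weight s 1 n) (hB : ∀ n ≤ N, |coeff n B| ≤ β * weight s x n)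
    {n : ℕ} (hn : n ≤ N) :
    |coeff n (euler A * B)| ≤ α * β * (2 ^ s * (n * weight s 1 n * (3 / x) +
      (n : ℝ) ^ (3 / 4 : ℝ) * 5 * weight s x n)) := by
  have hEA : ∀ j ≤ N, |coeff j (euler A)| ≤ α * (j * weight s 1 j) := fun j hj => by
    rw [coeff_euler, abs_mul, Nat.abs_cast, mul_left_comm]
    gcongr
    exact hA j hj
  calc |coeff n (euler A * B)|
      ≤ α * β * ∑ p ∈ antidiagonal n, (p.1 * weight s 1 p.1) * weight s x p.2 := by
        refine (abs_coeff_mul_le hEA hB hn).trans_eq ?_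
        rw [mul_sum]; exact sum_congr rfl fun _ _ => by ring
    _ ≤ _ := by gcongr; exact sum_cast_mul_weight_mul_weight_le hs hx hx1 n

lemma RenewalKernel.abs_coeff_euler_euler_green_le {θ b κ : ℝ} {N : ℕ} {g : ℕ → ℝ}
    (hθ : 5 / 2 ≤ θ) (hg : RenewalKernel θ b κ N g) (hb0 : 0 ≤ b) (hb : b ≤ smallness θ)
    {q : PowerSeries ℝ} (hq : (1 - PowerSeries.mk g) * q = 1) {n : ℕ} (hn : n ≤ N) {x : ℝ}
    (hx : x = rate θ * κ) (hx0 : 0 < x) :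
    |coeff n (euler (euler q))| ≤ 16 * convConst (θ - 1) ^ 9 *
      (n * weight (θ - 1) 1 n * (1 / x ^ 2) + (n : ℝ) ^ (3 / 4 : ℝ) * (1 / x) * weight (θ - 1) x n +
        1 / x ^ 2 * weight (θ - 1) x n) := by
  have hx1 : x ≤ 1 := by
    rw [hx]; nlinarith [rate_le_one hθ, rate_pos hθ, hg.defect_le, hg.defect_nonneg]
  have hqle := hg.abs_coeff_green_le hθ hb0 hb hq
  have hGle := fun n (hn : n ≤ N) => hg.abs_coeff_euler_le hθ (hb.trans (smallness_le_one hθ)) hn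
  rw [← hx] at hqle
  have hs : 3 / 2 ≤ θ - 1 := by linarith
  set s := θ - 1
  set c := convConst s with hc
  have hc1 : 1 ≤ c := one_le_convConst (by linarith)
  have hqq := fun n (hn : n ≤ N) => abs_coeff_mul_le_weight hs hx0.le le_rfl hx0 hx1 hqle hqle hn
  have hqqq := fun n (hn : n ≤ N) => abs_coeff_mul_le_weight hs hx0.le le_rfl hx0 hx1 hqle hqq hn
  have hGqqq := fun n (hn : n ≤ N) =>
    abs_coeff_mul_le_weight hs hx0.le hx1 one_pos le_rfl hGle hqqq hn
  have hGGqqq := abs_coeff_mul_le_weight hs hx0.le hx1 one_pos le_rfl hGle hGqqq hn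
  have hEGqq := abs_coeff_euler_mul_le hs hx0 hx1 (by positivity) (by positivity) hGle hqq hn
  have hw := weight_pos s zero_le_one n
  have hwx := weight_pos s hx0.le n
  have htwo : (2 : ℝ) ^ s = c / 6 := by rw [hc, convConst]; ring
  have hpow : c ^ 5 ≤ c ^ 9 := pow_le_pow_right₀ hc1 (by norm_num)
  rw [euler_euler_green hq, map_add, two_mul, map_add]
  set u₁ := n * weight s 1 n * (1 / x ^ 2) with hu₁
  set u₂ := (n : ℝ) ^ (3 / 4 : ℝ) * (1 / x) * weight s x n with hu₂
  set u₃ := 1 / x ^ 2 * weight s x n with hu₃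
  have : 0 ≤ u₁ := by positivity
  have : 0 ≤ u₂ := by positivity
  calc _ ≤ _ := (abs_add_le _ _).trans
        (add_le_add hEGqq ((abs_add_le _ _).trans (add_le_add hGGqqq hGGqqq)))
    _ = 2 * c ^ 5 * u₁ + 10 / 3 * c ^ 5 * u₂ + 16 * c ^ 9 * u₃ := by
        rw [hu₁, hu₂, hu₃, htwo]; field_simp; ring
    _ ≤ 16 * c ^ 9 * u₁ + 16 * c ^ 9 * u₂ + 16 * c ^ 9 * u₃ := by gcongr <;> norm_num
    _ = _ := by ring

theorem RenewalKernel.abs_green_le {θ b κ : ℝ} {N : ℕ} {g : ℕ → ℝ} (hθ : 5 / 2 ≤ θ)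
    (hg : RenewalKernel θ b κ N g) (hκ : 0 < κ) (hb0 : 0 ≤ b) (hb : b ≤ smallness θ)
    {q : PowerSeries ℝ} (hq : (1 - PowerSeries.mk g) * q = 1) {n : ℕ} (hn : n ≤ N) (hn1 : 1 ≤ n) :
    |coeff n q| ≤ greenConst θ * greenTail θ (rate θ * κ) n := by
  rcases le_total (rate θ * κ * n) 1 with hxn | hxn
  · exact hg.abs_green_le_of_mul_le_one hθ hb0 hb hq hn hxn
  have hx0 : 0 < rate θ * κ := mul_pos (rate_pos hθ) hκ
  have hx1 : rate θ * κ ≤ 1 := by nlinarith [rate_le_one hθ, hg.defect_le]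
  have hEE := hg.abs_coeff_euler_euler_green_le hθ hb0 hb hq hn rfl hx0
  rw [coeff_euler, coeff_euler, abs_mul, abs_mul, Nat.abs_cast, ← mul_assoc, ← sq] at hEE
  set x := rate θ * κ
  have hc1 : 1 ≤ convConst (θ - 1) := one_le_convConst (by linarith)
  have hn0 : (0 : ℝ) < (n : ℝ) ^ 2 := by positivity
  have hkernel := (cast_mul_weight_one_div_sq_le hθ hx0 hx1 hn1).trans
    (mul_le_mul_of_nonneg_left (rpow_le_greenTail θ hx0.le n) hn0.le)
  have hcross := (rpow_div_mul_weight_le (by linarith) hx0 hxn).trans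
    (mul_le_mul_of_nonneg_left (rpow_le_greenTail θ hx0.le n) hn0.le)
  have hdiffusion := (one_div_sq_mul_weight_le θ hx0 hxn).trans (mul_le_mul_of_nonneg_left
    (mul_le_mul_of_nonneg_left (weight_le_greenTail θ hx0.le n) hn0.le) zero_le_four)
  refine le_of_mul_le_mul_left (hEE.trans ?_) hn0
  calc _ ≤ 16 * convConst (θ - 1) ^ 9 * (6 * ((n : ℝ) ^ 2 * greenTail θ x n)) :=
        mul_le_mul_of_nonneg_left (by linarith) (by positivity)
    _ = _ := by rw [greenConst]; ring

end GreenFunctionDecay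

section Renewal

open Finset PowerSeries

lemma one_sub_mk_mul_inv {g : ℕ → ℝ} (hg : g 0 = 0) :
    (1 - PowerSeries.mk g) * (1 - PowerSeries.mk g)⁻¹ = 1 :=
  PowerSeries.mul_inv_cancel _ (by rw [← coeff_zero_eq_constantCoeff_apply]; simp [hg])

lemma eq_mul_inv_one_sub_mk {g : ℕ → ℝ} {F S : PowerSeries ℝ} (hg : g 0 = 0)
    (hF : (1 - PowerSeries.mk g) * F = S) : F = S * (1 - PowerSeries.mk g)⁻¹ := by
  linear_combination -F * one_sub_mk_mul_inv hg + (1 - PowerSeries.mk g)⁻¹ * hF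

lemma rpow_le_two_rpow_mul {s : ℝ} (hs : 0 ≤ s) {i n : ℕ} (hn : 1 ≤ n) (h : n ≤ 2 * i) :
    (i : ℝ) ^ (-s) ≤ 2 ^ s * (n : ℝ) ^ (-s) := by
  have hn0 : (0 : ℝ) < n := by exact_mod_cast hn
  have hni : (n : ℝ) ≤ 2 * i := by exact_mod_cast h
  calc (i : ℝ) ^ (-s) ≤ ((n : ℝ) / 2) ^ (-s) :=
        Real.rpow_le_rpow_of_nonpos (by positivity) (by linarith) (by linarith)
    _ = 2 ^ s * (n : ℝ) ^ (-s) := by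
        rw [Real.div_rpow hn0.le zero_le_two, Real.rpow_neg zero_le_two, div_inv_eq_mul, mul_comm]

lemma greenTail_le_of_le_two_mul {θ x : ℝ} (hθ : 0 ≤ θ) (hx : 0 ≤ x) {i n : ℕ} (hn : 1 ≤ n)
    (h : n ≤ 2 * i) : greenTail θ x i ≤ 2 ^ (θ + 1) * greenTail θ x n := by
  have hni : (n : ℝ) ≤ 2 * i := by exact_mod_cast h
  have hweight : weight (θ + 1) x i ≤ 2 ^ (θ + 1) * weight (θ + 1) x n :=
    weight_le_two_rpow_mul (by linarith) hx (by nlinarith)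
  have hrpow : (i : ℝ) ^ (-θ) ≤ 2 ^ (θ + 1) * (n : ℝ) ^ (-θ) :=
    (rpow_le_two_rpow_mul hθ hn h).trans (by gcongr <;> linarith)
  unfold greenTail
  calc _ ≤ 2 ^ (θ + 1) * (n : ℝ) ^ (-θ) * x ^ (1 / 4 - θ) + 2 ^ (θ + 1) * weight (θ + 1) x n := by
        gcongr
    _ = _ := by ring

lemma rpow_div_le_greenTail {θ x : ℝ} (hθ : 5 / 4 ≤ θ) (hx : 0 < x) (hx1 : x ≤ 1) (n : ℕ) :
    (n : ℝ) ^ (-θ) * (1 / x) ≤ greenTail θ x n := by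
  refine le_trans ?_ (rpow_le_greenTail θ hx.le n)
  rw [one_div, ← Real.rpow_neg_one]
  gcongr ?_ * ?_
  exact Real.rpow_le_rpow_of_exponent_ge hx hx1 (by linarith)

/-- The constant in the bounds on the solutions of renewal equations. -/
def renewalConst (θ : ℝ) : ℝ :=
  2 * convConst (θ - 1) ^ 2 + (3 * greenConst θ * 2 ^ (θ + 1) + 6 * convConst (θ - 1) * 2 ^ θ)

lemma two_mul_convConst_sq_le_renewalConst {θ : ℝ} (hθ : 5 / 2 ≤ θ) :
    2 * convConst (θ - 1) ^ 2 ≤ renewalConst θ := by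
  have hc := one_le_convConst (s := θ - 1) (by linarith)
  have hG := one_le_greenConst hθ
  exact le_add_of_nonneg_right (by positivity)

lemma one_le_renewalConst {θ : ℝ} (hθ : 5 / 2 ≤ θ) : 1 ≤ renewalConst θ := by
  have hc := one_le_convConst (s := θ - 1) (by linarith)
  nlinarith [two_mul_convConst_sq_le_renewalConst hθ]

variable {θ b κ : ℝ} {N : ℕ} {g : ℕ → ℝ} {S F : PowerSeries ℝ}

lemma RenewalKernel.rate_mul_nonneg (hθ : 5 / 2 ≤ θ) (hg : RenewalKernel θ b κ N g) :
    0 ≤ rate θ * κ :=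
  mul_nonneg (rate_pos hθ).le hg.defect_nonneg

lemma RenewalKernel.rate_mul_le_one (hθ : 5 / 2 ≤ θ) (hg : RenewalKernel θ b κ N g) :
    rate θ * κ ≤ 1 :=
  mul_le_one₀ (rate_le_one hθ) hg.defect_nonneg (by linarith [hg.defect_le])

lemma RenewalKernel.abs_coeff_le (hθ : 5 / 2 ≤ θ) (hg : RenewalKernel θ b κ N g) (hb0 : 0 ≤ b)
    (hb : b ≤ smallness θ) (hF : (1 - PowerSeries.mk g) * F = S)
    (hS : ∀ n ≤ N, |coeff n S| ≤ weight θ 1 n) : ∀ n ≤ N, |coeff n F| ≤ renewalConst θ := by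
  intro n hn
  have hc := one_le_convConst (s := θ - 1) (by linarith)
  have hx := hg.rate_mul_nonneg hθ
  have hS' : ∀ n ≤ N, |coeff n S| ≤ 1 * weight (θ - 1) 1 n := fun n hn => by
    rw [one_mul]
    exact (hS n hn).trans (weight_anti_exponent (by linarith) zero_le_one n)
  rw [eq_mul_inv_one_sub_mk hg.zero hF]
  calc _ ≤ _ := abs_coeff_mul_le_weight (by linarith) hx (hg.rate_mul_le_one hθ) one_pos le_rfl
        hS' (hg.abs_coeff_green_le hθ hb0 hb (one_sub_mk_mul_inv hg.zero)) hn
    _ = 2 * convConst (θ - 1) ^ 2 * weight (θ - 1) (rate θ * κ) n := by ring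
    _ ≤ 2 * convConst (θ - 1) ^ 2 :=
        mul_le_of_le_one_right (by positivity) (weight_le_one (by linarith) hx n)
    _ ≤ _ := two_mul_convConst_sq_le_renewalConst hθ

/-- In the convolution `S * q` with the Green function `q`, either the second index is at least
`n / 2`, where `q` decays, or the first one is, where `S` decays. -/
lemma RenewalKernel.abs_coeff_mul_green_le (hθ : 5 / 2 ≤ θ) (hg : RenewalKernel θ b κ N g)
    (hκ : 0 < κ) (hb0 : 0 ≤ b) (hb : b ≤ smallness θ)
    (hS : ∀ n ≤ N, |coeff n S| ≤ weight θ 1 n) {n j i : ℕ} (hn : n ≤ N) (hn1 : 1 ≤ n)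
    (hji : j + i = n) :
    |coeff j S * coeff i (1 - PowerSeries.mk g)⁻¹| ≤
      greenConst θ * (2 ^ (θ + 1) * greenTail θ (rate θ * κ) n) * weight θ 1 j +
        2 ^ θ * (n : ℝ) ^ (-θ) * (2 * convConst (θ - 1) * weight (θ - 1) (rate θ * κ) i) := by
  have hq := one_sub_mk_mul_inv hg.zero
  have hx := hg.rate_mul_nonneg hθ
  have hc := one_le_convConst (s := θ - 1) (by linarith)
  have hG := one_le_greenConst hθ
  have hwj := (weight_pos θ zero_le_one j).le
  have hwi := (weight_pos (θ - 1) hx i).le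
  have hV := greenTail_nonneg θ hx n
  rw [abs_mul]
  rcases le_total j i with h | h
  · have hqi : |coeff i (1 - PowerSeries.mk g)⁻¹| ≤
        greenConst θ * (2 ^ (θ + 1) * greenTail θ (rate θ * κ) n) :=
      (hg.abs_green_le hθ hκ hb0 hb hq (by omega) (by omega)).trans <| by
        gcongr
        exact greenTail_le_of_le_two_mul (by linarith) hx hn1 (by omega)
    calc _ ≤ weight θ 1 j * (greenConst θ * (2 ^ (θ + 1) * greenTail θ (rate θ * κ) n)) :=
          mul_le_mul (hS j (by omega)) hqi (abs_nonneg _) hwj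
      _ ≤ _ := by
          rw [mul_comm]
          exact le_add_of_nonneg_right (by positivity)
  · have hSj : |coeff j S| ≤ 2 ^ θ * (n : ℝ) ^ (-θ) :=
      (hS j (by omega)).trans <| (weight_one_le_rpow (by linarith) (by omega)).trans <|
        rpow_le_two_rpow_mul (by linarith) hn1 (by omega)
    exact (mul_le_mul hSj (hg.abs_coeff_green_le hθ hb0 hb hq i (by omega)) (abs_nonneg _)
      (by positivity)).trans (le_add_of_nonneg_left (by positivity))

lemma RenewalKernel.abs_coeff_le_greenTail (hθ : 5 / 2 ≤ θ) (hg : RenewalKernel θ b κ N g)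
    (hκ : 0 < κ) (hb0 : 0 ≤ b) (hb : b ≤ smallness θ) (hF : (1 - PowerSeries.mk g) * F = S)
    (hS : ∀ n ≤ N, |coeff n S| ≤ weight θ 1 n) {n : ℕ} (hn : n ≤ N) (hn1 : 1 ≤ n) :
    |coeff n F| ≤ renewalConst θ * greenTail θ (rate θ * κ) n := by
  have hx : 0 < rate θ * κ := mul_pos (rate_pos hθ) hκ
  have hx1 := hg.rate_mul_le_one hθ
  have hc := one_le_convConst (s := θ - 1) (by linarith)
  have hG := one_le_greenConst hθ
  have hV := greenTail_nonneg θ hx.le n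
  have hfst : ∑ p ∈ antidiagonal n, weight θ 1 p.1 ≤ 3 / 1 := by
    rw [Nat.sum_antidiagonal_eq_sum_range_succ_mk]
    exact sum_range_weight_le_three_div (by linarith) one_pos le_rfl _
  have hsnd : ∑ p ∈ antidiagonal n, weight (θ - 1) (rate θ * κ) p.2 ≤ 3 / (rate θ * κ) := by
    rw [← Nat.sum_antidiagonal_swap, Nat.sum_antidiagonal_eq_sum_range_succ_mk]
    exact sum_range_weight_le_three_div (by linarith) hx hx1 _
  rw [eq_mul_inv_one_sub_mk hg.zero hF, coeff_mul]
  refine (abs_sum_le_sum_abs _ _).trans ((sum_le_sum fun p hp =>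
    hg.abs_coeff_mul_green_le hθ hκ hb0 hb hS hn hn1 (mem_antidiagonal.1 hp)).trans ?_)
  rw [sum_add_distrib, ← mul_sum, ← mul_sum, ← mul_sum]
  calc _ ≤ greenConst θ * (2 ^ (θ + 1) * greenTail θ (rate θ * κ) n) * (3 / 1) +
        2 ^ θ * (n : ℝ) ^ (-θ) * (2 * convConst (θ - 1) * (3 / (rate θ * κ))) := by gcongr
    _ = 3 * greenConst θ * 2 ^ (θ + 1) * greenTail θ (rate θ * κ) n +
        6 * convConst (θ - 1) * 2 ^ θ * ((n : ℝ) ^ (-θ) * (1 / (rate θ * κ))) := by ring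
    _ ≤ 3 * greenConst θ * 2 ^ (θ + 1) * greenTail θ (rate θ * κ) n +
        6 * convConst (θ - 1) * 2 ^ θ * greenTail θ (rate θ * κ) n := by
        gcongr; exact rpow_div_le_greenTail (by linarith) hx hx1 n
    _ ≤ _ := by
        rw [← add_mul]
        exact mul_le_mul_of_nonneg_right (le_add_of_nonneg_left (by positivity)) hV

lemma abs_coeff_le_rpow_of_contraction {δ : ℝ} (hθ : 3 / 2 ≤ θ) (hδ : 0 < δ) (hδ1 : δ ≤ 1)
    (hb0 : 0 ≤ b) (hb : 4 * b * convConst θ ≤ δ) (hF : (1 - PowerSeries.mk g) * F = S)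
    (hg0 : g 0 = 0) (hg1 : |g 1| ≤ 1 - δ) (hg : ∀ m ≤ N, 2 ≤ m → |g m| ≤ b * weight θ 1 m)
    (hS0 : |coeff 0 S| ≤ 1) (hS : ∀ m ≤ N, 1 ≤ m → |coeff m S| ≤ b * weight θ 1 m)
    {n : ℕ} (hn : n ≤ N) (hn1 : 1 ≤ n) :
    |coeff n F| ≤ (δ / (4 * θ)) ^ (-θ) * (n : ℝ) ^ (-θ) := by
  have hθ0 : 0 < θ := by linarith
  have hc := one_le_convConst hθ0.le
  set y := δ / (4 * θ) with hy
  have hy0 : 0 < y := by positivity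
  have hy1 : y ≤ 1 := by rw [hy, div_le_one (by positivity)]; linarith
  have hθy : θ * y = δ / 4 := by rw [hy]; field_simp
  have hH0 : coeff 0 (1 - PowerSeries.mk g) = 1 := by simp [hg0]
  have hH : ∀ j < N, |coeff (j + 1) (1 - PowerSeries.mk g)| ≤
      (if j = 0 then 1 - δ else 0) + b * weight θ 1 (j + 1) := by
    intro j hj
    have hw := mul_nonneg hb0 (weight_pos θ zero_le_one (j + 1)).le
    rw [map_sub, coeff_one, if_neg j.succ_ne_zero, coeff_mk, zero_sub, abs_neg]
    split_ifs with h
    · subst h; exact hg1.trans (le_add_of_nonneg_right hw)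
    · rw [zero_add]; exact hg (j + 1) hj (by omega)
  have hweight : |coeff n F| ≤ 1 * weight θ y n := by
    refine abs_coeff_le_of_mul_eq (τ' := 1 - δ / 2) (σ := b) hθ hy0.le hy1 hb0 hF
      (by rw [hH0]; exact one_pos) hH (by rwa [hH0, one_mul]) (fun n hn => ?_) (fun n => ?_)
      (by rw [hH0]; nlinarith) n hn
    · exact (hS (n + 1) hn (by omega)).trans (mul_le_mul_of_nonneg_left
        (weight_anti_scale hθ0.le hy0.le hy1 _) hb0)
    · have hw := (weight_pos θ hy0.le (n + 1)).le
      calc _ ≤ (1 - δ) * ((1 + 2 * (δ / 4)) * weight θ y (n + 1)) :=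
            mul_le_mul_of_nonneg_left
              (weight_le_mul_weight_succ hθ0.le hy0.le hθy.le (by linarith) n) (by linarith)
        _ ≤ _ := by nlinarith [mul_nonneg (sq_nonneg δ) hw]
  have hn0 : (0 : ℝ) < n := by exact_mod_cast hn1
  rw [one_mul] at hweight
  refine hweight.trans ?_
  rw [← Real.mul_rpow hy0.le hn0.le]
  exact Real.rpow_le_rpow_of_nonpos (by positivity) (by linarith) (by linarith)

lemma abs_coeff_sub_le {g' : ℕ → ℝ} {S' F' : PowerSeries ℝ} {s A M : ℝ}
    (hs : 3 / 2 ≤ s) (hg0 : g 0 = 0) (hg0' : g' 0 = 0)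
    (hF : (1 - PowerSeries.mk g) * F = S) (hF' : (1 - PowerSeries.mk g') * F' = S')
    (hq : ∀ n ≤ N, |coeff n (1 - PowerSeries.mk g')⁻¹| ≤ A) (hFA : ∀ n ≤ N, |coeff n F| ≤ A)
    (hg : ∀ m ≤ N, |g m - g' m| ≤ M * weight s 1 m)
    (hS0 : coeff 0 S = coeff 0 S')
    (hS : ∀ n ≤ N, |coeff n S - coeff n S'| ≤ M * weight s 1 n) :
    ∀ n ≤ N, |coeff n F - coeff n F'| ≤ A * (1 + 3 * A) * M * n := by
  have hA : 0 ≤ A := (abs_nonneg _).trans (hFA 0 (Nat.zero_le _))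
  have hM : 0 ≤ M := by simpa using (abs_nonneg _).trans (hS 0 (Nat.zero_le _))
  set T := S - S' + (PowerSeries.mk g - PowerSeries.mk g') * F with hT
  have hFF : F - F' = T * (1 - PowerSeries.mk g')⁻¹ :=
    eq_mul_inv_one_sub_mk hg0' (by rw [hT, ← hF, ← hF']; ring)
  have hkernel : ∀ n ≤ N, |coeff n ((PowerSeries.mk g - PowerSeries.mk g') * F)| ≤ 3 * A * M := by
    intro n hn
    refine (abs_coeff_mul_le (α := fun m => M * weight s 1 m) (β := fun _ => A)
      (fun n hn => by simpa using hg n hn) hFA hn).trans ?_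
    rw [← sum_mul, Nat.sum_antidiagonal_eq_sum_range_succ_mk, ← mul_sum]
    calc _ ≤ M * (3 / 1) * A := by
          gcongr; exact sum_range_weight_le_three_div hs one_pos le_rfl (n + 1)
      _ = _ := by ring
  have hTle : ∀ n ≤ N, |coeff n T| ≤ if n = 0 then 0 else (1 + 3 * A) * M := by
    intro n hn
    split_ifs with h
    · rw [h, hT, map_add, map_sub, hS0, coeff_mul]
      simp [hg0, hg0']
    · rw [hT, map_add, map_sub]
      have hsource := (hS n hn).trans
        (mul_le_of_le_one_right hM (weight_le_one (by linarith) zero_le_one n))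
      exact ((abs_add_le _ _).trans (add_le_add hsource (hkernel n hn))).trans_eq (by ring)
  intro n hn
  rw [← map_sub, hFF]
  refine (abs_coeff_mul_le hTle hq hn).trans_eq ?_
  rw [← sum_mul, Nat.sum_antidiagonal_eq_sum_range_succ_mk, sum_range_succ']
  simp only [Nat.add_eq_zero_iff, one_ne_zero, and_false, if_false, if_true,
    sum_const, card_range, nsmul_eq_mul]
  ring

end Renewal

section LaplacianComparison

lemma deriv_deriv_nonneg_of_isLocalMin {u : ℝ → ℝ} {x : ℝ} (hmin : IsLocalMin u x)
    (hu : ContinuousAt u x) : 0 ≤ deriv (deriv u) x := by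
  by_contra! hneg
  have hmax : IsLocalMax u x := isLocalMax_of_deriv_deriv_neg hneg hmin.deriv_eq_zero hu
  have hconst : u =ᶠ[𝓝 x] fun _ => u x := by
    filter_upwards [hmin, hmax] with y h₁ h₂ using le_antisymm h₂ h₁
  have hzero : deriv (deriv u) x = 0 := by rw [hconst.deriv.deriv_eq]; simp
  exact hneg.ne hzero

variable {E : Type*} [NormedAddCommGroup E]

lemma deriv_deriv_comp_line [NormedSpace ℝ E] {h : E → ℝ} {x : E} (hh : ContDiffAt ℝ 2 h x)
    (v : E) :
    deriv (deriv fun t : ℝ => h (x + t • v)) 0 = iteratedFDeriv ℝ 2 h x ![v, v] := by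
  have hline : ∀ t : ℝ, HasDerivAt (fun t : ℝ => x + t • v) v t := fun t => by
    simpa using ((hasDerivAt_id t).smul_const v).const_add x
  have hx : x + (0 : ℝ) • v = x := by simp
  have hdiff : ∀ᶠ t in 𝓝 (0 : ℝ), DifferentiableAt ℝ h (x + t • v) := by
    refine (hline 0).continuousAt.eventually ?_
    simp only [hx]
    exact (hh.eventually (by simp)).mono fun k hk => hk.differentiableAt (by norm_num)
  have hfirst : deriv (fun t : ℝ => h (x + t • v)) =ᶠ[𝓝 0] fun t => fderiv ℝ h (x + t • v) v :=
    hdiff.mono fun t ht => (ht.hasFDerivAt.comp_hasDerivAt t (hline t)).deriv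
  have hfderiv : HasFDerivAt (fderiv ℝ h) (fderiv ℝ (fderiv ℝ h) x) (x + (0 : ℝ) • v) := by
    rw [hx]
    exact ((hh.fderiv_right (m := 1) (by norm_num)).differentiableAt (by norm_num)).hasFDerivAt
  rw [hfirst.deriv_eq, iteratedFDeriv_two_apply]
  exact ((ContinuousLinearMap.apply ℝ ℝ v).hasFDerivAt.comp_hasDerivAt (0 : ℝ)
    (hfderiv.comp_hasDerivAt (0 : ℝ) (hline 0))).deriv

variable [InnerProductSpace ℝ E] [FiniteDimensional ℝ E] {h w : E → ℝ} {x : E}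

lemma laplacian_nonneg_of_isLocalMin (hh : ContDiffAt ℝ 2 h x) (hmin : IsLocalMin h x) :
    0 ≤ Laplacian.laplacian h x := by
  rw [InnerProductSpace.laplacian_eq_iteratedFDeriv_stdOrthonormalBasis]
  refine Finset.sum_nonneg fun i _ => ?_
  set v := stdOrthonormalBasis ℝ E i
  have hline : ContinuousAt (fun t : ℝ => x + t • v) 0 := by fun_prop
  have hx : x + (0 : ℝ) • v = x := by simp
  rw [← deriv_deriv_comp_line hh]
  refine deriv_deriv_nonneg_of_isLocalMin ?_ (hh.continuousAt.comp_of_eq hline hx)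
  have hev := hline.tendsto
  rw [hx] at hev
  filter_upwards [hev.eventually hmin] with t ht
  simpa using ht

lemma abs_laplacian_le_of_abs_sub_le (hh : ContDiffAt ℝ 2 h x) (hw : ContDiffAt ℝ 2 w x)
    (hle : ∀ᶠ y in 𝓝 x, |h y - h x| ≤ w y - w x) :
    |Laplacian.laplacian h x| ≤ Laplacian.laplacian w x := by
  have hsub : 0 ≤ Laplacian.laplacian (w - h) x :=
    laplacian_nonneg_of_isLocalMin (hw.sub hh) (hle.mono fun y hy => by
      simp only [Pi.sub_apply]; linarith [(abs_le.1 hy).2])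
  have hadd : 0 ≤ Laplacian.laplacian (w + h) x :=
    laplacian_nonneg_of_isLocalMin (hw.add hh) (hle.mono fun y hy => by
      simp only [Pi.add_apply]; linarith [(abs_le.1 hy).1])
  rw [hw.laplacian_sub hh] at hsub
  rw [hw.laplacian_add hh] at hadd
  exact abs_le.2 ⟨by linarith, by linarith⟩

end LaplacianComparison

section Fourier

open Finset

variable {d : ℕ}

lemma abs_lapZero_le_mul_sigmaSq {D : (Fin d → ℤ) → ℝ} {h : Dual d → ℝ} {M : ℝ}
    (hh : ContDiffAt ℝ 2 h 0) (hD : ContDiffAt ℝ 2 (Dhat D) 0) (hD0 : Dhat D 0 = 1)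
    (hM : ∀ᶠ k in 𝓝 (0 : Dual d), |h k - h 0| ≤ M * a D k) :
    |lapZero h| ≤ M * sigmaSq D := by
  refine (abs_laplacian_le_of_abs_sub_le (w := (-M) • Dhat D) hh (hD.const_smul (-M))
    (hM.mono fun k hk => hk.trans_eq ?_)).trans_eq ?_
  · simp only [a, Pi.smul_apply, smul_eq_mul, hD0]; ring
  · rw [InnerProductSpace.laplacian_smul _ hD, sigmaSq, lapZero, smul_eq_mul]; ring

/-- The character `k ↦ exp(i k·x)` of the dual space attached to the lattice point `x`. -/
def character (x : Fin d → ℤ) (k : Dual d) : ℂ :=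
  Complex.exp (Complex.I * ((∑ i, k i * (x i : ℝ) : ℝ) : ℂ))

lemma fourier_eq_tsum_character (D : (Fin d → ℤ) → ℝ) (k : Dual d) :
    fourier D k = ∑' x, (D x : ℂ) * character x k := rfl

lemma norm_character (x : Fin d → ℤ) (k : Dual d) : ‖character x k‖ = 1 := by
  rw [character, mul_comm]; exact Complex.norm_exp_ofReal_mul_I _

lemma continuous_character (x : Fin d → ℤ) : Continuous (character x) := by
  unfold character; fun_prop

lemma character_mul_character (x y : Fin d → ℤ) (k : Dual d) :
    character x k * character y k = character (x + y) k := by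
  simp only [character, ← Complex.exp_add, ← mul_add, ← Complex.ofReal_add, ← sum_add_distrib,
    Pi.add_apply, Int.cast_add]

lemma zero_mem_cube : (0 : Dual d) ∈ cube d := fun i => by simp [Real.pi_pos.le]

lemma cube_eq_preimage (d : ℕ) :
    cube d = WithLp.ofLp ⁻¹' (Set.univ.pi fun _ : Fin d => Set.Icc (-Real.pi) Real.pi) := by
  ext k
  simp only [cube, Set.mem_ofPred_eq, Set.mem_preimage, Set.mem_univ_pi, Set.mem_Icc, abs_le]

lemma measurableSet_cube (d : ℕ) : MeasurableSet (cube d) := by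
  rw [cube_eq_preimage]
  exact (MeasurableSet.univ_pi fun _ => measurableSet_Icc).preimage
    (PiLp.volume_preserving_ofLp (Fin d)).measurable

instance isFiniteMeasure_cube (d : ℕ) : IsFiniteMeasure (volume.restrict (cube d)) := by
  constructor
  rw [Measure.restrict_apply_univ, cube_eq_preimage,
    (PiLp.volume_preserving_ofLp (Fin d)).measure_preimage
      (MeasurableSet.univ_pi fun _ => measurableSet_Icc).nullMeasurableSet, volume_pi,
    Measure.pi_pi]
  exact ENNReal.prod_lt_top fun i _ => by simp

lemma setIntegral_cube_prod (F : Fin d → ℝ → ℂ) :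
    ∫ k in cube d, ∏ i, F i (k i) = ∏ i, ∫ t in Set.Icc (-Real.pi) Real.pi, F i t := by
  rw [cube_eq_preimage, (PiLp.volume_preserving_ofLp (Fin d)).setIntegral_preimage_emb
    (MeasurableEquiv.toLp 2 (Fin d → ℝ)).symm.measurableEmbedding (fun y => ∏ i, F i (y i)),
    volume_pi, Measure.restrict_pi_pi, integral_fintype_prod_eq_prod]

lemma integral_exp_I_mul_int (n : ℤ) :
    ∫ t in Set.Icc (-Real.pi) Real.pi, Complex.exp (Complex.I * n * (t : ℂ)) =
      if n = 0 then ((2 * Real.pi : ℝ) : ℂ) else 0 := by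
  rw [integral_Icc_eq_integral_Ioc,
    ← intervalIntegral.integral_of_le (by linarith [Real.pi_pos])]
  split_ifs with hn
  · subst hn
    simp; ring
  · have hperiod : Complex.exp (Complex.I * n * (Real.pi : ℝ)) =
        Complex.exp (Complex.I * n * ((-Real.pi : ℝ) : ℂ)) :=
      Complex.exp_eq_exp_iff_exists_int.2 ⟨n, by push_cast; ring⟩
    rw [integral_exp_mul_complex (by simp [hn]), hperiod, sub_self, zero_div]

lemma integral_character (x : Fin d → ℤ) :
    ∫ k in cube d, character x k = if x = 0 then (((2 * Real.pi) ^ d : ℝ) : ℂ) else 0 := by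
  have hprod : ∀ k : Dual d,
      character x k = ∏ i, Complex.exp (Complex.I * (x i : ℤ) * (k i : ℂ)) := fun k => by
    rw [character, ← Complex.exp_sum]
    push_cast
    rw [mul_sum]
    exact congrArg _ (sum_congr rfl fun i _ => by ring)
  simp only [hprod]
  rw [setIntegral_cube_prod fun i t => Complex.exp (Complex.I * (x i : ℤ) * (t : ℂ))]
  simp only [integral_exp_I_mul_int]
  split_ifs with hx
  · subst hx; simp
  · obtain ⟨i, hi⟩ := Function.ne_iff.1 hx
    exact prod_eq_zero (mem_univ i) (by rw [if_neg]; simpa using hi)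

variable {D : (Fin d → ℤ) → ℝ}

lemma norm_mul_character (hD : ∀ x, 0 ≤ D x) (x : Fin d → ℤ) (k : Dual d) :
    ‖(D x : ℂ) * character x k‖ = D x := by
  rw [norm_mul, norm_character, mul_one, Complex.norm_real, Real.norm_of_nonneg (hD x)]

lemma continuous_fourier (hD : ∀ x, 0 ≤ D x) (hs : Summable D) : Continuous (fourier D) :=
  continuous_tsum (fun x => continuous_const.mul (continuous_character x)) hs
    fun x k => (norm_mul_character hD x k).le

lemma norm_fourier_le_one (hD : ∀ x, 0 ≤ D x) (hs : HasSum D 1) (k : Dual d) :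
    ‖fourier D k‖ ≤ 1 := by
  rw [fourier_eq_tsum_character, ← hs.tsum_eq]
  refine (norm_tsum_le_tsum_norm ?_).trans ?_ <;> simp only [norm_mul_character hD, le_refl]
  exact hs.summable

lemma continuous_Dhat (hD : ∀ x, 0 ≤ D x) (hs : Summable D) : Continuous (Dhat D) :=
  Complex.continuous_re.comp (continuous_fourier hD hs)

lemma abs_Dhat_le_one (hD : ∀ x, 0 ≤ D x) (hs : HasSum D 1) (k : Dual d) : |Dhat D k| ≤ 1 :=
  (Complex.abs_re_le_norm _).trans (norm_fourier_le_one hD hs k)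

lemma Dhat_zero (hs : HasSum D 1) : Dhat D 0 = 1 := by
  have hsum : fourier D 0 = ((1 : ℝ) : ℂ) := by
    rw [← hs.tsum_eq, Complex.ofReal_tsum]
    simp [fourier]
  rw [Dhat, hsum, Complex.ofReal_re]

lemma hasSum_integral_fourier_mul (hD : ∀ x, 0 ≤ D x) (hs : Summable D) {φ : Dual d → ℂ}
    (hφ : Continuous φ) (hφ1 : ∀ k, ‖φ k‖ ≤ 1) :
    HasSum (fun x => (D x : ℂ) * ∫ k in cube d, character x k * φ k)
      (∫ k in cube d, fourier D k * φ k) := by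
  have hbound : ∀ x k, ‖(D x : ℂ) * character x k * φ k‖ ≤ D x := fun x k => by
    rw [norm_mul, norm_mul_character hD]
    exact mul_le_of_le_one_right (hD x) (hφ1 k)
  have hint : ∀ x, Integrable (fun k => (D x : ℂ) * character x k * φ k)
      (volume.restrict (cube d)) := fun x =>
    .of_bound ((continuous_const.mul (continuous_character x)).mul hφ).aestronglyMeasurable (D x)
      (.of_forall (hbound x))
  have hsummable : Summable fun x =>
      ∫ k, ‖(D x : ℂ) * character x k * φ k‖ ∂(volume.restrict (cube d)) := by
    refine .of_nonneg_of_le (fun x => integral_nonneg fun k => norm_nonneg _) (fun x => ?_)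
      (hs.mul_right ((volume.restrict (cube d)).real Set.univ))
    calc _ ≤ ∫ _, D x ∂(volume.restrict (cube d)) :=
          integral_mono (hint x).norm (integrable_const _) (hbound x)
      _ = _ := by rw [integral_const, smul_eq_mul, mul_comm]
  have hsum := hasSum_integral_of_summable_integral_norm hint hsummable
  simp only [fourier_eq_tsum_character, ← tsum_mul_right, ← integral_const_mul, ← mul_assoc]
  exact hsum

lemma integral_character_mul_fourier (hD : ∀ x, 0 ≤ D x) (hs : Summable D) (y : Fin d → ℤ) :
    ∫ k in cube d, character y k * fourier D k = (((2 * Real.pi) ^ d * D (-y) : ℝ) : ℂ) := by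
  have hsum := hasSum_integral_fourier_mul hD hs (continuous_character y)
    fun k => (norm_character y k).le
  simp only [character_mul_character, integral_character, add_eq_zero_iff_eq_neg] at hsum
  have hsingle := hsum.unique (hasSum_single (-y) fun x hx => by rw [if_neg hx, mul_zero])
  simp only [mul_comm (character y _), hsingle, if_true]
  push_cast; ring

lemma hasSum_integral_Dhat_sq (hD : ∀ x, 0 ≤ D x) (hs : HasSum D 1)
    (hreal : ∀ k ∈ cube d, fourier D k = (Dhat D k : ℂ)) :
    HasSum (fun x => D x * ((2 * Real.pi) ^ d * D (-x))) (∫ k in cube d, Dhat D k ^ 2) := by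
  have hsum := hasSum_integral_fourier_mul hD hs.summable (continuous_fourier hD hs.summable)
    (norm_fourier_le_one hD hs)
  simp only [integral_character_mul_fourier hD hs.summable] at hsum
  have hsq : ∫ k in cube d, fourier D k * fourier D k =
      ((∫ k in cube d, Dhat D k ^ 2 : ℝ) : ℂ) := by
    rw [← integral_complex_ofReal]
    refine setIntegral_congr_fun (measurableSet_cube d) fun k hk => ?_
    simp only [hreal k hk]
    push_cast; ring
  rw [← Complex.hasSum_ofReal, ← hsq]
  simpa only [Complex.ofReal_mul] using hsum

lemma lintegral_Dhat_sq_le (hD : ∀ x, 0 ≤ D x) (hs : HasSum D 1) {B : ℝ} (hB : ∀ x, D x ≤ B)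
    (hreal : ∀ k ∈ cube d, fourier D k = (Dhat D k : ℂ)) :
    ∫⁻ k in cube d, ‖Dhat D k ^ 2‖ₑ ≤ ENNReal.ofReal ((2 * Real.pi) ^ d * B) := by
  have hint : Integrable (fun k => Dhat D k ^ 2) (volume.restrict (cube d)) :=
    .of_bound ((continuous_Dhat hD hs.summable).pow 2).aestronglyMeasurable 1
      (.of_forall fun k => by
        rw [norm_pow, Real.norm_eq_abs]
        exact pow_le_one₀ (abs_nonneg _) (abs_Dhat_le_one hD hs k))
  have hupper := hs.mul_right ((2 * Real.pi) ^ d * B)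
  rw [one_mul] at hupper
  rw [← ofReal_integral_norm_eq_lintegral_enorm hint]
  simp only [norm_pow, Real.norm_eq_abs, sq_abs]
  refine ENNReal.ofReal_le_ofReal (hasSum_le (fun x => ?_) (hasSum_integral_Dhat_sq hD hs hreal)
    hupper)
  have := hD x
  have := hB (-x)
  gcongr

end Fourier

section Scaling

variable {d : ℕ}

lemma lintegral_comp_smul (φ : Dual d → ℝ≥0∞) {r : ℝ} (hr : 0 < r) :
    ∫⁻ k, φ (r • k) = ENNReal.ofReal (beta d r) * ∫⁻ k, φ k := by
  have hmap := Measure.map_addHaar_smul (volume : Measure (Dual d)) hr.ne'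
  rw [← (measurableEmbedding_const_smul₀ (α := Dual d) hr.ne').lintegral_map (μ := volume) φ, hmap,
    lintegral_smul_measure, finrank_euclideanSpace_fin, abs_of_pos (by positivity)]
  rfl

lemma setLIntegral_ball_comp_smul (φ : Dual d → ℝ≥0∞) (ρ : ℝ) {r : ℝ} (hr : 0 < r) :
    ∫⁻ k in Metric.ball 0 (ρ / r), φ (r • k) =
      ENNReal.ofReal (beta d r) * ∫⁻ k in Metric.ball 0 ρ, φ k := by
  rw [← lintegral_indicator measurableSet_ball, ← lintegral_indicator measurableSet_ball,
    ← lintegral_comp_smul _ hr]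
  refine lintegral_congr fun k => ?_
  simp only [Set.indicator, mem_ball_zero_iff, norm_smul, Real.norm_of_nonneg hr.le,
    lt_div_iff₀' hr]

lemma integrableOn_norm_sq_rpow (hd : 0 < d) (ρ : ℝ) :
    IntegrableOn (fun k : Dual d => (‖k‖ ^ 2) ^ (1 / 4 - (d : ℝ) / 2)) (Metric.ball 0 ρ) := by
  have : Nonempty (Fin d) := ⟨⟨0, hd⟩⟩
  rw [integrableOn_fun_norm_addHaar (volume : Measure (Dual d))
    (f := fun y : ℝ => (y ^ 2) ^ (1 / 4 - (d : ℝ) / 2)), finrank_euclideanSpace_fin]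
  rcases le_or_gt ρ 0 with hρ | hρ
  · simp [Set.Ioo_eq_empty_of_le hρ]
  refine ((intervalIntegral.integrableOn_Ioo_rpow_iff hρ (s := -1 / 2)).2 (by norm_num)).congr_fun
    (fun y hy => ?_) measurableSet_Ioo
  have hy0 : 0 < y := hy.1
  simp only [smul_eq_mul]
  rw [← Real.rpow_natCast, ← Real.rpow_natCast, ← Real.rpow_mul hy0.le, ← Real.rpow_add hy0]
  congr 1
  rw [Nat.cast_sub hd]; push_cast; ring

lemma setLIntegral_ball_norm_sq_rpow_lt_top (hd : 0 < d) (ρ : ℝ) :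
    ∫⁻ k in Metric.ball (0 : Dual d) ρ, ENNReal.ofReal ((‖k‖ ^ 2) ^ (1 / 4 - (d : ℝ) / 2)) < ∞ :=
  (integrableOn_norm_sq_rpow hd ρ).lintegral_lt_top

lemma lintegral_weight_norm_sq_lt_top (d : ℕ) :
    ∫⁻ k : Dual d, ENNReal.ofReal (weight ((d : ℝ) / 2 + 1) (‖k‖ ^ 2) 1) < ∞ := by
  have hint := (integrable_rpow_neg_one_add_norm_sq (E := Dual d) (μ := volume) (r := d + 2)
    (by rw [finrank_euclideanSpace_fin]; linarith)).lintegral_lt_top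
  convert hint using 4 with k
  rw [weight, Nat.cast_one, mul_one]
  congr 1; ring

lemma beta_sqrt_natCast (d : ℕ) (n : ℕ) : beta d √(n : ℝ) = (n : ℝ) ^ (-((d : ℝ) / 2)) := by
  rw [beta, Real.sqrt_eq_rpow, ← Real.rpow_natCast, ← Real.rpow_mul n.cast_nonneg,
    Real.rpow_neg n.cast_nonneg]
  congr 2; ring

lemma beta_mul (d : ℕ) (r s : ℝ) : beta d (r * s) = beta d r * beta d s := by
  rw [beta, mul_pow, mul_inv]; rfl

lemma beta_pos (d : ℕ) {L : ℝ} (hL : 0 < L) : 0 < beta d L := by unfold beta; positivity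

lemma greenTail_norm_sq_eq {r : ℝ} (hr : 0 < r) {n : ℕ} (θ : ℝ) (k : Dual d) :
    greenTail θ (r ^ 2 * ‖k‖ ^ 2) n = (n : ℝ) ^ (-θ) * (‖r • k‖ ^ 2) ^ (1 / 4 - θ) +
      weight (θ + 1) (‖(r * √(n : ℝ)) • k‖ ^ 2) 1 := by
  rw [norm_smul, norm_smul, Real.norm_of_nonneg hr.le, Real.norm_of_nonneg (by positivity)]
  simp only [greenTail, weight, mul_pow, Real.sq_sqrt n.cast_nonneg, Nat.cast_one, mul_one]
  congr 3; ring

lemma ofReal_greenTail_norm_sq {r : ℝ} (hr : 0 < r) {n : ℕ} (θ : ℝ) (k : Dual d) :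
    ENNReal.ofReal (greenTail θ (r ^ 2 * ‖k‖ ^ 2) n) =
      ENNReal.ofReal ((n : ℝ) ^ (-θ)) * ENNReal.ofReal ((‖r • k‖ ^ 2) ^ (1 / 4 - θ)) +
        ENNReal.ofReal (weight (θ + 1) (‖(r * √(n : ℝ)) • k‖ ^ 2) 1) := by
  rw [greenTail_norm_sq_eq hr, ENNReal.ofReal_add (by positivity)
    (weight_pos _ (sq_nonneg _) 1).le, ENNReal.ofReal_mul (by positivity)]

lemma exists_setLIntegral_greenTail_le (hd : 0 < d) (ρ : ℝ) :
    ∃ B : ℝ, 0 ≤ B ∧ ∀ r : ℝ, 0 < r → ∀ n : ℕ, 1 ≤ n →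
      ∫⁻ k in Metric.ball (0 : Dual d) (ρ / r),
        ENNReal.ofReal (greenTail ((d : ℝ) / 2) (r ^ 2 * ‖k‖ ^ 2) n) ≤
      ENNReal.ofReal (B * beta d r * (n : ℝ) ^ (-((d : ℝ) / 2))) := by
  set φ : Dual d → ℝ≥0∞ := fun k => ENNReal.ofReal ((‖k‖ ^ 2) ^ (1 / 4 - (d : ℝ) / 2))
  set ψ : Dual d → ℝ≥0∞ := fun k => ENNReal.ofReal (weight ((d : ℝ) / 2 + 1) (‖k‖ ^ 2) 1)
  have hφ : ∫⁻ k in Metric.ball 0 ρ, φ k ≠ ∞ := (setLIntegral_ball_norm_sq_rpow_lt_top hd ρ).ne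
  have hψ : ∫⁻ k, ψ k ≠ ∞ := (lintegral_weight_norm_sq_lt_top d).ne
  set I := (∫⁻ k in Metric.ball 0 ρ, φ k).toReal
  set J := (∫⁻ k, ψ k).toReal
  refine ⟨I + J, by positivity, fun r hr n hn => ?_⟩
  set ν := (n : ℝ) ^ (-((d : ℝ) / 2))
  have hν : 0 ≤ ν := by positivity
  have hn0 : 0 < √(n : ℝ) := Real.sqrt_pos.2 (by exact_mod_cast hn)
  have hβ := (beta_pos d hr).le
  have hm : Measurable fun k : Dual d => φ (r • k) := by fun_prop
  calc ∫⁻ k in Metric.ball (0 : Dual d) (ρ / r),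
        ENNReal.ofReal (greenTail ((d : ℝ) / 2) (r ^ 2 * ‖k‖ ^ 2) n)
      = ENNReal.ofReal ν * (∫⁻ k in Metric.ball 0 (ρ / r), φ (r • k)) +
        ∫⁻ k in Metric.ball 0 (ρ / r), ψ ((r * √(n : ℝ)) • k) := by
        simp only [ofReal_greenTail_norm_sq hr]
        rw [lintegral_add_left (hm.const_mul _), lintegral_const_mul _ hm]
    _ ≤ ENNReal.ofReal ν * (∫⁻ k in Metric.ball 0 (ρ / r), φ (r • k)) +
        ∫⁻ k, ψ ((r * √(n : ℝ)) • k) := by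
        gcongr
        exact Measure.restrict_le_self
    _ = ENNReal.ofReal (ν * (beta d r * I) + beta d r * ν * J) := by
        have hscale : beta d (r * √(n : ℝ)) = beta d r * ν := by rw [beta_mul, beta_sqrt_natCast]
        rw [setLIntegral_ball_comp_smul φ ρ hr, lintegral_comp_smul ψ (mul_pos hr hn0), hscale,
          ENNReal.ofReal_add (by positivity) (by positivity), ENNReal.ofReal_mul hν,
          ENNReal.ofReal_mul (q := I) hβ, ENNReal.ofReal_mul (q := J) (by positivity),
          ENNReal.ofReal_toReal hφ, ENNReal.ofReal_toReal hψ]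
    _ = ENNReal.ofReal ((I + J) * beta d r * ν) := by congr 1; ring

end Scaling

section Kernel

open Finset

variable {d : ℕ} {f g e : ℕ → Dual d → ℝ → ℝ} {k : Dual d} {z : ℝ}

/-- The coefficients `g_m(k;z)` at fixed `k` and `z` as a sequence on `ℕ`, with value `0` at `0`. -/
def kernelSeq (g : ℕ → Dual d → ℝ → ℝ) (k : Dual d) (z : ℝ) (m : ℕ) : ℝ :=
  if m = 0 then 0 else g m k z

/-- The source term of the recursion at fixed `k` and `z`; the initial value `f_0 = 1` is its term
of index `0`. -/
def sourceSeq (e : ℕ → Dual d → ℝ → ℝ) (k : Dual d) (z : ℝ) (n : ℕ) : ℝ :=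
  if n = 0 then 1 else e n k z

lemma kernelSeq_zero (g : ℕ → Dual d → ℝ → ℝ) (k : Dual d) (z : ℝ) : kernelSeq g k z 0 = 0 := rfl

lemma kernelSeq_of_pos (g : ℕ → Dual d → ℝ → ℝ) (k : Dual d) (z : ℝ) {m : ℕ} (hm : 1 ≤ m) :
    kernelSeq g k z m = g m k z := if_neg (by omega)

lemma sourceSeq_of_pos (e : ℕ → Dual d → ℝ → ℝ) (k : Dual d) (z : ℝ) {m : ℕ} (hm : 1 ≤ m) :
    sourceSeq e k z m = e m k z := if_neg (by omega)

lemma sum_range_kernelSeq_mul (φ : ℕ → ℝ) (N : ℕ) :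
    ∑ m ∈ range (N + 1), kernelSeq g k z m * φ m = ∑ m ∈ Icc 1 N, g m k z * φ m := by
  rw [range_eq_Ico, sum_eq_sum_Ico_succ_bot N.succ_pos, kernelSeq_zero, zero_mul, zero_add,
    ← Ico_add_one_right_eq_Icc]
  exact sum_congr rfl fun m hm => by rw [kernelSeq_of_pos g k z (mem_Ico.1 hm).1]

lemma sum_range_kernelSeq (N : ℕ) :
    ∑ m ∈ range (N + 1), kernelSeq g k z m = ∑ m ∈ Icc 1 N, g m k z := by
  simpa using sum_range_kernelSeq_mul (g := g) (k := k) (z := z) (fun _ => 1) N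

lemma Recursion.eq_antidiagonal (h : Recursion f g e) (hz : 0 < z) (hk : k ∈ cube d) (n : ℕ) :
    f n k z = ∑ p ∈ antidiagonal n, kernelSeq g k z p.1 * f p.2 k z + sourceSeq e k z n := by
  obtain ⟨hzero, hsucc⟩ := h z hz k hk
  rw [Nat.sum_antidiagonal_eq_sum_range_succ_mk,
    sum_range_kernelSeq_mul fun m => f (n - m) k z]
  cases n with
  | zero => simp [sourceSeq, hzero]
  | succ n => rw [hsucc n, sourceSeq_of_pos e k z n.succ_pos]

lemma Recursion.powerSeries (h : Recursion f g e) (hz : 0 < z) (hk : k ∈ cube d) :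
    (1 - PowerSeries.mk (kernelSeq g k z)) * PowerSeries.mk (fun n => f n k z) =
      PowerSeries.mk (sourceSeq e k z) := by
  ext n
  rw [sub_mul, one_mul, map_sub, PowerSeries.coeff_mul]
  simp only [PowerSeries.coeff_mk]
  linear_combination h.eq_antidiagonal hz hk n

end Kernel

section StepDistribution

variable {d : ℕ} {f g e : ℕ → Dual d → ℝ → ℝ} {ε C c₁ c₂ η L : ℝ} {D : (Fin d → ℤ) → ℝ}

lemma cube_mem_nhds (d : ℕ) : cube d ∈ 𝓝 (0 : Dual d) := by
  refine mem_of_superset (Metric.ball_mem_nhds 0 Real.pi_pos) fun k hk i => ?_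
  rw [mem_ball_zero_iff] at hk
  exact (PiLp.norm_apply_le k i).trans hk.le

lemma AssumptionD.fourier_eq_Dhat (h : AssumptionD ε C c₁ c₂ η L D f e) {k : Dual d}
    (hk : k ∈ cube d) : fourier D k = (Dhat D k : ℂ) := by
  have hone := h.f_one 1 one_pos k hk
  rw [Complex.ofReal_one, one_mul] at hone
  rw [Dhat, ← hone, Complex.ofReal_re]

lemma AssumptionD.f_one_eq (h : AssumptionD ε C c₁ c₂ η L D f e) {k : Dual d}
    (hk : k ∈ cube d) {z : ℝ} (hz : 0 < z) : f 1 k z = z * Dhat D k := by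
  have hone := h.f_one z hz k hk
  rw [h.fourier_eq_Dhat hk] at hone
  exact_mod_cast hone

lemma AssumptionD.g_one_eq (h : AssumptionD ε C c₁ c₂ η L D f e) (hr : Recursion f g e)
    {k : Dual d} (hk : k ∈ cube d) {z : ℝ} (hz : 0 < z) : g 1 k z = z * Dhat D k := by
  obtain ⟨hzero, hsucc⟩ := hr z hz k hk
  have hone := hsucc 0
  simp only [zero_add, Finset.Icc_self, Finset.sum_singleton, Nat.sub_self, hzero, mul_one,
    h.e_one z hz k hk, add_zero] at hone
  rw [← hone, h.f_one_eq hk hz]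

lemma AssumptionD.Dhat_zero (h : AssumptionD ε C c₁ c₂ η L D f e) : Dhat D 0 = 1 :=
  LaceRec.Dhat_zero h.normalised

lemma AssumptionD.g_one_zero_eq (h : AssumptionD ε C c₁ c₂ η L D f e) (hr : Recursion f g e)
    {z : ℝ} (hz : 0 < z) : g 1 0 z = z := by
  rw [h.g_one_eq hr zero_mem_cube hz, h.Dhat_zero, mul_one]

lemma AssumptionD.contDiffAt_Dhat (h : AssumptionD ε C c₁ c₂ η L D f e)
    (hS : AssumptionS f g e) : ContDiffAt ℝ 2 (Dhat D) 0 := by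
  refine (hS.smooth_f 1 1 one_pos).congr_of_eventuallyEq ?_
  filter_upwards [cube_mem_nhds d] with k hk
  rw [h.f_one_eq hk one_pos, one_mul]

lemma AssumptionD.abs_Dhat_le_one (h : AssumptionD ε C c₁ c₂ η L D f e) (k : Dual d) :
    |Dhat D k| ≤ 1 := LaceRec.abs_Dhat_le_one h.nonneg h.normalised k

lemma AssumptionD.a_nonneg (h : AssumptionD ε C c₁ c₂ η L D f e) (k : Dual d) : 0 ≤ a D k :=
  sub_nonneg.2 (abs_le.1 (h.abs_Dhat_le_one k)).2

lemma AssumptionD.sigmaSq_nonneg (h : AssumptionD ε C c₁ c₂ η L D f e)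
    (hS : AssumptionS f g e) : 0 ≤ sigmaSq D := by
  have hlap := abs_lapZero_le_mul_sigmaSq (D := D) (h := fun _ => (0 : ℝ)) (M := 1)
    contDiffAt_const (h.contDiffAt_Dhat hS) h.Dhat_zero
    (.of_forall fun k => by simpa using h.a_nonneg k)
  rw [one_mul] at hlap
  exact (abs_nonneg _).trans hlap

end StepDistribution

section ControlledKernel

open Finset

/-- The bounds on the coefficients of index `m` used in the analysis of the recursion. Those of
`EBounds` and `GBounds` imply them with `B` a multiple of `β`, the weights replacing powers
of `m`. -/
structure CoeffBounds {d : ℕ} (B : ℝ) (D : (Fin d → ℤ) → ℝ) (g e : ℕ → Dual d → ℝ → ℝ)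
    (m : ℕ) (z : ℝ) : Prop where
  e_sup : ∀ k ∈ cube d, |e m k z| ≤ B * weight ((d : ℝ) / 2) 1 m
  e_diff : ∀ k ∈ cube d, |e m k z - e m 0 z| ≤ B * a D k * weight ((d : ℝ) / 2 - 1) 1 m
  g_sup : ∀ k ∈ cube d, |g m k z| ≤ B * weight ((d : ℝ) / 2) 1 m
  g_diff : ∀ k ∈ cube d, |g m k z - g m 0 z| ≤ B * a D k * weight ((d : ℝ) / 2 - 1) 1 m
  differentiable : DifferentiableAt ℝ (fun w => g m 0 w) z
  deriv_le : |deriv (fun w => g m 0 w) z| ≤ B * weight ((d : ℝ) / 2 - 1) 1 m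

/-- The parameter `z` is critical up to the resolution of the first `N` coefficients: these are
bounded, and the mass `∑_{m ≤ N} g_m(0;z)` differs from `1` by no more than the tail of a kernel
satisfying the same bounds. -/
structure Controlled {d : ℕ} (B : ℝ) (D : (Fin d → ℤ) → ℝ) (g e : ℕ → Dual d → ℝ → ℝ)
    (N : ℕ) (z : ℝ) : Prop where
  near_one : |z - 1| ≤ 2 * B
  coeff : ∀ m ≤ N, 2 ≤ m → CoeffBounds B D g e m z
  crit : |1 - ∑ m ∈ Icc 1 N, g m 0 z| ≤ 4 * B * weight ((d : ℝ) / 2 - 1) 1 N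

variable {d : ℕ} {f g e : ℕ → Dual d → ℝ → ℝ} {ε C c₁ c₂ η L B z : ℝ} {D : (Fin d → ℤ) → ℝ}
  {N : ℕ} {k : Dual d}

lemma Controlled.nonneg (hc : Controlled B D g e N z) : 0 ≤ B := by
  linarith [(abs_nonneg _).trans hc.near_one]

lemma Controlled.mem_Icc (hc : Controlled B D g e N z) (hB : 12 * B ≤ 1) :
    z ∈ Set.Icc (5 / 6 : ℝ) (7 / 6) := by
  have := abs_le.1 hc.near_one
  constructor <;> linarith

lemma five_halves_le_half (hd : 4 < d) : (5 : ℝ) / 2 ≤ (d : ℝ) / 2 := by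
  have : ((5 : ℕ) : ℝ) ≤ d := Nat.cast_le.2 hd
  push_cast at this
  linarith

lemma two_le_two_mul_two_rpow_mul_weight (s : ℝ) : 2 ≤ 2 * 2 ^ s * weight s 1 1 := by
  rw [weight, mul_assoc, Nat.cast_one, mul_one, one_add_one_eq_two,
    ← Real.rpow_add two_pos, add_neg_cancel, Real.rpow_zero, mul_one]

lemma Controlled.abs_kernelSeq_sub_le (hd : 4 < d) (hr : Recursion f g e)
    (hD : AssumptionD ε C c₁ c₂ η L D f e) (hc : Controlled B D g e N z) (hB : 12 * B ≤ 1)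
    (hk : k ∈ cube d) {m : ℕ} (hm : m ≤ N) :
    |kernelSeq g k z m - kernelSeq g 0 z m| ≤
      2 * 2 ^ ((d : ℝ) / 2 - 1) * a D k * weight ((d : ℝ) / 2 - 1) 1 m := by
  have hz := hc.mem_Icc hB
  have hz0 : 0 < z := by linarith [hz.1]
  have ha := hD.a_nonneg k
  have hw := (weight_pos ((d : ℝ) / 2 - 1) zero_le_one m).le
  obtain rfl | rfl | hm2 : m = 0 ∨ m = 1 ∨ 2 ≤ m := by omega
  · rw [kernelSeq_zero, kernelSeq_zero, sub_self, abs_zero]; positivity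
  · rw [kernelSeq_of_pos g k z le_rfl, kernelSeq_of_pos g 0 z le_rfl, hD.g_one_eq hr hk hz0,
      hD.g_one_zero_eq hr hz0]
    have hdefect : z * Dhat D k - z = -(z * a D k) := by unfold a; ring
    rw [hdefect, abs_neg, abs_of_nonneg (by positivity)]
    have hweight := two_le_two_mul_two_rpow_mul_weight ((d : ℝ) / 2 - 1)
    calc z * a D k ≤ 2 * a D k := by gcongr; linarith [hz.2]
      _ ≤ 2 * 2 ^ ((d : ℝ) / 2 - 1) * weight ((d : ℝ) / 2 - 1) 1 1 * a D k := by gcongr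
      _ = _ := by ring
  · rw [kernelSeq_of_pos g k z (by omega), kernelSeq_of_pos g 0 z (by omega)]
    have hpow : (1 : ℝ) ≤ 2 ^ ((d : ℝ) / 2 - 1) :=
      Real.one_le_rpow one_le_two (by linarith [five_halves_le_half hd])
    exact ((hc.coeff m hm hm2).g_diff k hk).trans (by gcongr; linarith)

lemma Controlled.abs_sourceSeq_sub_le (hd : 4 < d) (hD : AssumptionD ε C c₁ c₂ η L D f e)
    (hc : Controlled B D g e N z) (hB : 12 * B ≤ 1) (hk : k ∈ cube d) {m : ℕ} (hm : m ≤ N) :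
    |sourceSeq e k z m - sourceSeq e 0 z m| ≤
      2 * 2 ^ ((d : ℝ) / 2 - 1) * a D k * weight ((d : ℝ) / 2 - 1) 1 m := by
  have hz0 : 0 < z := by linarith [(hc.mem_Icc hB).1]
  have ha := hD.a_nonneg k
  have hw := (weight_pos ((d : ℝ) / 2 - 1) zero_le_one m).le
  obtain rfl | rfl | hm2 : m = 0 ∨ m = 1 ∨ 2 ≤ m := by omega
  · rw [sourceSeq, sourceSeq, if_pos rfl, if_pos rfl, sub_self, abs_zero]; positivity
  · rw [sourceSeq_of_pos e k z le_rfl, sourceSeq_of_pos e 0 z le_rfl, hD.e_one z hz0 k hk,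
      hD.e_one z hz0 0 zero_mem_cube, sub_self, abs_zero]
    positivity
  · rw [sourceSeq_of_pos e k z (by omega), sourceSeq_of_pos e 0 z (by omega)]
    have hpow : (1 : ℝ) ≤ 2 ^ ((d : ℝ) / 2 - 1) :=
      Real.one_le_rpow one_le_two (by linarith [five_halves_le_half hd])
    exact ((hc.coeff m hm hm2).e_diff k hk).trans (by gcongr; linarith)

lemma Controlled.abs_sourceSeq_le (hD : AssumptionD ε C c₁ c₂ η L D f e)
    (hc : Controlled B D g e N z) (hB : 12 * B ≤ 1) (hk : k ∈ cube d) {m : ℕ} (hm : m ≤ N)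
    (hm0 : 1 ≤ m) : |sourceSeq e k z m| ≤ B * weight ((d : ℝ) / 2) 1 m := by
  have hz0 : 0 < z := by linarith [(hc.mem_Icc hB).1]
  rw [sourceSeq_of_pos e k z hm0]
  rcases hm0.eq_or_lt with rfl | hm2
  · rw [hD.e_one z hz0 k hk, abs_zero]
    exact mul_nonneg hc.nonneg (weight_pos _ zero_le_one 1).le
  · exact (hc.coeff m hm hm2).e_sup k hk

lemma Controlled.abs_sourceSeq_le_weight (hD : AssumptionD ε C c₁ c₂ η L D f e)
    (hc : Controlled B D g e N z) (hB : 12 * B ≤ 1) (hk : k ∈ cube d) {m : ℕ} (hm : m ≤ N) :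
    |sourceSeq e k z m| ≤ weight ((d : ℝ) / 2) 1 m := by
  rcases Nat.eq_zero_or_pos m with rfl | hm0
  · simp [sourceSeq, weight]
  · exact (hc.abs_sourceSeq_le hD hB hk hm hm0).trans
      (mul_le_of_le_one_left (weight_pos _ zero_le_one m).le (by linarith [hc.nonneg]))

lemma Controlled.abs_kernelSeq_le (hc : Controlled B D g e N z) (hk : k ∈ cube d) {m : ℕ}
    (hm : m ≤ N) (hm2 : 2 ≤ m) : |kernelSeq g k z m| ≤ B * weight ((d : ℝ) / 2) 1 m := by
  rw [kernelSeq_of_pos g k z (by omega)]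
  exact (hc.coeff m hm hm2).g_sup k hk

/-- The amount by which the total mass of the kernel at `k`, truncated at `N`, falls short of that
at `0`. -/
def massDefect (g : ℕ → Dual d → ℝ → ℝ) (N : ℕ) (k : Dual d) (z : ℝ) : ℝ :=
  ∑ m ∈ range (N + 1), (kernelSeq g 0 z m - kernelSeq g k z m)

lemma Controlled.abs_massDefect_sub_le (hd : 4 < d) (hr : Recursion f g e)
    (hD : AssumptionD ε C c₁ c₂ η L D f e) (hc : Controlled B D g e N z) (hB : 12 * B ≤ 1)
    (hN : 1 ≤ N) (hk : k ∈ cube d) :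
    |massDefect g N k z - z * a D k| ≤ 3 * B * a D k := by
  have hz0 : 0 < z := by linarith [(hc.mem_Icc hB).1]
  have hθ := five_halves_le_half hd
  have hBa : 0 ≤ B * a D k := mul_nonneg hc.nonneg (hD.a_nonneg k)
  have hstep : massDefect g N k z - z * a D k =
      ∑ m ∈ Ico 2 (N + 1), (kernelSeq g 0 z m - kernelSeq g k z m) := by
    rw [massDefect, ← sum_range_add_sum_Ico _ (by omega : 2 ≤ N + 1), sum_range_succ,
      sum_range_one, kernelSeq_zero, kernelSeq_zero, kernelSeq_of_pos g 0 z le_rfl,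
      kernelSeq_of_pos g k z le_rfl, hD.g_one_eq hr hk hz0, hD.g_one_zero_eq hr hz0, a]
    ring
  calc |massDefect g N k z - z * a D k|
      ≤ ∑ m ∈ Ico 2 (N + 1), B * a D k * weight ((d : ℝ) / 2 - 1) 1 m := by
        rw [hstep]
        refine (abs_sum_le_sum_abs _ _).trans (sum_le_sum fun m hm => ?_)
        rw [mem_Ico] at hm
        rw [abs_sub_comm, kernelSeq_of_pos g 0 z (by omega), kernelSeq_of_pos g k z (by omega)]
        exact (hc.coeff m (by omega) hm.1).g_diff k hk
    _ ≤ ∑ m ∈ range (N + 1), B * a D k * weight ((d : ℝ) / 2 - 1) 1 m :=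
        sum_le_sum_of_subset_of_nonneg (fun m hm => mem_range.2 (mem_Ico.1 hm).2)
          fun m _ _ => mul_nonneg hBa (weight_pos _ zero_le_one m).le
    _ ≤ B * a D k * (3 / 1) := by
        rw [← mul_sum]
        gcongr
        exact sum_range_weight_le_three_div (by linarith) one_pos le_rfl _
    _ = 3 * B * a D k := by ring

lemma Controlled.massDefect_mem_Icc (hd : 4 < d) (hr : Recursion f g e)
    (hD : AssumptionD ε C c₁ c₂ η L D f e) (hc : Controlled B D g e N z) (hB : 12 * B ≤ 1)
    (hN : 1 ≤ N) (hk : k ∈ cube d) :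
    massDefect g N k z ∈ Set.Icc (a D k / 2) (2 * a D k) := by
  have hz := hc.mem_Icc hB
  have ha := hD.a_nonneg k
  have hdefect := abs_le.1 (hc.abs_massDefect_sub_le hd hr hD hB hN hk)
  constructor <;> nlinarith [hz.1, hz.2]

lemma Controlled.abs_sum_Ico_kernelSeq_le (hd : 4 < d) (hc : Controlled B D g e N z)
    (hk : k ∈ cube d) {j : ℕ} (hj : 1 ≤ j) :
    |∑ m ∈ Ico (j + 1) (N + 1), kernelSeq g k z m| ≤ B * weight ((d : ℝ) / 2 - 1) 1 j := by
  rw [← sum_Ico_add']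
  calc |∑ m ∈ Ico j N, kernelSeq g k z (m + 1)|
      ≤ ∑ m ∈ Ico j N, B * weight ((d : ℝ) / 2) 1 (m + 1) := by
        refine (abs_sum_le_sum_abs _ _).trans (sum_le_sum fun m hm => ?_)
        rw [mem_Ico] at hm
        exact hc.abs_kernelSeq_le hk (by omega) (by omega)
    _ ≤ B * weight ((d : ℝ) / 2 - 1) 1 j := by
        rw [← mul_sum]
        have := hc.nonneg
        gcongr
        exact sum_Ico_weight_succ_le (by linarith [five_halves_le_half hd]) _ _

lemma Controlled.renewalKernel (hd : 4 < d) (hr : Recursion f g e)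
    (hD : AssumptionD ε C c₁ c₂ η L D f e) (hc : Controlled B D g e N z) (hB : 12 * B ≤ 1)
    (hN : 1 ≤ N) (hk : k ∈ cube d) (hak : a D k ≤ 1 / 4) :
    RenewalKernel ((d : ℝ) / 2) (5 * B) (massDefect g N k z) N (kernelSeq g k z) where
  defect_nonneg := by
    linarith [(hc.massDefect_mem_Icc hd hr hD hB hN hk).1, hD.a_nonneg k]
  defect_le := by linarith [(hc.massDefect_mem_Icc hd hr hD hB hN hk).2]
  zero := kernelSeq_zero g k z
  one := by
    have hz := hc.mem_Icc hB
    have hz0 : 0 < z := by linarith [hz.1]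
    rw [kernelSeq_of_pos g k z le_rfl, hD.g_one_eq hr hk hz0, abs_mul, abs_of_pos hz0]
    nlinarith [hD.abs_Dhat_le_one k, hz.2]
  bound m hm hm2 := by
    refine (hc.abs_kernelSeq_le hk hm hm2).trans ?_
    have := (weight_pos ((d : ℝ) / 2) zero_le_one m).le
    gcongr
    linarith [hc.nonneg]
  tail j hj hj1 := by
    have hsplit : 1 - massDefect g N k z - ∑ m ∈ range (j + 1), kernelSeq g k z m =
        (1 - ∑ m ∈ Icc 1 N, g m 0 z) + ∑ m ∈ Ico (j + 1) (N + 1), kernelSeq g k z m := by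
      rw [massDefect, sum_sub_distrib, sum_range_kernelSeq,
        ← sum_range_add_sum_Ico (kernelSeq g k z) (by omega : j + 1 ≤ N + 1)]
      ring
    have hcrit : |1 - ∑ m ∈ Icc 1 N, g m 0 z| ≤ 4 * B * weight ((d : ℝ) / 2 - 1) 1 j := by
      have := hc.nonneg
      refine hc.crit.trans ?_
      gcongr
      exact weight_anti (by linarith [five_halves_le_half hd]) zero_le_one hj
    rw [hsplit]
    linarith [abs_add_le (1 - ∑ m ∈ Icc 1 N, g m 0 z)
      (∑ m ∈ Ico (j + 1) (N + 1), kernelSeq g k z m), hc.abs_sum_Ico_kernelSeq_le hd hk hj1]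

end ControlledKernel

section FunctionBounds

variable {d : ℕ} {f g e : ℕ → Dual d → ℝ → ℝ} {ε C c₁ c₂ η L B z : ℝ} {D : (Fin d → ℤ) → ℝ}
  {N n : ℕ} {k : Dual d}

lemma greenTail_anti {θ x y : ℝ} (hθ : 1 ≤ θ) (hx : 0 < x) (hxy : x ≤ y) (n : ℕ) :
    greenTail θ y n ≤ greenTail θ x n := by
  have hpow : y ^ (1 / 4 - θ) ≤ x ^ (1 / 4 - θ) :=
    Real.rpow_le_rpow_of_nonpos hx hxy (by linarith)
  have hweight := weight_anti_scale (s := θ + 1) (by linarith) hx.le hxy n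
  unfold greenTail
  gcongr

lemma one_le_greenTail_zero (θ : ℝ) (n : ℕ) : 1 ≤ greenTail θ 0 n := by
  have hweight : weight (θ + 1) 0 n = 1 := by simp [weight]
  rw [greenTail, hweight]
  exact le_add_of_nonneg_left (by positivity)

lemma norm_le_of_forall_abs_le {r : ℝ} (hr : 0 ≤ r) (hk : ∀ i, |k i| ≤ r) : ‖k‖ ≤ d * r := by
  rw [EuclideanSpace.norm_eq]
  refine Real.sqrt_le_iff.2 ⟨by positivity, ?_⟩
  calc ∑ i, ‖k i‖ ^ 2 ≤ ∑ _i : Fin d, r ^ 2 :=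
        Finset.sum_le_sum fun i _ => pow_le_pow_left₀ (norm_nonneg _) (hk i) 2
    _ = d * r ^ 2 := by simp
    _ ≤ (d * r) ^ 2 := by
        rw [mul_pow]
        gcongr
        exact_mod_cast Nat.le_self_pow two_ne_zero d

lemma AssumptionD.abs_apply_le_inv (hD : AssumptionD ε C c₁ c₂ η L D f e) (hk : k ∈ cube d)
    (hak : a D k ≤ η) (i : Fin d) : |k i| ≤ L⁻¹ := by
  by_contra! h
  exact (hD.large_k k hk ⟨i, h.le⟩).not_ge hak

lemma AssumptionD.a_zero (hD : AssumptionD ε C c₁ c₂ η L D f e) : a D (0 : Dual d) = 0 := by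
  rw [a, hD.Dhat_zero, sub_self]

lemma Controlled.abs_f_le (hd : 4 < d) (hr : Recursion f g e)
    (hD : AssumptionD ε C c₁ c₂ η L D f e) (hc : Controlled B D g e N z)
    (hB : 12 * B ≤ smallness ((d : ℝ) / 2)) (hN : 1 ≤ N) (hk : k ∈ cube d) (hak : a D k ≤ 1 / 4)
    (hn : n ≤ N) : |f n k z| ≤ renewalConst ((d : ℝ) / 2) := by
  have hθ := five_halves_le_half hd
  have hB1 := hB.trans (smallness_le_one hθ)
  have hB0 := hc.nonneg
  have hz0 : 0 < z := by linarith [(hc.mem_Icc hB1).1]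
  simpa only [PowerSeries.coeff_mk] using
    (hc.renewalKernel hd hr hD hB1 hN hk hak).abs_coeff_le hθ (by positivity) (by linarith)
      (hr.powerSeries hz0 hk)
      (fun m hm => by simpa using hc.abs_sourceSeq_le_weight hD hB1 hk hm) n hn

/-- The bound for the difference `|f_n(k) - f_n(0)|` in units of `a(k) n`. -/
def incrementConst (θ : ℝ) : ℝ :=
  renewalConst θ * (1 + 3 * renewalConst θ) * (2 * 2 ^ (θ - 1))

lemma incrementConst_nonneg {θ : ℝ} (hθ : 5 / 2 ≤ θ) : 0 ≤ incrementConst θ := by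
  have := one_le_renewalConst hθ
  unfold incrementConst; positivity

lemma Controlled.abs_f_sub_le (hd : 4 < d) (hr : Recursion f g e)
    (hD : AssumptionD ε C c₁ c₂ η L D f e) (hc : Controlled B D g e N z)
    (hB : 12 * B ≤ smallness ((d : ℝ) / 2)) (hN : 1 ≤ N) (hk : k ∈ cube d) (hak : a D k ≤ 1 / 4)
    (hn : n ≤ N) : |f n k z - f n 0 z| ≤ incrementConst ((d : ℝ) / 2) * n * a D k := by
  have hθ := five_halves_le_half hd
  have hB1 := hB.trans (smallness_le_one hθ)
  have hB0 := hc.nonneg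
  have hz0 : 0 < z := by linarith [(hc.mem_Icc hB1).1]
  have hker0 := hc.renewalKernel hd hr hD hB1 hN zero_mem_cube (by rw [hD.a_zero]; norm_num)
  have hinv := hker0.abs_coeff_le hθ (by positivity) (by linarith)
    (one_sub_mk_mul_inv hker0.zero) fun m _ => by
      rw [PowerSeries.coeff_one]
      split_ifs with h
      · simp [h, weight]
      · simpa using (weight_pos _ zero_le_one m).le
  have hsub := abs_coeff_sub_le (s := (d : ℝ) / 2 - 1) (by linarith) (kernelSeq_zero g k z)
    (kernelSeq_zero g 0 z) (hr.powerSeries hz0 hk) (hr.powerSeries hz0 zero_mem_cube) hinv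
    (fun m hm => by simpa using hc.abs_f_le hd hr hD hB hN hk hak hm)
    (fun m hm => hc.abs_kernelSeq_sub_le hd hr hD hB1 hk hm)
    (by simp [sourceSeq])
    (fun m hm => by simpa using hc.abs_sourceSeq_sub_le hd hD hB1 hk hm) n hn
  simp only [PowerSeries.coeff_mk] at hsub
  refine hsub.trans_eq ?_
  rw [incrementConst]
  ring

/-- The Green function at `k` is compared with `greenTail` at `(greenScale * L * ‖k‖) ^ 2`. -/
def greenScale (d : ℕ) (c₁ : ℝ) : ℝ := √(rate ((d : ℝ) / 2) * (c₁ / 2))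

lemma greenScale_pos (hd : 4 < d) (hc₁ : 0 < c₁) : 0 < greenScale d c₁ :=
  Real.sqrt_pos.2 (mul_pos (rate_pos (five_halves_le_half hd)) (half_pos hc₁))

lemma Controlled.greenScale_le_rate_mul_massDefect (hd : 4 < d) (hc₁ : 0 < c₁)
    (hr : Recursion f g e) (hD : AssumptionD ε C c₁ c₂ η L D f e) (hc : Controlled B D g e N z)
    (hB : 12 * B ≤ 1) (hN : 1 ≤ N) (hk : k ∈ cube d) (hakη : a D k ≤ η) :
    (greenScale d c₁ * L) ^ 2 * ‖k‖ ^ 2 ≤ rate ((d : ℝ) / 2) * massDefect g N k z := by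
  have hrate := rate_pos (five_halves_le_half hd)
  have hsmall := (hD.small_k k hk (hD.abs_apply_le_inv hk hakη)).1
  calc (greenScale d c₁ * L) ^ 2 * ‖k‖ ^ 2
      = rate ((d : ℝ) / 2) * (c₁ * L ^ 2 * ‖k‖ ^ 2 / 2) := by
        rw [greenScale, mul_pow, Real.sq_sqrt (by positivity)]; ring
    _ ≤ _ := by
        gcongr
        linarith [(hc.massDefect_mem_Icc hd hr hD hB hN hk).1]

lemma Controlled.abs_f_le_greenTail (hd : 4 < d) (hc₁ : 0 < c₁) (hL : 0 < L)
    (hr : Recursion f g e) (hD : AssumptionD ε C c₁ c₂ η L D f e) (hc : Controlled B D g e N z)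
    (hB : 12 * B ≤ smallness ((d : ℝ) / 2)) (hN : 1 ≤ N) (hk : k ∈ cube d)
    (hak : a D k ≤ 1 / 4) (hakη : a D k ≤ η) (hn : n ≤ N) (hn1 : 1 ≤ n) :
    |f n k z| ≤ renewalConst ((d : ℝ) / 2) *
      greenTail ((d : ℝ) / 2) ((greenScale d c₁ * L) ^ 2 * ‖k‖ ^ 2) n := by
  have hθ := five_halves_le_half hd
  have hA := one_le_renewalConst hθ
  have hB1 := hB.trans (smallness_le_one hθ)
  have hB0 := hc.nonneg
  rcases eq_or_ne k 0 with rfl | hk0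
  · rw [norm_zero, zero_pow two_ne_zero, mul_zero]
    exact (hc.abs_f_le hd hr hD hB hN hk hak hn).trans
      (le_mul_of_one_le_right (by linarith) (one_le_greenTail_zero _ n))
  · have hz0 : 0 < z := by linarith [(hc.mem_Icc hB1).1]
    have hscale := hc.greenScale_le_rate_mul_massDefect hd hc₁ hr hD hB1 hN hk hakη
    have hpos : 0 < (greenScale d c₁ * L) ^ 2 * ‖k‖ ^ 2 := by
      have := greenScale_pos hd hc₁
      positivity
    have hκ : 0 < massDefect g N k z :=
      pos_of_mul_pos_right (hpos.trans_le hscale) (rate_pos hθ).le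
    have hrenewal := (hc.renewalKernel hd hr hD hB1 hN hk hak).abs_coeff_le_greenTail hθ hκ
      (by positivity) (by linarith) (hr.powerSeries hz0 hk)
      (fun m hm => by simpa using hc.abs_sourceSeq_le_weight hD hB1 hk hm) hn hn1
    rw [PowerSeries.coeff_mk] at hrenewal
    exact hrenewal.trans (mul_le_mul_of_nonneg_left
      (greenTail_anti (by linarith) hpos hscale n) (by linarith))

lemma Controlled.abs_f_le_rpow {δ : ℝ} (hd : 4 < d) (hr : Recursion f g e)
    (hD : AssumptionD ε C c₁ c₂ η L D f e) (hc : Controlled B D g e N z) (hδ : 0 < δ)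
    (hδ4 : δ ≤ 1 / 4) (hδη : δ ≤ η) (hB : 12 * B ≤ 1)
    (hBδ : 4 * B * convConst ((d : ℝ) / 2) ≤ δ / 2) (hk : k ∈ cube d) (hak : δ < a D k)
    (hn : n ≤ N) (hn1 : 1 ≤ n) :
    |f n k z| ≤ (δ / 2 / (4 * ((d : ℝ) / 2))) ^ (-((d : ℝ) / 2)) * (n : ℝ) ^ (-((d : ℝ) / 2)) := by
  have hθ := five_halves_le_half hd
  have hB0 := hc.nonneg
  have hz0 : 0 < z := by linarith [(hc.mem_Icc hB).1]
  have hstep : |kernelSeq g k z 1| ≤ 1 - δ / 2 := by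
    have hDhat : |Dhat D k| ≤ 1 - δ := by
      have hak2 := hD.away_two k hk
      unfold a at hak hak2
      rw [abs_le]; constructor <;> linarith
    have hz : z ≤ 1 + δ / 2 := by
      have := one_le_convConst (s := (d : ℝ) / 2) (by linarith)
      nlinarith [abs_le.1 hc.near_one]
    rw [kernelSeq_of_pos g k z le_rfl, hD.g_one_eq hr hk hz0, abs_mul, abs_of_pos hz0]
    calc z * |Dhat D k| ≤ (1 + δ / 2) * (1 - δ) := by gcongr
      _ ≤ 1 - δ / 2 := by nlinarith
  simpa only [PowerSeries.coeff_mk] using abs_coeff_le_rpow_of_contraction (by linarith)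
    (half_pos hδ) (by linarith) hB0 hBδ (hr.powerSeries hz0 hk) (kernelSeq_zero g k z) hstep
    (fun m hm hm2 => hc.abs_kernelSeq_le hk hm hm2) (by simp [sourceSeq])
    (fun m hm hm1 => by simpa using hc.abs_sourceSeq_le hD hB hk hm hm1) hn hn1

lemma lintegral_enorm_Dhat_sq_mul_le (hD : ∀ x, 0 ≤ D x) (hs : HasSum D 1) {h φ : Dual d → ℝ}
    {S : Set (Dual d)} {M : ℝ} (hS : MeasurableSet S)
    (hh : ∀ k ∈ cube d, |h k| ≤ M ∨ k ∈ S ∧ |h k| ≤ φ k) :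
    ∫⁻ k in cube d, ‖Dhat D k ^ 2 * h k‖ₑ ≤
      ENNReal.ofReal M * (∫⁻ k in cube d, ‖Dhat D k ^ 2‖ₑ) +
        ∫⁻ k in S, ENNReal.ofReal (φ k) := by
  have hmeas : Measurable fun k => ‖Dhat D k ^ 2‖ₑ :=
    ((continuous_Dhat hD hs.summable).measurable.pow_const 2).enorm
  have hpoint : ∀ k ∈ cube d, ‖Dhat D k ^ 2 * h k‖ₑ ≤
      ENNReal.ofReal M * ‖Dhat D k ^ 2‖ₑ + S.indicator (fun k => ENNReal.ofReal (φ k)) k := by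
    intro k hk
    rcases hh k hk with hM | ⟨hkS, hφ⟩
    · refine le_add_right ?_
      rw [enorm_mul, mul_comm]
      gcongr
      rw [Real.enorm_eq_ofReal_abs]
      exact ENNReal.ofReal_le_ofReal hM
    · refine le_add_left ?_
      rw [Set.indicator_of_mem hkS, Real.enorm_eq_ofReal_abs, abs_mul, abs_pow]
      exact ENNReal.ofReal_le_ofReal ((mul_le_of_le_one_left (abs_nonneg _)
        (pow_le_one₀ (abs_nonneg _) (abs_Dhat_le_one hD hs k))).trans hφ)
  calc ∫⁻ k in cube d, ‖Dhat D k ^ 2 * h k‖ₑ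
      ≤ ∫⁻ k in cube d, (ENNReal.ofReal M * ‖Dhat D k ^ 2‖ₑ +
          S.indicator (fun k => ENNReal.ofReal (φ k)) k) :=
        setLIntegral_mono' (measurableSet_cube d) hpoint
    _ = ENNReal.ofReal M * (∫⁻ k in cube d, ‖Dhat D k ^ 2‖ₑ) +
          ∫⁻ k in cube d, S.indicator (fun k => ENNReal.ofReal (φ k)) k := by
        rw [lintegral_add_left (hmeas.const_mul _), lintegral_const_mul _ hmeas]
    _ ≤ _ := add_le_add_right
        ((setLIntegral_le_lintegral _ _).trans_eq (lintegral_indicator hS _)) _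

lemma Controlled.abs_f_le_or {δ : ℝ} (hd : 4 < d) (hc₁ : 0 < c₁) (hL : 0 < L)
    (hr : Recursion f g e) (hD : AssumptionD ε C c₁ c₂ η L D f e) (hc : Controlled B D g e N z)
    (hδ : 0 < δ) (hδ4 : δ ≤ 1 / 4) (hδη : δ ≤ η) (hB : 12 * B ≤ smallness ((d : ℝ) / 2))
    (hBδ : 4 * B * convConst ((d : ℝ) / 2) ≤ δ / 2) (hk : k ∈ cube d) (hn : n ≤ N)
    (hn1 : 1 ≤ n) :
    |f n k z| ≤ (δ / 2 / (4 * ((d : ℝ) / 2))) ^ (-((d : ℝ) / 2)) * (n : ℝ) ^ (-((d : ℝ) / 2)) ∨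
      k ∈ Metric.ball 0 (greenScale d c₁ * (d + 1) / (greenScale d c₁ * L)) ∧
        |f n k z| ≤ renewalConst ((d : ℝ) / 2) *
          greenTail ((d : ℝ) / 2) ((greenScale d c₁ * L) ^ 2 * ‖k‖ ^ 2) n := by
  rcases lt_or_ge δ (a D k) with hak | hak
  · have hB1 := hB.trans (smallness_le_one (five_halves_le_half hd))
    exact .inl (hc.abs_f_le_rpow hd hr hD hδ hδ4 hδη hB1 hBδ hk hak hn hn1)
  · refine .inr ⟨?_, hc.abs_f_le_greenTail hd hc₁ hL hr hD hB (hn1.trans hn) hk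
      (hak.trans hδ4) (hak.trans hδη) hn hn1⟩
    rw [mem_ball_zero_iff, mul_div_mul_left _ _ (greenScale_pos hd hc₁).ne', div_eq_mul_inv]
    refine (norm_le_of_forall_abs_le (by positivity)
      (hD.abs_apply_le_inv hk (hak.trans hδη))).trans_lt ?_
    gcongr
    linarith

lemma exists_normOne_le (hd : 4 < d) (C : ℝ) (hc₁ : 0 < c₁) {δ : ℝ} (hδ : 0 < δ)
    (hδ4 : δ ≤ 1 / 4) (hδη : δ ≤ η) :
    ∃ M : ℝ, 0 ≤ M ∧ ∀ {ε c₂ L B z : ℝ} {D : (Fin d → ℤ) → ℝ} {f g e : ℕ → Dual d → ℝ → ℝ}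
      {N n : ℕ}, 0 < L → Recursion f g e → AssumptionD ε C c₁ c₂ η L D f e →
      Controlled B D g e N z → 12 * B ≤ smallness ((d : ℝ) / 2) →
      4 * B * convConst ((d : ℝ) / 2) ≤ δ / 2 → n ≤ N → 1 ≤ n →
      normOne (fun k => Dhat D k ^ 2 * f n k z) ≤
        ENNReal.ofReal (M * (beta d L * (n : ℝ) ^ (-((d : ℝ) / 2)))) := by
  set s := greenScale d c₁
  have hs : 0 < s := greenScale_pos hd hc₁
  obtain ⟨J, hJ0, hJ⟩ := exists_setLIntegral_greenTail_le (d := d) (by omega) (s * (d + 1))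
  set A := renewalConst ((d : ℝ) / 2)
  have hA : 0 ≤ A := zero_le_one.trans (one_le_renewalConst (five_halves_le_half hd))
  set A' := (δ / 2 / (4 * ((d : ℝ) / 2))) ^ (-((d : ℝ) / 2))
  have : 0 ≤ A' := by positivity
  set P := (2 * Real.pi) ^ d
  have hP : 0 < P := by positivity
  have hβs := (beta_pos d hs).le
  refine ⟨A' * |C| + P⁻¹ * (A * (J * beta d s)), by positivity, ?_⟩
  intro ε c₂ L B z D f g e N n hL hr hD hc hB hBδ hn hn1
  have hβ := (beta_pos d hL).le
  set ν := (n : ℝ) ^ (-((d : ℝ) / 2))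
  have : 0 ≤ ν := by positivity
  have hsup : ∀ x, D x ≤ |C| * beta d L := fun x =>
    (hD.sup_le x).trans (mul_le_mul_of_nonneg_right (le_abs_self C) hβ)
  have hint : ∫⁻ k in cube d, ‖Dhat D k ^ 2 * f n k z‖ₑ ≤
      ENNReal.ofReal (A' * ν * (P * (|C| * beta d L)) + A * (J * beta d (s * L) * ν)) := by
    rw [ENNReal.ofReal_add (by positivity) (by have := beta_pos d (mul_pos hs hL); positivity),
      ENNReal.ofReal_mul (p := A' * ν) (by positivity), ENNReal.ofReal_mul (p := A) hA]
    refine (lintegral_enorm_Dhat_sq_mul_le hD.nonneg hD.normalised measurableSet_ball fun k hk =>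
      hc.abs_f_le_or hd hc₁ hL hr hD hδ hδ4 hδη hB hBδ hk hn hn1).trans (add_le_add ?_ ?_)
    · gcongr
      exact lintegral_Dhat_sq_le hD.nonneg hD.normalised hsup fun k hk => hD.fourier_eq_Dhat hk
    · simp only [A, ENNReal.ofReal_mul (p := renewalConst ((d : ℝ) / 2)) hA]
      rw [lintegral_const_mul' _ _ ENNReal.ofReal_ne_top]
      gcongr
      exact hJ (s * L) (mul_pos hs hL) n hn1
  calc normOne (fun k => Dhat D k ^ 2 * f n k z)
      ≤ ENNReal.ofReal P⁻¹ *
        ENNReal.ofReal (A' * ν * (P * (|C| * beta d L)) + A * (J * beta d (s * L) * ν)) := by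
        unfold normOne
        gcongr
    _ = _ := by
        rw [← ENNReal.ofReal_mul (inv_nonneg.2 hP.le), beta_mul]
        congr 1
        field_simp

lemma Controlled.abs_lapZero_f_le (hd : 4 < d) (hr : Recursion f g e)
    (hS : AssumptionS f g e) (hD : AssumptionD ε C c₁ c₂ η L D f e)
    (hc : Controlled B D g e N z) (hB : 12 * B ≤ smallness ((d : ℝ) / 2)) (hN : 1 ≤ N)
    (hn : n ≤ N) :
    |lapZero (fun k => f n k z)| ≤ incrementConst ((d : ℝ) / 2) * n * sigmaSq D := by
  have hB1 := hB.trans (smallness_le_one (five_halves_le_half hd))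
  have hz0 : 0 < z := by linarith [(hc.mem_Icc hB1).1]
  have hcont : Continuous (a D) :=
    continuous_const.sub (continuous_Dhat hD.nonneg hD.normalised.summable)
  have hev : ∀ᶠ k in 𝓝 (0 : Dual d), a D k < 1 / 4 :=
    hcont.continuousAt.eventually_lt_const (by rw [hD.a_zero]; norm_num)
  refine abs_lapZero_le_mul_sigmaSq (hS.smooth_f n z hz0) (hD.contDiffAt_Dhat hS) hD.Dhat_zero ?_
  filter_upwards [hev, cube_mem_nhds d] with k hak hk
  exact hc.abs_f_sub_le hd hr hD hB hN hk hak.le hn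

lemma exists_fBounds (hd : 4 < d) (C : ℝ) (hc₁ : 0 < c₁) (hη : 0 < η) :
    ∃ K b : ℝ, 1 < K ∧ 0 < b ∧ b ≤ 1 / 12 ∧ ∀ {ε c₂ L B z : ℝ} {D : (Fin d → ℤ) → ℝ}
      {f g e : ℕ → Dual d → ℝ → ℝ} {N : ℕ}, 0 < L → Recursion f g e → AssumptionS f g e →
      AssumptionD ε C c₁ c₂ η L D f e → Controlled B D g e N z → B ≤ b →
      ∀ n ≤ N, 1 ≤ n → FBounds L D f K n z := by
  have hθ := five_halves_le_half hd
  have hA := one_le_renewalConst hθ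
  have hA' := incrementConst_nonneg hθ
  have hconv := one_le_convConst (s := (d : ℝ) / 2) (by linarith)
  obtain ⟨δ, hδ, hδ'⟩ : ∃ δ, 0 < δ ∧ δ ≤ min (1 / 4) η := ⟨_, lt_min (by norm_num) hη, le_rfl⟩
  obtain ⟨hδ4, hδη⟩ := le_min_iff.1 hδ'
  obtain ⟨M, hM0, hM⟩ := exists_normOne_le hd C hc₁ hδ hδ4 hδη
  set K := 1 + renewalConst ((d : ℝ) / 2) + incrementConst ((d : ℝ) / 2) + M
  set b := min (smallness ((d : ℝ) / 2) / 12) (δ / (8 * convConst ((d : ℝ) / 2)))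
  have hb12 : 12 * b ≤ smallness ((d : ℝ) / 2) := by
    linarith [min_le_left (smallness ((d : ℝ) / 2) / 12) (δ / (8 * convConst ((d : ℝ) / 2)))]
  have hbδ : b * (8 * convConst ((d : ℝ) / 2)) ≤ δ :=
    (le_div_iff₀ (by positivity)).1 (min_le_right _ _)
  have hb0 : 0 < b := lt_min (div_pos (smallness_pos hθ) (by norm_num)) (by positivity)
  refine ⟨K, b, by linarith, hb0, by linarith [smallness_le_one hθ], ?_⟩
  intro ε c₂ L B z D f g e N hL hr hS hD hc hB n hn hn1
  have hβ := (beta_pos d hL).le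
  have hB12 : 12 * B ≤ smallness ((d : ℝ) / 2) := by linarith
  have hBδ : 4 * B * convConst ((d : ℝ) / 2) ≤ δ / 2 := by nlinarith
  have hN : 1 ≤ N := hn1.trans hn
  refine ⟨(hM hL hr hD hc hB12 hBδ hn hn1).trans ?_, ?_, ?_⟩
  · rw [neg_div, mul_assoc K]
    gcongr
    linarith
  · refine (hc.abs_f_le hd hr hD hB12 hN zero_mem_cube (by rw [hD.a_zero]; norm_num) hn).trans ?_
    linarith
  · have hσ := hD.sigmaSq_nonneg hS
    refine (hc.abs_lapZero_f_le hd hr hS hD hB12 hN hn).trans ?_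
    rw [mul_right_comm]
    gcongr
    linarith

end FunctionBounds

section CoefficientBounds

variable {d : ℕ} {f g e : ℕ → Dual d → ℝ → ℝ} {ε C c₁ c₂ η L B Γ : ℝ} {D : (Fin d → ℤ) → ℝ}
  {m : ℕ} {z : ℝ}

lemma EBounds.mono {c : ℝ} (h : EBounds L D e c m z) (hcΓ : c ≤ Γ) (hL : 0 < L)
    (ha : ∀ k, 0 ≤ a D k) : EBounds L D e Γ m z where
  sup k hk := by
    have hβ := beta_pos d hL
    exact (h.sup k hk).trans (by gcongr)
  diff k hk := by
    have hβ := beta_pos d hL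
    have hak := ha k
    exact (h.diff k hk).trans (by gcongr)

lemma GBounds.mono {c : ℝ} (h : GBounds ε L D g c m z) (hcΓ : c ≤ Γ) (hL : 0 < L)
    (ha : ∀ k, 0 ≤ a D k) (hσ : 0 ≤ sigmaSq D) : GBounds ε L D g Γ m z where
  sup k hk := by
    have hβ := beta_pos d hL
    exact (h.sup k hk).trans (by gcongr)
  lap := by
    have hβ := beta_pos d hL
    exact h.lap.trans (by gcongr)
  differentiable := h.differentiable
  deriv_le := by
    have hβ := beta_pos d hL
    exact h.deriv_le.trans (by gcongr)
  taylor ε' hε' k hk := by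
    have hβ := beta_pos d hL
    have hak := ha k
    exact (h.taylor ε' hε' k hk).trans (by gcongr)

lemma GBounds.abs_sub_zero_le (h : GBounds ε L D g Γ m z) (hΓ : 0 ≤ Γ) (hε : 0 ≤ ε) (hL : 0 < L)
    (ha : ∀ k, 0 ≤ a D k) (hσ : 0 ≤ sigmaSq D) {k : Dual d} (hk : k ∈ cube d) :
    |g m k z - g m 0 z| ≤ 2 * (Γ * beta d L) * a D k * (m : ℝ) ^ (-((d : ℝ) - 2) / 2) := by
  have hβ := beta_pos d hL
  have htaylor := h.taylor 0 ⟨le_rfl, hε⟩ k hk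
  rw [mul_zero, sub_zero, add_zero, Real.rpow_one] at htaylor
  set p := (m : ℝ) ^ (-((d : ℝ) - 2) / 2)
  set q := a D k * (sigmaSq D)⁻¹ * lapZero (fun k => g m k z)
  have : 0 ≤ p := by positivity
  have hlap : (sigmaSq D)⁻¹ * |lapZero (fun k => g m k z)| ≤ Γ * beta d L * p := by
    rcases hσ.eq_or_lt with h0 | h0
    · rw [← h0, inv_zero, zero_mul]
      positivity
    · rw [inv_mul_le_iff₀ h0]
      linarith [h.lap]
  have hq : |q| ≤ a D k * (Γ * beta d L * p) := by
    rw [abs_mul, abs_mul, abs_of_nonneg (ha k), abs_of_nonneg (inv_nonneg.2 hσ), mul_assoc]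
    exact mul_le_mul_of_nonneg_left hlap (ha k)
  calc |g m k z - g m 0 z| = |(g m k z - g m 0 z - q) + q| := by rw [sub_add_cancel]
    _ ≤ Γ * beta d L * a D k * p + a D k * (Γ * beta d L * p) :=
        (abs_add_le _ _).trans (add_le_add htaylor hq)
    _ = 2 * (Γ * beta d L) * a D k * p := by ring

/-- The constant of `CoeffBounds` derived from `EBounds` and `GBounds` with constant `Γ`: the
factor `2 ^ (d/2)` is the cost of passing from powers of `m` to weights. -/
def coeffConst (d : ℕ) (Γ L : ℝ) : ℝ := 2 * 2 ^ ((d : ℝ) / 2) * Γ * beta d L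

lemma coeffConst_pos (d : ℕ) (hΓ : 0 < Γ) (hL : 0 < L) : 0 < coeffConst d Γ L := by
  have := beta_pos d hL
  unfold coeffConst
  positivity

lemma eventually_coeffConst_le (hd : d ≠ 0) (Γ : ℝ) {y : ℝ} (hy : 0 < y) :
    ∀ᶠ L in atTop, coeffConst d Γ L ≤ y := by
  have hβ : Tendsto (beta d) atTop (𝓝 0) := (tendsto_pow_atTop hd).inv_tendsto_atTop
  have hlim : Tendsto (fun L => coeffConst d Γ L) atTop (𝓝 0) := by
    simpa only [coeffConst, mul_zero] using hβ.const_mul (2 * 2 ^ ((d : ℝ) / 2) * Γ)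
  exact hlim.eventually_le_const hy

lemma two_mul_mul_rpow_le_coeffConst_mul_weight (hΓ : 0 ≤ Γ) (hL : 0 < L) {s : ℝ} (hs : 0 ≤ s)
    (hsd : s ≤ (d : ℝ) / 2) (hm : 1 ≤ m) :
    2 * (Γ * beta d L) * (m : ℝ) ^ (-s) ≤ coeffConst d Γ L * weight s 1 m := by
  have hβ := beta_pos d hL
  have hw := (weight_pos s zero_le_one m).le
  calc 2 * (Γ * beta d L) * (m : ℝ) ^ (-s)
      ≤ 2 * (Γ * beta d L) * (2 ^ ((d : ℝ) / 2) * weight s 1 m) := by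
        gcongr
        refine (rpow_le_weight_one hs hm).trans ?_
        gcongr
        exact one_le_two
    _ = coeffConst d Γ L * weight s 1 m := by unfold coeffConst; ring

lemma CoeffBounds.of_bounds (hd : 4 < d) (hε : 0 ≤ ε) (hL : 0 < L) (hΓ : 0 ≤ Γ)
    (ha : ∀ k, 0 ≤ a D k) (hσ : 0 ≤ sigmaSq D) (hm : 1 ≤ m) (hE : EBounds L D e Γ m z)
    (hG : GBounds ε L D g Γ m z) : CoeffBounds (coeffConst d Γ L) D g e m z := by
  have hθ := five_halves_le_half hd
  have hΓβ : 0 ≤ Γ * beta d L := mul_nonneg hΓ (beta_pos d hL).le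
  have hsup := two_mul_mul_rpow_le_coeffConst_mul_weight (d := d) hΓ hL (by linarith) le_rfl hm
  have hdiff := two_mul_mul_rpow_le_coeffConst_mul_weight (d := d) (s := (d : ℝ) / 2 - 1) hΓ hL
    (by linarith) (by linarith) hm
  rw [← neg_div] at hsup
  rw [show -((d : ℝ) / 2 - 1) = -((d : ℝ) - 2) / 2 by ring] at hdiff
  have hpow : 0 ≤ Γ * beta d L * (m : ℝ) ^ (-(d : ℝ) / 2) := by positivity
  have hpow' : 0 ≤ Γ * beta d L * (m : ℝ) ^ (-((d : ℝ) - 2) / 2) := by positivity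
  refine ⟨fun k hk => ?_, fun k hk => ?_, fun k hk => ?_, fun k hk => ?_, hG.differentiable, ?_⟩
  · linarith [hE.sup k hk]
  · nlinarith [hE.diff k hk, mul_le_mul_of_nonneg_left hdiff (ha k), mul_nonneg hpow' (ha k)]
  · linarith [hG.sup k hk]
  · nlinarith [hG.abs_sub_zero_le hΓ hε hL ha hσ hk, mul_le_mul_of_nonneg_left hdiff (ha k)]
  · linarith [hG.deriv_le]

lemma UniformEG.coeffBounds {Ce Cg L₁ : ℝ → ℝ} {K zc : ℝ}
    (h : UniformEG ε Ce Cg L₁ L D f g e zc) (hd : 4 < d) (hε : 0 ≤ ε) (hS : AssumptionS f g e)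
    (hD : AssumptionD ε C c₁ c₂ η L D f e) (hK : 1 < K) (hLK : L₁ K ≤ L) (hL : 0 < L)
    (hΓ : 0 ≤ Γ) (hCe : Ce K ≤ Γ) (hCg : Cg K ≤ Γ) (hF : ∀ n, 1 ≤ n → FBounds L D f K n zc) :
    ∀ z ∈ Set.Ioc 0 zc, ∀ m, 2 ≤ m → CoeffBounds (coeffConst d Γ L) D g e m z := by
  intro z hz m hm
  have ha := hD.a_nonneg
  have hσ := hD.sigmaSq_nonneg hS
  obtain ⟨hE, hG⟩ := h K hK hLK hF z hz m hm
  exact .of_bounds hd hε hL hΓ ha hσ (by omega) (hE.mono hCe hL ha) (hG.mono hCg hL ha hσ)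

lemma CoeffBounds.abs_g_zero_sub_le {I : Set ℝ} (hI : I.OrdConnected)
    (h : ∀ z ∈ I, CoeffBounds B D g e m z) {w : ℝ} (hw : w ∈ I) (hz : z ∈ I) :
    |g m 0 w - g m 0 z| ≤ B * weight ((d : ℝ) / 2 - 1) 1 m * |w - z| :=
  hI.convex.norm_image_sub_le_of_norm_deriv_le (f := fun w => g m 0 w)
    (fun x hx => (h x hx).differentiable) (fun x hx => (h x hx).deriv_le) hz hw

open Finset

lemma sum_Icc_two_weight_le {s : ℝ} (hs : 3 / 2 ≤ s) (N : ℕ) :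
    ∑ m ∈ Icc 2 N, weight s 1 m ≤ 3 :=
  calc ∑ m ∈ Icc 2 N, weight s 1 m ≤ ∑ m ∈ range (N + 1), weight s 1 m :=
        sum_le_sum_of_subset_of_nonneg (fun m hm => mem_range_succ_iff.2 (mem_Icc.1 hm).2)
          fun m _ _ => (weight_pos s zero_le_one m).le
    _ ≤ 3 := by simpa using sum_range_weight_le_three_div hs one_pos le_rfl (N + 1)

lemma abs_sum_g_zero_sub_le (hd : 4 < d) (hB : 0 ≤ B) {N : ℕ} {I : Set ℝ} (hI : I.OrdConnected)
    (h : ∀ z ∈ I, ∀ m ≤ N, 2 ≤ m → CoeffBounds B D g e m z) {w : ℝ} (hw : w ∈ I) (hz : z ∈ I) :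
    |∑ m ∈ Icc 2 N, g m 0 w - ∑ m ∈ Icc 2 N, g m 0 z| ≤ 3 * B * |w - z| := by
  rw [← sum_sub_distrib]
  calc |∑ m ∈ Icc 2 N, (g m 0 w - g m 0 z)|
      ≤ ∑ m ∈ Icc 2 N, B * weight ((d : ℝ) / 2 - 1) 1 m * |w - z| := by
        refine (abs_sum_le_sum_abs _ _).trans (sum_le_sum fun m hm => ?_)
        obtain ⟨hm2, hmN⟩ := mem_Icc.1 hm
        exact CoeffBounds.abs_g_zero_sub_le hI (fun z hz => h z hz m hmN hm2) hw hz
    _ = B * (∑ m ∈ Icc 2 N, weight ((d : ℝ) / 2 - 1) 1 m) * |w - z| := by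
        rw [← sum_mul, ← mul_sum]
    _ ≤ B * 3 * |w - z| := by
        gcongr
        exact sum_Icc_two_weight_le (by linarith [five_halves_le_half hd]) N
    _ = 3 * B * |w - z| := by ring

lemma AssumptionD.sum_Icc_one_g_zero (hD : AssumptionD ε C c₁ c₂ η L D f e)
    (hr : Recursion f g e) (hz : 0 < z) {N : ℕ} (hN : 1 ≤ N) :
    ∑ m ∈ Icc 1 N, g m 0 z = z + ∑ m ∈ Icc 2 N, g m 0 z := by
  rw [← sum_Ioc_add_eq_sum_Icc hN, add_comm, hD.g_one_zero_eq hr hz]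
  rfl

end CoefficientBounds

section CriticalValue

open Finset

variable {d : ℕ} {f g e : ℕ → Dual d → ℝ → ℝ} {ε α C c₁ c₂ η L B K Γ z : ℝ}
  {Ce Cg L₁ : ℝ → ℝ} {D : (Fin d → ℤ) → ℝ} {n : ℕ}

/-- The interval around `z_n` on which the induction hypothesis at `n` is asserted. Its radius is
chosen so that the intervals are nested and shrink to the critical value. -/
def zInterval (g : ℕ → Dual d → ℝ → ℝ) (B : ℝ) (n : ℕ) : Set ℝ :=
  Metric.closedBall (zSeq g n) (2 * B * weight ((d : ℝ) / 2 - 1) 1 n)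

/-- The inductive step for the coefficients: on intervals where the first `n` of them are
controlled, the bounds extend to index `n + 1`. -/
def CoeffBootstrap (B : ℝ) (D : (Fin d → ℤ) → ℝ) (g e : ℕ → Dual d → ℝ → ℝ) : Prop :=
  ∀ n : ℕ, 1 ≤ n → ∀ I : Set ℝ, I.OrdConnected → I.Nontrivial →
    (∀ z ∈ I, Controlled B D g e n z) →
    ∀ z ∈ I, ∀ m ≤ n + 1, 2 ≤ m → CoeffBounds B D g e m z

lemma coeffBootstrap_of_assumptions (hd : 4 < d) (hε : 0 ≤ ε) (hS : AssumptionS f g e)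
    (hD : AssumptionD ε C c₁ c₂ η L D f e) (hE : AssumptionE α Ce L₁ L D f e)
    (hG : AssumptionG α ε Cg L₁ L D f g) (hK : 1 < K) (hLK : L₁ K ≤ L) (hL : 0 < L)
    (hΓ : 0 ≤ Γ) (hCe : Ce K ≤ Γ) (hCg : Cg K ≤ Γ) (hα : 2 * coeffConst d Γ L ≤ α)
    (hF : ∀ {z : ℝ} {N : ℕ}, Controlled (coeffConst d Γ L) D g e N z →
      ∀ n ≤ N, 1 ≤ n → FBounds L D f K n z) :
    CoeffBootstrap (coeffConst d Γ L) D g e := by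
  intro n _ I hI hI' hctrl z hz m hmn hm
  have ha := hD.a_nonneg
  have hσ := hD.sigmaSq_nonneg hS
  have hIα : I ⊆ Set.Icc (1 - α) (1 + α) := fun w hw => by
    have := abs_le.1 (hctrl w hw).near_one
    constructor <;> linarith
  have hFI : ∀ w ∈ I, ∀ j ∈ Icc 1 n, FBounds L D f K j w := fun w hw j hj =>
    hF (hctrl w hw) j (mem_Icc.1 hj).2 (mem_Icc.1 hj).1
  have hm' : m ∈ Icc 2 (n + 1) := mem_Icc.2 ⟨hm, hmn⟩
  exact .of_bounds hd hε hL hΓ ha hσ (by omega)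
    ((hE K hK hLK n I hI hI' hIα hFI z hz m hm').mono hCe hL ha)
    ((hG K hK hLK n I hI hI' hIα hFI z hz m hm').mono hCg hL ha hσ)

lemma mem_zInterval :
    z ∈ zInterval g B n ↔ |z - zSeq g n| ≤ 2 * B * weight ((d : ℝ) / 2 - 1) 1 n := by
  rw [zInterval, Metric.mem_closedBall, Real.dist_eq]

lemma zSeq_mem_zInterval (g : ℕ → Dual d → ℝ → ℝ) (hB : 0 ≤ B) (n : ℕ) :
    zSeq g n ∈ zInterval g B n :=
  Metric.mem_closedBall_self (mul_nonneg (by positivity) (weight_pos _ zero_le_one n).le)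

lemma ordConnected_zInterval (g : ℕ → Dual d → ℝ → ℝ) (B : ℝ) (n : ℕ) :
    (zInterval g B n).OrdConnected := by
  rw [zInterval, Real.closedBall_eq_Icc]
  exact Set.ordConnected_Icc

lemma nontrivial_zInterval (g : ℕ → Dual d → ℝ → ℝ) (hB : 0 < B) (n : ℕ) :
    (zInterval g B n).Nontrivial := by
  have hr : 0 < 2 * B * weight ((d : ℝ) / 2 - 1) 1 n :=
    mul_pos (by positivity) (weight_pos _ zero_le_one n)
  rw [zInterval, Real.closedBall_eq_Icc]
  exact (Set.Icc_infinite (by linarith)).nontrivial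

lemma zSeq_mem_zInterval_succ (hB : 0 ≤ B)
    (h : |zSeq g (n + 1) - zSeq g n| ≤ 2 * B * weight ((d : ℝ) / 2) 1 (n + 1)) :
    zSeq g n ∈ zInterval g B (n + 1) := by
  rw [mem_zInterval, abs_sub_comm]
  refine h.trans ?_
  gcongr
  exact weight_anti_exponent (by linarith) zero_le_one _

lemma zInterval_succ_subset (hd : 4 < d) (hB : 0 ≤ B)
    (h : |zSeq g (n + 1) - zSeq g n| ≤ 2 * B * weight ((d : ℝ) / 2) 1 (n + 1)) :
    zInterval g B (n + 1) ⊆ zInterval g B n := by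
  have hθ := five_halves_le_half hd
  have hdecay : weight ((d : ℝ) / 2) 1 (n + 1) ≤
      weight ((d : ℝ) / 2 - 1) 1 n - weight ((d : ℝ) / 2 - 1) 1 (n + 1) := by
    have hstep := mul_weight_succ_le_sub (s := (d : ℝ) / 2) (by linarith) zero_le_one n
    nlinarith [weight_pos ((d : ℝ) / 2) zero_le_one (n + 1)]
  refine Metric.closedBall_subset_closedBall' ?_
  rw [Real.dist_eq]
  nlinarith [mul_le_mul_of_nonneg_left hdecay (by positivity : 0 ≤ 2 * B)]

lemma zSeq_one (g : ℕ → Dual d → ℝ → ℝ) : zSeq g 1 = 1 := by simp [zSeq]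

lemma zSeq_add_sum_eq_one (g : ℕ → Dual d → ℝ → ℝ) (n : ℕ) :
    zSeq g (n + 1) + ∑ m ∈ Icc 2 (n + 1), g m 0 (zSeq g n) = 1 := by
  rw [zSeq, sub_add_cancel]

lemma abs_zSeq_succ_sub_le (hd : 4 < d) (hB : 0 ≤ B) (hBd : 6 * 2 ^ ((d : ℝ) / 2) * B ≤ 1)
    (hcoeff : ∀ z ∈ zInterval g B (n + 1), ∀ m ≤ n + 2, 2 ≤ m → CoeffBounds B D g e m z)
    (h : |zSeq g (n + 1) - zSeq g n| ≤ 2 * B * weight ((d : ℝ) / 2) 1 (n + 1)) :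
    |zSeq g (n + 2) - zSeq g (n + 1)| ≤ 2 * B * weight ((d : ℝ) / 2) 1 (n + 2) := by
  have hθ := five_halves_le_half hd
  have hz := zSeq_mem_zInterval_succ hB h
  have hz' := zSeq_mem_zInterval g hB (n + 1)
  have hincrement : zSeq g (n + 2) - zSeq g (n + 1) = -g (n + 2) 0 (zSeq g (n + 1)) -
      (∑ m ∈ Icc 2 (n + 1), g m 0 (zSeq g (n + 1)) - ∑ m ∈ Icc 2 (n + 1), g m 0 (zSeq g n)) := by
    have hsucc := zSeq_add_sum_eq_one g (n + 1)
    rw [sum_Icc_succ_top (by omega)] at hsucc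
    linear_combination hsucc - zSeq_add_sum_eq_one g n
  have hlast : |g (n + 2) 0 (zSeq g (n + 1))| ≤ B * weight ((d : ℝ) / 2) 1 (n + 2) :=
    (hcoeff _ hz' (n + 2) le_rfl (by omega)).g_sup 0 zero_mem_cube
  have hsum := abs_sum_g_zero_sub_le hd hB (ordConnected_zInterval g B (n + 1))
    (fun z hz m hm => hcoeff z hz m (Nat.le_succ_of_le hm)) hz' hz
  have hweight : weight ((d : ℝ) / 2) 1 (n + 1) ≤
      2 ^ ((d : ℝ) / 2) * weight ((d : ℝ) / 2) 1 (n + 2) :=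
    weight_le_two_rpow_mul (by linarith) zero_le_one (by push_cast; linarith)
  have hw := (weight_pos ((d : ℝ) / 2) zero_le_one (n + 2)).le
  have hsum' : 3 * B * |zSeq g (n + 1) - zSeq g n| ≤ B * weight ((d : ℝ) / 2) 1 (n + 2) :=
    calc 3 * B * |zSeq g (n + 1) - zSeq g n|
        ≤ 3 * B * (2 * B * (2 ^ ((d : ℝ) / 2) * weight ((d : ℝ) / 2) 1 (n + 2))) := by
          gcongr
          exact h.trans (by gcongr)
      _ = 6 * 2 ^ ((d : ℝ) / 2) * B * (B * weight ((d : ℝ) / 2) 1 (n + 2)) := by ring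
      _ ≤ B * weight ((d : ℝ) / 2) 1 (n + 2) := mul_le_of_le_one_left (by positivity) hBd
  rw [hincrement]
  refine (abs_sub _ _).trans ?_
  rw [abs_neg]
  linarith

lemma controlled_one (hd : 4 < d) (hr : Recursion f g e) (hD : AssumptionD ε C c₁ c₂ η L D f e)
    (hB : 0 ≤ B) (hB1 : 6 * B ≤ 1) (hz : z ∈ zInterval g B 1) : Controlled B D g e 1 z := by
  rw [mem_zInterval, zSeq_one] at hz
  have hradius : 0 ≤ 2 * B * weight ((d : ℝ) / 2 - 1) 1 1 :=
    mul_nonneg (by positivity) (weight_pos _ zero_le_one 1).le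
  have hnear : |z - 1| ≤ 2 * B := hz.trans <| mul_le_of_le_one_right (by positivity) <|
    weight_le_one (by linarith [five_halves_le_half hd]) zero_le_one 1
  have hz0 : 0 < z := by linarith [(abs_le.1 hnear).1]
  refine ⟨hnear, fun m hm hm2 => by omega, ?_⟩
  rw [Icc_self, sum_singleton, hD.g_one_zero_eq hr hz0, abs_sub_comm]
  linarith

lemma controlled_succ (hd : 4 < d) (hr : Recursion f g e)
    (hD : AssumptionD ε C c₁ c₂ η L D f e) (hB1 : 6 * B ≤ 1)
    (hctrl : ∀ z ∈ zInterval g B n, Controlled B D g e n z)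
    (hcoeff : ∀ z ∈ zInterval g B n, ∀ m ≤ n + 1, 2 ≤ m → CoeffBounds B D g e m z)
    (h : |zSeq g (n + 1) - zSeq g n| ≤ 2 * B * weight ((d : ℝ) / 2) 1 (n + 1))
    (hz : z ∈ zInterval g B (n + 1)) : Controlled B D g e (n + 1) z := by
  have hB : 0 ≤ B := by
    have hw := weight_pos ((d : ℝ) / 2) zero_le_one (n + 1)
    nlinarith [abs_nonneg (zSeq g (n + 1) - zSeq g n)]
  have hzn := zInterval_succ_subset hd hB h hz
  have hnear := (hctrl z hzn).near_one
  have hz0 : 0 < z := by linarith [(abs_le.1 hnear).1]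
  refine ⟨hnear, hcoeff z hzn, ?_⟩
  have hsum := abs_sum_g_zero_sub_le hd hB (ordConnected_zInterval g B n) hcoeff
    (zSeq_mem_zInterval g hB n) hzn
  have hdist := mem_zInterval.1 hz
  have hdist' := mem_zInterval.1 (zSeq_mem_zInterval_succ hB h)
  have htriangle : |zSeq g n - z| ≤ 4 * B * weight ((d : ℝ) / 2 - 1) 1 (n + 1) := by
    have := abs_sub_le (zSeq g n) (zSeq g (n + 1)) z
    rw [abs_sub_comm (zSeq g (n + 1)) z] at this
    linarith
  have hmass : 1 - ∑ m ∈ Icc 1 (n + 1), g m 0 z = -(z - zSeq g (n + 1)) +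
      (∑ m ∈ Icc 2 (n + 1), g m 0 (zSeq g n) - ∑ m ∈ Icc 2 (n + 1), g m 0 z) := by
    rw [hD.sum_Icc_one_g_zero hr hz0 (by omega)]
    linear_combination -zSeq_add_sum_eq_one g n
  rw [hmass]
  refine (abs_add_le _ _).trans ?_
  rw [abs_neg]
  nlinarith [abs_nonneg (zSeq g n - z)]

lemma CoeffBootstrap.induction (hboot : CoeffBootstrap B D g e) (hd : 4 < d)
    (hr : Recursion f g e) (hD : AssumptionD ε C c₁ c₂ η L D f e) (hB : 0 < B)
    (hBd : 6 * 2 ^ ((d : ℝ) / 2) * B ≤ 1) (n : ℕ) :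
    |zSeq g (n + 1) - zSeq g n| ≤ 2 * B * weight ((d : ℝ) / 2) 1 (n + 1) ∧
      ∀ z ∈ zInterval g B (n + 1), Controlled B D g e (n + 1) z := by
  have hpow : 1 ≤ (2 : ℝ) ^ ((d : ℝ) / 2) := Real.one_le_rpow one_le_two (by positivity)
  have hB1 : 6 * B ≤ 1 := by nlinarith
  induction n with
  | zero =>
    refine ⟨?_, fun z hz => controlled_one hd hr hD hB.le hB1 hz⟩
    rw [zSeq_one, zSeq, sub_self, abs_zero]
    exact mul_nonneg (by positivity) (weight_pos _ zero_le_one _).le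
  | succ n ih =>
    obtain ⟨hincrement, hctrl⟩ := ih
    have hcoeff := hboot (n + 1) (by omega) _ (ordConnected_zInterval g B _)
      (nontrivial_zInterval g hB _) hctrl
    have hincrement' := abs_zSeq_succ_sub_le hd hB.le hBd hcoeff hincrement
    exact ⟨hincrement', fun z hz => controlled_succ hd hr hD hB1 hctrl hcoeff hincrement' hz⟩

lemma tendsto_weight_zero {s : ℝ} (hs : 0 < s) : Tendsto (weight s 1) atTop (𝓝 0) := by
  refine (tendsto_rpow_neg_atTop hs).comp (tendsto_atTop_add_const_left _ 1 ?_)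
  simpa using tendsto_natCast_atTop_atTop

lemma exists_forall_mem_zInterval (hd : 4 < d) (hB : 0 ≤ B)
    (hsub : ∀ n, zInterval g B (n + 1) ⊆ zInterval g B n) :
    ∃ zc, IsCriticalValue g zc ∧ ∀ n, zc ∈ zInterval g B n := by
  have hmem : ∀ n, ∀ j ≥ n, zSeq g j ∈ zInterval g B n := fun n j hj =>
    antitone_nat_of_succ_le hsub hj (zSeq_mem_zInterval g hB j)
  have hradius : Tendsto (fun n => 2 * B * weight ((d : ℝ) / 2 - 1) 1 n) atTop (𝓝 0) := by
    simpa using (tendsto_weight_zero (by linarith [five_halves_le_half hd])).const_mul (2 * B)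
  have hcauchy : CauchySeq (zSeq g) :=
    cauchySeq_of_le_tendsto_0' _ (fun n j hj => Metric.mem_closedBall'.1 (hmem n j hj)) hradius
  obtain ⟨zc, hzc⟩ := cauchySeq_tendsto_of_complete hcauchy
  exact ⟨zc, hzc, fun n => Metric.isClosed_closedBall.mem_of_tendsto hzc
    (eventually_atTop.2 ⟨n, hmem n⟩)⟩

lemma tendsto_sum_g_zero_of_controlled (hd : 4 < d) (h : ∀ n, 1 ≤ n → Controlled B D g e n z) :
    Tendsto (fun N => ∑ m ∈ Icc 1 N, g m 0 z) atTop (𝓝 1) := by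
  have hweight : Tendsto (fun N => 4 * B * weight ((d : ℝ) / 2 - 1) 1 N) atTop (𝓝 0) := by
    simpa using (tendsto_weight_zero (by linarith [five_halves_le_half hd])).const_mul (4 * B)
  have hdefect : Tendsto (fun N => 1 - ∑ m ∈ Icc 1 N, g m 0 z) atTop (𝓝 0) :=
    squeeze_zero_norm' ((eventually_ge_atTop 1).mono fun N hN => (h N hN).crit) hweight
  simpa using hdefect.const_sub 1

lemma CoeffBootstrap.exists_criticalValue (hboot : CoeffBootstrap B D g e) (hd : 4 < d)
    (hr : Recursion f g e) (hD : AssumptionD ε C c₁ c₂ η L D f e) (hB : 0 < B)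
    (hBd : 6 * 2 ^ ((d : ℝ) / 2) * B ≤ 1) :
    ∃ zc, IsCriticalValue g zc ∧ ∀ n, 1 ≤ n → Controlled B D g e n zc := by
  have hind := hboot.induction hd hr hD hB hBd
  obtain ⟨zc, hzc, hmem⟩ := exists_forall_mem_zInterval (g := g) hd hB.le fun n =>
    zInterval_succ_subset hd hB.le (hind n).1
  refine ⟨zc, hzc, fun n hn => ?_⟩
  obtain ⟨n, rfl⟩ := Nat.exists_eq_add_of_le' hn
  exact (hind n).2 zc (hmem _)

end CriticalValue

section Susceptibility

open Finset

/-- Mertens' theorem on Cauchy products: here `v` need not be absolutely summable. -/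
lemma tendsto_sum_range_antidiagonal {u v : ℕ → ℝ} {V : ℝ} (hu : Summable fun n => |u n|)
    (hv : Tendsto (fun N => ∑ n ∈ range N, v n) atTop (𝓝 V)) :
    Tendsto (fun N => ∑ n ∈ range N, ∑ p ∈ antidiagonal n, u p.1 * v p.2) atTop
      (𝓝 ((∑' n, u n) * V)) := by
  obtain ⟨b, hb⟩ := (Metric.isBounded_range_of_tendsto _ hv).exists_norm_le
  have hlim := tendsto_tsum_of_dominated_convergence (𝓕 := atTop)
    (f := fun (N : ℕ) j => u j * ∑ i ∈ range (N - j), v i) (bound := fun j => |u j| * b)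
    (hu.mul_right b) (fun j => (hv.comp (tendsto_sub_atTop_nat j)).const_mul (u j))
    (.of_forall fun N j => by
      rw [Real.norm_eq_abs, abs_mul]
      exact mul_le_mul_of_nonneg_left (hb _ ⟨N - j, rfl⟩) (abs_nonneg _))
  rw [tsum_mul_right] at hlim
  refine hlim.congr fun N => ?_
  have hdiag : ∑ n ∈ range N, ∑ p ∈ antidiagonal n, u p.1 * v p.2 =
      ∑ j ∈ range N, u j * ∑ i ∈ range (N - j), v i := by
    simp only [Nat.sum_antidiagonal_eq_sum_range_succ_mk, mul_sum]
    exact sum_range_diag_flip N fun i j => u i * v j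
  rw [hdiag]
  refine tsum_eq_sum fun j hj => ?_
  rw [Nat.sub_eq_zero_of_le (not_lt.1 (mem_range.not.1 hj)), sum_range_zero, mul_zero]

variable {d : ℕ} {f g e : ℕ → Dual d → ℝ → ℝ} {ε C c₁ c₂ η L B z : ℝ} {D : (Fin d → ℤ) → ℝ}

lemma summable_abs_kernelSeq (hd : 4 < d) (hcoeff : ∀ m, 2 ≤ m → CoeffBounds B D g e m z) :
    Summable fun n => |kernelSeq g 0 z n| := by
  have hθ := five_halves_le_half hd
  have hweight : Summable fun n => weight ((d : ℝ) / 2) 1 n :=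
    summable_of_sum_range_le (fun n => (weight_pos _ zero_le_one n).le)
      (sum_range_weight_le_three_div (by linarith) one_pos le_rfl)
  rw [← summable_nat_add_iff 2]
  refine .of_nonneg_of_le (fun n => abs_nonneg _) (fun n => ?_)
    (((summable_nat_add_iff 2).2 hweight).mul_left B)
  rw [kernelSeq_of_pos g 0 z (by omega)]
  exact (hcoeff (n + 2) (by omega)).g_sup 0 zero_mem_cube

lemma tendsto_sum_Icc_g_zero (hd : 4 < d) (hcoeff : ∀ m, 2 ≤ m → CoeffBounds B D g e m z) :
    Tendsto (fun N => ∑ m ∈ Icc 1 N, g m 0 z) atTop (𝓝 (∑' n, kernelSeq g 0 z n)) := by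
  have hsum := (summable_abs_kernelSeq hd hcoeff).of_abs.hasSum.tendsto_sum_nat
  simpa only [Function.comp_def, sum_range_kernelSeq] using hsum.comp (tendsto_add_atTop_nat 1)

lemma abs_sum_range_sourceSeq_sub_one_le (hd : 4 < d) (hD : AssumptionD ε C c₁ c₂ η L D f e)
    (hz : 0 < z) (hB : 0 ≤ B) (hcoeff : ∀ m, 2 ≤ m → CoeffBounds B D g e m z) {N : ℕ}
    (hN : 2 ≤ N) : |∑ n ∈ range N, sourceSeq e 0 z n - 1| ≤ 3 * B := by
  have hsplit : ∑ n ∈ range N, sourceSeq e 0 z n - 1 = ∑ m ∈ Ico 2 N, e m 0 z := by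
    rw [← sum_range_add_sum_Ico _ hN, sum_range_succ, sum_range_one,
      sourceSeq_of_pos e 0 z le_rfl, hD.e_one z hz 0 zero_mem_cube, sourceSeq, if_pos rfl,
      add_zero, add_sub_cancel_left]
    exact sum_congr rfl fun m hm => sourceSeq_of_pos e 0 z (by linarith [(mem_Ico.1 hm).1])
  calc |∑ n ∈ range N, sourceSeq e 0 z n - 1|
      ≤ ∑ m ∈ Ico 2 N, B * weight ((d : ℝ) / 2) 1 m := by
        rw [hsplit]
        exact (abs_sum_le_sum_abs _ _).trans <| sum_le_sum fun m hm =>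
          (hcoeff m (mem_Ico.1 hm).1).e_sup 0 zero_mem_cube
    _ ≤ ∑ m ∈ Icc 2 N, B * weight ((d : ℝ) / 2) 1 m :=
        sum_le_sum_of_subset_of_nonneg Ico_subset_Icc_self fun m _ _ =>
          mul_nonneg hB (weight_pos _ zero_le_one m).le
    _ ≤ B * 3 := by
        rw [← mul_sum]
        gcongr
        exact sum_Icc_two_weight_le (by linarith [five_halves_le_half hd]) N
    _ = 3 * B := mul_comm _ _

lemma HasSusceptibility.mul_one_sub_mem_Icc {χ : ℝ} (hχ : HasSusceptibility f z χ) (hd : 4 < d)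
    (hr : Recursion f g e) (hD : AssumptionD ε C c₁ c₂ η L D f e) (hz : 0 < z) (hB : 0 ≤ B)
    (hB1 : 6 * B ≤ 1) (hcoeff : ∀ m, 2 ≤ m → CoeffBounds B D g e m z) :
    χ * (1 - ∑' n, kernelSeq g 0 z n) ∈ Set.Icc (1 / 2 : ℝ) (3 / 2) := by
  have hsource : Tendsto (fun N => ∑ n ∈ range N, sourceSeq e 0 z n) atTop
      (𝓝 (χ * (1 - ∑' n, kernelSeq g 0 z n))) := by
    have hlim := hχ.sub (tendsto_sum_range_antidiagonal (summable_abs_kernelSeq hd hcoeff) hχ)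
    rw [mul_one_sub, mul_comm χ]
    refine hlim.congr fun N => ?_
    rw [← sum_sub_distrib]
    exact sum_congr rfl fun n _ => sub_eq_of_eq_add' (hr.eq_antidiagonal hz zero_mem_cube n)
  have hbound := abs_le.1 <| le_of_tendsto (hsource.sub_const 1).abs <|
    (eventually_ge_atTop 2).mono fun N hN =>
      abs_sum_range_sourceSeq_sub_one_le hd hD hz hB hcoeff hN
  constructor <;> linarith

lemma sub_le_two_mul_sum_g_zero_sub (hd : 4 < d) (hr : Recursion f g e)
    (hD : AssumptionD ε C c₁ c₂ η L D f e) (hB : 0 ≤ B) (hB1 : 6 * B ≤ 1) {zc : ℝ}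
    (hcoeff : ∀ z ∈ Set.Ioc 0 zc, ∀ m, 2 ≤ m → CoeffBounds B D g e m z) (hz : z ∈ Set.Ioc 0 zc)
    {N : ℕ} (hN : 1 ≤ N) :
    zc - z ≤ 2 * (∑ m ∈ Icc 1 N, g m 0 zc - ∑ m ∈ Icc 1 N, g m 0 z) := by
  have hzc : 0 < zc := hz.1.trans_le hz.2
  have hgap : 0 ≤ zc - z := sub_nonneg.2 hz.2
  have hsum := abs_sum_g_zero_sub_le (N := N) hd hB Set.ordConnected_Ioc
    (fun w hw m _ hm => hcoeff w hw m hm) (Set.right_mem_Ioc.2 hzc) hz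
  rw [abs_of_nonneg hgap] at hsum
  rw [hD.sum_Icc_one_g_zero hr hz.1 hN, hD.sum_Icc_one_g_zero hr hzc hN]
  nlinarith [(abs_le.1 hsum).1]

lemma criticalValue_eq (hd : 4 < d) (hr : Recursion f g e)
    (hD : AssumptionD ε C c₁ c₂ η L D f e) (hB : 0 ≤ B) (hB1 : 6 * B ≤ 1) {zc pc : ℝ}
    (hzc : 0 < zc) (hcrit : Tendsto (fun N => ∑ m ∈ Icc 1 N, g m 0 zc) atTop (𝓝 1))
    (hcoeff : ∀ z ∈ Set.Ioc 0 zc, ∀ m, 2 ≤ m → CoeffBounds B D g e m z) (hpc : 0 < pc)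
    {χ : ℝ → ℝ} (hχ : ∀ z ∈ Set.Ioo 0 pc, HasSusceptibility f z (χ z) ∧ 0 < χ z)
    (hdiv : Tendsto χ (𝓝[<] pc) atTop) : zc = pc := by
  have hmul : ∀ z ∈ Set.Ioo 0 pc, z ≤ zc →
      χ z * (1 - ∑' n, kernelSeq g 0 z n) ∈ Set.Icc (1 / 2 : ℝ) (3 / 2) := fun z hz hzzc =>
    (hχ z hz).1.mul_one_sub_mem_Icc hd hr hD hz.1 hB hB1 (hcoeff z ⟨hz.1, hzzc⟩)
  refine le_antisymm (le_of_not_gt fun hlt => ?_) (le_of_not_gt fun hlt => ?_)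
  · -- If `pc < zc`, the mass stays away from `1` below `pc`, so `χ` cannot diverge there.
    have hbound : ∀ z ∈ Set.Ioo 0 pc, χ z ≤ 3 / (zc - pc) := by
      intro z hz
      have hz' : z ∈ Set.Ioc 0 zc := ⟨hz.1, (hz.2.trans hlt).le⟩
      have hgap : zc - z ≤ 2 * (1 - ∑' n, kernelSeq g 0 z n) :=
        ge_of_tendsto ((hcrit.sub (tendsto_sum_Icc_g_zero hd (hcoeff z hz'))).const_mul 2)
          ((eventually_ge_atTop 1).mono fun N hN =>
            sub_le_two_mul_sum_g_zero_sub hd hr hD hB hB1 hcoeff hz' hN)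
      rw [le_div_iff₀ (sub_pos.2 hlt)]
      nlinarith [(hmul z hz hz'.2).2, (hχ z hz).2, hz.2]
    obtain ⟨z, hlarge, hz⟩ :=
      ((hdiv.eventually_gt_atTop (3 / (zc - pc))).and (Ioo_mem_nhdsLT hpc)).exists
    exact (hbound z hz).not_gt hlarge
  · -- If `zc < pc`, the mass at `zc` is `1`, which is incompatible with a finite susceptibility.
    have hmass := tendsto_nhds_unique (tendsto_sum_Icc_g_zero hd (hcoeff zc ⟨hzc, le_rfl⟩)) hcrit
    have hhalf := (hmul zc ⟨hzc, hlt⟩ le_rfl).1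
    rw [hmass, sub_self, mul_zero] at hhalf
    norm_num at hhalf

end Susceptibility

end LaceRec

end

theorem theorem1p2 (d : ℕ) (hd : 4 < d)
    (ε C c₁ c₂ η α : ℝ) (hε : 0 < ε) (hc₁ : 0 < c₁) (hc₂ : 0 < c₂) (hη : 0 < η)
    (hα : α ∈ Set.Ioo (0 : ℝ) 1) (Ce Cg L₁ : ℝ → ℝ) :
    ∃ L₀ : ℝ, ∀ L : ℝ, L₀ ≤ L →
      ∀ (D : (Fin d → ℤ) → ℝ) (f g e : ℕ → LaceRec.Dual d → ℝ → ℝ),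
        LaceRec.Recursion f g e →
        LaceRec.AssumptionS f g e →
        LaceRec.AssumptionD ε C c₁ c₂ η L D f e →
        LaceRec.AssumptionE α Ce L₁ L D f e →
        LaceRec.AssumptionG α ε Cg L₁ L D f g →
        ∃ zc : ℝ, LaceRec.IsCriticalValue g zc ∧
          ∀ (pc : ℝ) (χ : ℝ → ℝ), 0 < pc →
            (∀ z ∈ Set.Ioo 0 pc, LaceRec.HasSusceptibility f z (χ z) ∧ 0 < χ z) →
            Tendsto χ (𝓝[<] pc) atTop →
            LaceRec.UniformEG ε Ce Cg L₁ L D f g e zc →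
            zc = pc := by
  obtain ⟨K, b, hK, hb, hb12, hF⟩ := LaceRec.exists_fBounds hd C hc₁ hη
  obtain ⟨Γ, hΓ, hCe, hCg⟩ : ∃ Γ, 0 < Γ ∧ Ce K ≤ Γ ∧ Cg K ≤ Γ :=
    ⟨max 1 (max (Ce K) (Cg K)), by simp⟩
  obtain ⟨L₀, hL₀⟩ := eventually_atTop.1 <| (eventually_gt_atTop 0).and <|
    (eventually_ge_atTop (L₁ K)).and <| LaceRec.eventually_coeffConst_le (d := d) (by omega) Γ <|
      show 0 < min b (min (α / 2) (1 / (6 * 2 ^ ((d : ℝ) / 2)))) from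
        lt_min hb (lt_min (half_pos hα.1) (by positivity))
  refine ⟨L₀, fun L hL D f g e hr hS hD hE hG => ?_⟩
  obtain ⟨hL, hLK, hB⟩ := hL₀ L hL
  obtain ⟨hBb, hBα, hBd⟩ := by simpa only [le_min_iff] using hB
  rw [le_div_iff₀' (by positivity)] at hBα hBd
  have hBpos := LaceRec.coeffConst_pos d hΓ hL
  have hboot := LaceRec.coeffBootstrap_of_assumptions hd hε.le hS hD hE hG hK hLK hL hΓ.le hCe hCg
    hBα fun hctrl => hF hL hr hS hD hctrl hBb
  obtain ⟨zc, hzc, hctrl⟩ := hboot.exists_criticalValue hd hr hD hBpos hBd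
  have hzc0 : 0 < zc := by linarith [((hctrl 1 le_rfl).mem_Icc (by linarith)).1]
  refine ⟨zc, hzc, fun pc χ hpc hχ hdiv hEG => ?_⟩
  have hcoeff := hEG.coeffBounds hd hε.le hS hD hK hLK hL hΓ.le hCe hCg fun n hn =>
    hF hL hr hS hD (hctrl n hn) hBb n le_rfl hn
  exact LaceRec.criticalValue_eq hd hr hD hBpos.le (by linarith) hzc0
    (LaceRec.tendsto_sum_g_zero_of_controlled hd hctrl) hcoeff hpc hχ hdiv
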